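/- **Notation.** $\mathbb R^{m\times n}$ and $\mathbb R^{m\times n}\times\mathbb R^{m\times n}$ carry the Euclidean norm; $\rho=(\rho^1,\rho^2)$ is an element of the latter, and $\mathbb B_r$, $\bar{\mathbb B}_r$ are its open and closed balls of radius $r$ about $0$. Points of $\mathbb R^{n+1}$ are $(x,t)$, $x\in\mathbb R^n$; $D$ and $\operatorname{div}$ (by rows) act in $x$; $|\cdot|$ of a set is Lebesgue measure; $[\alpha,\beta]$ is a closed segment. A cube is an open cube with sides parallel to the axes, and $\mathrm{rad}(Q)$ is half its side length. For $G$ open, $C^1(\bar G)$ consists of the functions that are $C^1$ in $G$ and extend continuously to $\bar G$ together with their first derivatives, and $C_0^\infty(G)$ of the smooth functions with compact support in $G$. A set $\{(Du,\partial_tv)\in A\}$ means $\{y\in G:(Du(y),\partial_tv(y))\in A\}$. Put $$\Gamma=\{(p\otimes a,B): p\in\mathbb R^m,\ a\in\mathbb R^n\setminus\{0\},\ B\in\mathbb R^{m\times n},\ Ba=0\}.$$ **Condition $O_N$.** A continuous $\sigma:\mathbb R^{m\times n}\to\mathbb R^{m\times n}$ with graph $\mathcal K=\{(A,\sigma(A))\}$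 satisfies Condition $O_N$ if there are $r_0>0$, $0<\delta_1<\delta_2<1$ and continuous $(\kappa_i,\gamma_i):\bar{\mathbb B}_{r_0}\to[1/\delta_2,1/\delta_1]\times\Gamma$ $(1\le i\le N)$ with $\gamma_1+\dots+\gamma_N\equiv0$ such that, with $\pi_i(\rho)=\rho+\sum_{k<i}\gamma_k(\rho)$ and $\xi_i(\rho)=\pi_i(\rho)+\kappa_i(\rho)\gamma_i(\rho)$: * (P1) $\xi_i(\rho)\in\mathcal K$ for all $\rho\in\bar{\mathbb B}_{r_0}$ and all $i$, and $\xi_i^1(\bar{\mathbb B}_{r_0})\cap\xi_j^1(\bar{\mathbb B}_{r_0})=\pi_i^1(\bar{\mathbb B}_{r_0})\cap\pi_j^1(\bar{\mathbb B}_{r_0})=\emptyset$ for $i\ne j$; * (P2) with $S_i^r(\lambda)=\{\lambda\xi_i(\rho)+(1-\lambda)\pi_i(\rho):\rho\in\mathbb B_r\}$ there is $\delta_0\in(\delta_2,1)$ such that for all $0<r\le r_0$ and $\lambda\in\{0\}\cup[\delta_0,1)$ the sets $S_1^r(\lambda),\dots,S_N^r(\lambda)$ are open and pairwise disjoint. For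 such data let $S^r(\lambda)=\bigcup_iS_i^r(\lambda)$, let $L_i^r(\lambda)$ be the union of the segments $[\alpha,\beta]$ with $\alpha\in S_i^r(\lambda)$, $\beta\in S_i^r(0)$, $\alpha-\beta\in\Gamma$, let $L^r(\lambda)=\bigcup_iL_i^r(\lambda)$, and for $\delta_0\le\lambda<1$ let $\Sigma^r(\lambda)=\bigcup_{\delta_0\le\lambda'\le\lambda}L^r(\lambda')$; let $\Sigma(1)=\bigcup_{\delta_0\le\lambda<1}\Sigma^{r_0}(\lambda)$. **Theorem 4.1 (stage theorem for convex integration).** Let $m,n\ge1$ and $N\ge2$, and let $\sigma$ satisfy Condition $O_N$, with data as above. Let $G\subset\mathbb R^{n+1}$ be a nonempty bounded open set, let $0<r<r_0$ and $\delta_0\le\lambda<1$, and let $(u,v)\in C^1(\bar G;\mathbb R^m\times\mathbb R^{m\times n})$ satisfy $$u=\operatorname{div}v\quad\text{and}\quad(Du,\partial_tv)\in\Sigma^r(\lambda)\quad\text{on }\bar G.$$ Then for all $\lambda<\mu<1$, $r<s<r_0$ and $0<\epsilon<1$ there exist $(\tilde u,\tilde v)\in(u,v)+C_0^\infty(G;\mathbb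 R^m\times\mathbb R^{m\times n})$ and finitely many disjoint cubes $Q_1,\dots,Q_M\subset G$ with $|G\setminus\bigcup_jQ_j|<\epsilon|G|$ such that: * (a) $0<\mathrm{rad}(Q_j)<\epsilon$ for all $j$; * (b) $\tilde u=\operatorname{div}\tilde v$ and $(D\tilde u,\partial_t\tilde v)\in\Sigma^s(\mu)$ on $\bar G$; * (c) $\|\tilde u-u\|_{L^\infty(G)}+\|\partial_t\tilde u-\partial_tu\|_{L^\infty(G)}<\epsilon$; * (d) $|Q_j\cap\{(D\tilde u,\partial_t\tilde v)\in S^s(\mu)\}|\ge(1-\epsilon)|Q_j|$ for all $j$; * (e) $|\{(D\tilde u,\partial_t\tilde v)\in S^s(\mu)\}|\ge(1-\epsilon)|G|$; * (f) for all $1\le k\le N$, $|\{(D\tilde u,\partial_t\tilde v)\in S_k^s(\mu)\}|\ge\tfrac12(\mu-\lambda)(\mu-\delta_2)^{N-1}\delta_1|G|$ and $|\{(D\tilde u,\partial_t\tilde v)\in S_k^s(\mu)\}|\ge\tfrac\lambda\mu\,|\{(Du,\partial_tv)\in S_k^r(\lambda)\}|$; * (g) $\|D\tilde u-Du\|_{L^1(G)}\le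 C_0\big[|F_0|+(\epsilon+(\mu-\lambda))|G|\big]$, where $F_0=\{(Du,\partial_tv)\notin S^r(\lambda)\}$ and $C_0>0$ is a constant depending only on $\delta_0$ and the diameter of $\Sigma(1)$. -/

import Mathlib

open MeasureTheory Set Topology
open scoped ContDiff

/-- Space-time `ℝ^{n+1}`, with points `y = (x, t)`. Only the topology, the differentiable structure
and Lebesgue measure of this space are used, never its norm. -/
abbrev SpaceTime (n : ℕ) : Type := (Fin n → ℝ) × ℝ

/-- `ℝ^{m×n}` with the Euclidean (Frobenius) norm; the `(i,j)` entry of `A` is `A (i, j)`. -/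
abbrev Mat (m n : ℕ) : Type := EuclideanSpace ℝ (Fin m × Fin n)

/-- `ℝ^{m×n} × ℝ^{m×n}` with the Euclidean norm `|(A,B)|² = |A|² + |B|²`. -/
abbrev MatPair (m n : ℕ) : Type := WithLp 2 (Mat m n × Mat m n)

/-- The tensor product `p ⊗ a`, with entries `p_i a_j`. -/
def tensor {m n : ℕ} (p : EuclideanSpace ℝ (Fin m)) (a : EuclideanSpace ℝ (Fin n)) : Mat m n :=
  WithLp.toLp 2 fun ij => p ij.1 * a ij.2

/-- The wave cone `Γ = {(p ⊗ a, B) : a ≠ 0, B a = 0}`. -/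
def waveCone (m n : ℕ) : Set (MatPair m n) :=
  {g | ∃ (p : EuclideanSpace ℝ (Fin m)) (a : EuclideanSpace ℝ (Fin n)) (B : Mat m n),
    a ≠ 0 ∧ (∀ i, ∑ j, B (i, j) * a j = 0) ∧ g = WithLp.toLp 2 (tensor p a, B)}

/-- The graph `𝒦 = {(A, σ(A))}`. -/
def graphSet {m n : ℕ} (σ : Mat m n → Mat m n) : Set (MatPair m n) :=
  {ξ | ∃ A : Mat m n, ξ = WithLp.toLp 2 (A, σ A)}

/-- The numbers and the functions whose existence Condition `O_N` requires. The functions `κ_i`,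
`γ_i` matter only on the closed ball of radius `r₀` about the origin. -/
structure ONData (m n N : ℕ) where
  r₀ : ℝ
  δ₀ : ℝ
  δ₁ : ℝ
  δ₂ : ℝ
  κ : Fin N → MatPair m n → ℝ
  γ : Fin N → MatPair m n → MatPair m n

namespace ONData

variable {m n N : ℕ}

/-- `π_i(ρ) = ρ + γ_1(ρ) + ⋯ + γ_{i-1}(ρ)`. -/
noncomputable def vertex (d : ONData m n N) (i : Fin N) (ρ : MatPair m n) : MatPair m n :=
  ρ + ∑ k ∈ Finset.univ.filter (fun k : Fin N => k < i), d.γ k ρ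

/-- `ξ_i(ρ) = π_i(ρ) + κ_i(ρ) γ_i(ρ)`. -/
noncomputable def endpoint (d : ONData m n N) (i : Fin N) (ρ : MatPair m n) : MatPair m n :=
  d.vertex i ρ + d.κ i ρ • d.γ i ρ

/-- `S_i^r(lam) = {lam ξ_i(ρ) + (1 - lam) π_i(ρ) : |ρ| < r}`. -/
def Si (d : ONData m n N) (i : Fin N) (r lam : ℝ) : Set (MatPair m n) :=
  (fun ρ => lam • d.endpoint i ρ + (1 - lam) • d.vertex i ρ) '' Metric.ball 0 r

/-- `S^r(lam) = ⋃_i S_i^r(lam)`. -/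
def S (d : ONData m n N) (r lam : ℝ) : Set (MatPair m n) :=
  ⋃ i : Fin N, d.Si i r lam

/-- `L_i^r(lam)`: the union of the closed segments `[α, β]` with `α ∈ S_i^r(lam)`,
`β ∈ S_i^r(0)` and `α - β ∈ Γ`. -/
def Li (d : ONData m n N) (i : Fin N) (r lam : ℝ) : Set (MatPair m n) :=
  {Y | ∃ α ∈ d.Si i r lam, ∃ β ∈ d.Si i r 0, α - β ∈ waveCone m n ∧ Y ∈ segment ℝ α β}

/-- `L^r(lam) = ⋃_i L_i^r(lam)`. -/
def L (d : ONData m n N) (r lam : ℝ) : Set (MatPair m n) :=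
  ⋃ i : Fin N, d.Li i r lam

/-- `Σ^r(lam)`: the union of `L^r(lam')` over `δ₀ ≤ lam' ≤ lam`. -/
def Sig (d : ONData m n N) (r lam : ℝ) : Set (MatPair m n) :=
  ⋃ lam' ∈ Icc d.δ₀ lam, d.L r lam'

/-- `Σ(1)`: the union of `Σ^{r₀}(lam)` over `δ₀ ≤ lam < 1`. -/
def SigOne (d : ONData m n N) : Set (MatPair m n) :=
  ⋃ lam ∈ Ico d.δ₀ 1, d.Sig d.r₀ lam

/-- The data `d` witness Condition `O_N` for the function `σ`. -/
structure Witnesses (d : ONData m n N) (σ : Mat m n → Mat m n) : Prop where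
  continuous_sigma : Continuous σ
  r₀_pos : 0 < d.r₀
  δ₁_pos : 0 < d.δ₁
  δ₁_lt_δ₂ : d.δ₁ < d.δ₂
  δ₂_lt_one : d.δ₂ < 1
  δ₀_mem : d.δ₀ ∈ Ioo d.δ₂ 1
  κ_continuousOn : ∀ i, ContinuousOn (d.κ i) (Metric.closedBall 0 d.r₀)
  γ_continuousOn : ∀ i, ContinuousOn (d.γ i) (Metric.closedBall 0 d.r₀)
  κ_mem : ∀ i, ∀ ρ ∈ Metric.closedBall (0 : MatPair m n) d.r₀,
    d.κ i ρ ∈ Icc (1 / d.δ₂) (1 / d.δ₁)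
  γ_mem : ∀ i, ∀ ρ ∈ Metric.closedBall (0 : MatPair m n) d.r₀, d.γ i ρ ∈ waveCone m n
  γ_sum : ∀ ρ ∈ Metric.closedBall (0 : MatPair m n) d.r₀, ∑ i, d.γ i ρ = 0
  endpoint_mem : ∀ i, ∀ ρ ∈ Metric.closedBall (0 : MatPair m n) d.r₀,
    d.endpoint i ρ ∈ graphSet σ
  endpoint_fst_disjoint : ∀ i j, i ≠ j →
    Disjoint ((fun ρ => (d.endpoint i ρ).fst) '' Metric.closedBall 0 d.r₀)
      ((fun ρ => (d.endpoint j ρ).fst) '' Metric.closedBall 0 d.r₀)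
  vertex_fst_disjoint : ∀ i j, i ≠ j →
    Disjoint ((fun ρ => (d.vertex i ρ).fst) '' Metric.closedBall 0 d.r₀)
      ((fun ρ => (d.vertex j ρ).fst) '' Metric.closedBall 0 d.r₀)
  Si_isOpen : ∀ r lam : ℝ, 0 < r → r ≤ d.r₀ → (lam = 0 ∨ lam ∈ Ico d.δ₀ 1) →
    ∀ i, IsOpen (d.Si i r lam)
  Si_disjoint : ∀ r lam : ℝ, 0 < r → r ≤ d.r₀ → (lam = 0 ∨ lam ∈ Ico d.δ₀ 1) →
    ∀ i j, i ≠ j → Disjoint (d.Si i r lam) (d.Si j r lam)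

end ONData

section Calculus

variable {m n : ℕ} {F : Type*} [NormedAddCommGroup F] [NormedSpace ℝ F]

/-- `f ∈ C¹(closure G)`: `f` is continuous on the closure of the open set `G`, differentiable in
`G`, and its derivative in `G` extends continuously to the closure of `G`. -/
def IsC1Closure (G : Set (SpaceTime n)) (f : SpaceTime n → F) : Prop :=
  ContinuousOn f (closure G) ∧
    ∃ f' : SpaceTime n → SpaceTime n →L[ℝ] F,
      ContinuousOn f' (closure G) ∧ ∀ y ∈ G, HasFDerivAt f (f' y) y

/-- The total derivative of `f` in the open set `G`, extended by continuity to the closure. -/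
noncomputable def clDeriv (G : Set (SpaceTime n)) (f : SpaceTime n → F) :
    SpaceTime n → SpaceTime n →L[ℝ] F :=
  extendFrom G (fderiv ℝ f)

/-- On the closure of `G`, `clDeriv G f` is the continuous extension of the derivative. -/
theorem clDeriv_eq {G : Set (SpaceTime n)} {f : SpaceTime n → F}
    {f' : SpaceTime n → SpaceTime n →L[ℝ] F} (hc : ContinuousOn f' (closure G))
    (hd : ∀ y ∈ G, HasFDerivAt f (f' y) y) {y : SpaceTime n} (hy : y ∈ closure G) :
    clDeriv G f y = f' y := by
  refine extendFrom_eq hy ?_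
  refine ((hc y hy).mono subset_closure).congr' ?_
  filter_upwards [self_mem_nhdsWithin] with z hz
  exact (hd z hz).fderiv.symm

/-- The time derivative `∂_t f`, on the closure of `G`. -/
noncomputable def timeDeriv (G : Set (SpaceTime n)) (f : SpaceTime n → F) (y : SpaceTime n) : F :=
  clDeriv G f y (0, 1)

/-- The partial derivative `∂f/∂x_j`, on the closure of `G`. -/
noncomputable def spaceDeriv (G : Set (SpaceTime n)) (f : SpaceTime n → F) (j : Fin n)
    (y : SpaceTime n) : F :=
  clDeriv G f y (Pi.single j 1, 0)

/-- The spatial gradient `(Du)_{ij} = ∂u_i/∂x_j`, on the closure of `G`. -/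
noncomputable def spaceGrad (G : Set (SpaceTime n)) (u : SpaceTime n → EuclideanSpace ℝ (Fin m))
    (y : SpaceTime n) : Mat m n :=
  WithLp.toLp 2 fun ij => spaceDeriv G u ij.2 y ij.1

/-- The spatial divergence by rows, `(div v)_i = ∑_j ∂v_{ij}/∂x_j`, on the closure of `G`. -/
noncomputable def spaceDiv (G : Set (SpaceTime n)) (v : SpaceTime n → Mat m n)
    (y : SpaceTime n) : EuclideanSpace ℝ (Fin m) :=
  WithLp.toLp 2 fun i => ∑ j, spaceDeriv G v j y (i, j)

/-- The pair `(Du, ∂_t v)`, on the closure of `G`. -/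
noncomputable def diffPair (G : Set (SpaceTime n)) (u : SpaceTime n → EuclideanSpace ℝ (Fin m))
    (v : SpaceTime n → Mat m n) (y : SpaceTime n) : MatPair m n :=
  WithLp.toLp 2 (spaceGrad G u y, timeDeriv G v y)

/-- `f ∈ C_0^∞(G)`: smooth, with compact support contained in `G`. -/
def IsTestFun (G : Set (SpaceTime n)) (f : SpaceTime n → F) : Prop :=
  ContDiff ℝ ∞ f ∧ HasCompactSupport f ∧ tsupport f ⊆ G

end Calculus

/-- The open cube in `ℝ^{n+1}` with sides parallel to the axes, centre `c` and side length `2l`. -/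
def cube {n : ℕ} (c : SpaceTime n) (l : ℝ) : Set (SpaceTime n) :=
  {y | (∀ i, |y.1 i - c.1 i| < l) ∧ |y.2 - c.2| < l}

/-! ### One-dimensional oscillating profiles. -/

section Profile

/-! The equation `u = div v` survives every perturbation `(u + div w, v + w)`, which shifts `(Du,
∂_t v)` by `pairField w = (D div w, ∂_t w)`. So the task is to find test fields `w` that prescribe
the distribution of `pairField w` while `div w` and `∂_t div w` stay small.

The building block is `exists_localized_planeWave`. For `g = (p ⊗ a, B)` in the wave cone, `w` is a
multiple of `Φ p ⊗ a` plus a first order operator applied to `Φ` that is divergence free because its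
coefficients are antisymmetric. With `Φ` oscillating rapidly along the form `a · x + s t`,
`pairField w` takes values close to `(1 - θ) g` and `-θ g` on proportions close to `θ` and `1 - θ`.
The main part of `∂_t div w` is proportional to `s p`, hence harmless for small `s`. Superposing
further waves in the open sets where the values are nearly constant iterates the splitting
(`Realizes.split`): finite laminates along wave cone directions are realized approximately.

Condition `O_N` supplies the laminates. Since `π_{i+1} = π_i + γ_i` cyclically, each vertex lies on
the segment from the preceding vertex to the ray point of parameter `mu` above that vertex
(`exists_weight`). Going around the cycle moves all but an arbitrarily small mass to the sets
`S_k^s(mu)`, and each `k` receives at least `(mu - δ₂)^(N-1) δ₁` within one turn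
(`exists_realizes_vertex`). A point of `Σ^r(lam)` splits into a vertex and a ray point of parameter
`lam' ≤ lam`, and the latter sends the fraction `lam' / mu` straight up its ray and the rest to its
vertex.

By continuity of `(Du, ∂_t v)`, a laminate for its value at `x` perturbs the field in all small
cubes about `x`. Two kinds of points suffice: those in the open set where the field lies in
`S^r(lam)`, and density points of the complement (`ae_eventually_isStage`). A Besicovitch covering
by disjoint cubes, truncated to finitely many, gives the global field. The leftover measure is
absorbed by the strictly positive gain `stageWeight`, so (f) holds with no error term. -/

/-- A smooth `1`-periodic function of mean zero has a smooth `1`-periodic primitive of mean zero. -/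
theorem exists_periodic_primitive {f : ℝ → ℝ} (hf : ContDiff ℝ ∞ f)
    (hp : Function.Periodic f 1) (h0 : ∫ x in (0 : ℝ)..1, f x = 0) :
    ∃ F : ℝ → ℝ, ContDiff ℝ ∞ F ∧ Function.Periodic F 1 ∧ (∀ x, HasDerivAt F (f x) x) ∧
      ∫ x in (0 : ℝ)..1, F x = 0 := by
  have hc : Continuous f := hf.continuous
  set I : ℝ → ℝ := fun x => ∫ t in (0 : ℝ)..x, f t with hI
  have hd : ∀ x, HasDerivAt I (f x) x := fun x =>
    intervalIntegral.integral_hasDerivAt_right (hc.intervalIntegrable _ _)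
      hc.aestronglyMeasurable.stronglyMeasurableAtFilter hc.continuousAt
  have hIc : Continuous I := continuous_iff_continuousAt.2 fun x => (hd x).continuousAt
  have hIp : Function.Periodic I 1 := by
    intro x
    have h1 : I (x + 1) - I x = ∫ t in x..(x + 1), f t :=
      intervalIntegral.integral_interval_sub_left (hc.intervalIntegrable _ _)
        (hc.intervalIntegrable _ _)
    have h2 := hp.intervalIntegral_add_eq x 0
    rw [zero_add, h0] at h2
    linarith
  refine ⟨fun x => I x - ∫ t in (0 : ℝ)..1, I t, ?_, ?_, ?_, ?_⟩
  · refine contDiff_infty_iff_deriv.2 ⟨fun x => ((hd x).sub_const _).differentiableAt, ?_⟩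
    have : deriv (fun x => I x - ∫ t in (0 : ℝ)..1, I t) = f :=
      funext fun x => ((hd x).sub_const _).deriv
    rwa [this]
  · intro x
    simp only [hIp x]
  · exact fun x => (hd x).sub_const _
  · rw [intervalIntegral.integral_sub (hIc.intervalIntegrable _ _) (by simp)]
    simp

/-- A smooth `1`-periodic function with values in `[0, 1]` which, up to a small proportion, takes
the value `1` with frequency `θ` and the value `0` with frequency `1 - θ`. -/
theorem exists_periodic_profile {θ η : ℝ} (h0 : 0 ≤ θ) (h1 : θ ≤ 1) (hη : 0 < η) :
    ∃ g : ℝ → ℝ, ContDiff ℝ ∞ g ∧ Function.Periodic g 1 ∧ (∀ x, 0 ≤ g x ∧ g x ≤ 1) ∧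
      θ - η ≤ ∫ x in (0 : ℝ)..1, ({x | g x = 1}.indicator (fun _ => (1 : ℝ))) x ∧
      1 - θ - η ≤ ∫ x in (0 : ℝ)..1, ({x | g x = 0}.indicator (fun _ => (1 : ℝ))) x := by
  -- If `θ ≤ η` the zero profile already meets both bounds; otherwise `0 < θ - η < θ`, so the two
  -- cosine thresholds below are distinct.
  by_cases hθ : θ ≤ η
  · refine ⟨fun _ => 0, contDiff_const, fun _ => rfl, fun _ => by simp, ?_, ?_⟩
    · simpa using hθ
    · simp
      linarith
  push Not at hθ
  have hπ := Real.pi_pos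
  set c := Real.cos (Real.pi * θ) with hc
  set c' := Real.cos (Real.pi * (θ - η)) with hc'
  have hcc : 0 < c' - c := by
    have : c < c' := by
      apply Real.cos_lt_cos_of_nonneg_of_le_pi <;> nlinarith
    linarith
  -- Over one period, `cos (2πx) ≥ c'` on an interval of length `θ - η` about `0`, and `cos (2πx) ≤
  -- c` on one of length `1 - θ`; the smooth transition takes place between the two thresholds.
  set g : ℝ → ℝ := fun x => Real.smoothTransition ((Real.cos (2 * Real.pi * x) - c) / (c' - c))
    with hg
  have hgs : ContDiff ℝ ∞ g := by
    apply Real.smoothTransition.contDiff.comp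
    fun_prop
  have hgp : Function.Periodic g 1 := by
    intro x
    simp only [hg]
    rw [show 2 * Real.pi * (x + 1) = 2 * Real.pi * x + 2 * Real.pi by ring, Real.cos_add_two_pi]
  have hg01 : ∀ x, 0 ≤ g x ∧ g x ≤ 1 := fun x =>
    ⟨Real.smoothTransition.nonneg _, Real.smoothTransition.le_one _⟩
  have hgone : ∀ x : ℝ, |x| ≤ (θ - η) / 2 → g x = 1 := by
    intro x hx
    apply Real.smoothTransition.one_of_one_le
    rw [le_div_iff₀ hcc, one_mul, sub_le_sub_iff_right, ← Real.cos_abs, hc']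
    have : |2 * Real.pi * x| = 2 * Real.pi * |x| := by
      rw [abs_mul, abs_of_pos (by positivity)]
    rw [this]
    apply Real.cos_le_cos_of_nonneg_of_le_pi
    · positivity
    · nlinarith
    · nlinarith
  have hgzero : ∀ x : ℝ, θ / 2 ≤ x → x ≤ 1 - θ / 2 → g x = 0 := by
    intro x hx hx'
    apply Real.smoothTransition.zero_of_nonpos
    apply div_nonpos_of_nonpos_of_nonneg _ hcc.le
    have key : ∀ z, θ / 2 ≤ z → z ≤ 1 / 2 → Real.cos (2 * Real.pi * z) ≤ c := by
      intro z hz hz'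
      apply Real.cos_le_cos_of_nonneg_of_le_pi
      · positivity
      · nlinarith
      · nlinarith
    rcases le_total x (1 / 2) with h | h
    · linarith [key x hx h]
    · have := key (1 - x) (by linarith) (by linarith)
      rw [show 2 * Real.pi * (1 - x) = 2 * Real.pi - 2 * Real.pi * x by ring,
        Real.cos_two_pi_sub] at this
      linarith
  have hmeas : ∀ a : ℝ, MeasurableSet {x | g x = a} := fun a =>
    hgs.continuous.measurable (measurableSet_singleton a)
  have hper : ∀ a : ℝ, Function.Periodic ({x | g x = a}.indicator (fun _ => (1 : ℝ))) 1 := by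
    intro a x
    simp only [indicator, mem_ofPred_eq, hgp x]
  have hint : ∀ (a p r : ℝ), p ≤ r → (∫ x in p..r, ({x | g x = a}.indicator
      (fun _ => (1 : ℝ))) x) = volume.real ({x | g x = a} ∩ Ioc p r) := by
    intro a p r hpr
    rw [intervalIntegral.integral_of_le hpr, integral_indicator (hmeas a)]
    simp [Measure.real, Measure.restrict_apply, hmeas a]
  have hle : ∀ (a p r p' r' : ℝ), p ≤ r → p' ≤ r' → p ≤ p' → r' ≤ r →
      (∀ x, p' ≤ x → x ≤ r' → g x = a) →
      r' - p' ≤ ∫ x in p..r, ({x | g x = a}.indicator (fun _ => (1 : ℝ))) x := by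
    intro a p r p' r' hpr hpr' hp hr hga
    rw [hint a p r hpr]
    have : volume.real (Ioc p' r') ≤ volume.real ({x | g x = a} ∩ Ioc p r) := by
      apply measureReal_mono
      · intro x hx
        exact ⟨hga x hx.1.le hx.2, hp.trans_lt hx.1, hx.2.trans hr⟩
      · exact ((measure_mono inter_subset_right).trans_lt measure_Ioc_lt_top).ne
    rwa [Real.volume_real_Ioc_of_le hpr'] at this
  refine ⟨g, hgs, hgp, hg01, ?_, ?_⟩
  · have h2 := (hper 1).intervalIntegral_add_eq 0 (-(1 / 2))
    rw [zero_add] at h2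
    rw [h2]
    have := hle 1 (-(1 / 2)) (-(1 / 2) + 1) (-((θ - η) / 2)) ((θ - η) / 2) (by norm_num)
      (by linarith) (by linarith) (by linarith) (fun x h h' => hgone x (abs_le.2 ⟨h, h'⟩))
    linarith
  · have := hle 0 0 1 (θ / 2) (1 - θ / 2) (by norm_num)
      (by linarith) (by linarith) (by linarith) hgzero
    linarith

/-- An oscillating profile `h` whose second derivative is, up to small errors in value and in
proportion, equal to `1 - θ` with frequency `θ` and to `-θ` with frequency `1 - θ`. -/
theorem exists_oscillating_profile {θ η : ℝ} (h0 : 0 ≤ θ) (h1 : θ ≤ 1) (hη : 0 < η) :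
    ∃ (g h h' : ℝ → ℝ) (θ' C : ℝ), ContDiff ℝ ∞ g ∧ ContDiff ℝ ∞ h ∧ Function.Periodic g 1 ∧
      (∀ x, 0 ≤ g x ∧ g x ≤ 1) ∧ |θ' - θ| ≤ η ∧
      (∀ x, HasDerivAt h (h' x) x) ∧ (∀ x, HasDerivAt h' (g x - θ') x) ∧
      (∀ x, |h x| ≤ C) ∧ (∀ x, |h' x| ≤ C) ∧
      θ - η ≤ ∫ x in (0 : ℝ)..1, ({x | g x = 1}.indicator (fun _ => (1 : ℝ))) x ∧
      1 - θ - η ≤ ∫ x in (0 : ℝ)..1, ({x | g x = 0}.indicator (fun _ => (1 : ℝ))) x := by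
  obtain ⟨g, hgs, hgp, hg01, hone, hzero⟩ := exists_periodic_profile h0 h1 hη
  have hgi : ∀ a b, IntervalIntegrable g volume a b := fun a b =>
    hgs.continuous.intervalIntegrable _ _
  have hmeas : ∀ a : ℝ, MeasurableSet {x | g x = a} := fun a =>
    hgs.continuous.measurable (measurableSet_singleton a)
  have hindi : ∀ a : ℝ, IntervalIntegrable ({x | g x = a}.indicator (fun _ => (1 : ℝ)))
      volume 0 1 := by
    intro a
    rw [intervalIntegrable_iff_integrableOn_Ioc_of_le zero_le_one]
    exact (integrable_const _).indicator (hmeas a)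
  -- Periodic primitives exist only after subtracting the exact mean, which agrees with `θ` up to
  -- `η`.
  set θ' := ∫ x in (0 : ℝ)..1, g x with hθ'
  have hlow : θ - η ≤ θ' := hone.trans <| by
    apply intervalIntegral.integral_mono_on zero_le_one (hindi 1) (hgi _ _)
    intro x _
    by_cases hx : g x = 1
    · simp [indicator, hx]
    · simp [indicator, hx, (hg01 x).1]
  have hup : θ' ≤ θ + η := by
    have : (∫ x in (0 : ℝ)..1, ({x | g x = 0}.indicator (fun _ => (1 : ℝ))) x) ≤
        ∫ x in (0 : ℝ)..1, (1 - g x) := by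
      apply intervalIntegral.integral_mono_on zero_le_one (hindi 0)
        (intervalIntegrable_const.sub (hgi _ _))
      intro x _
      by_cases hx : g x = 0
      · simp [indicator, hx]
      · simp [indicator, hx, (hg01 x).2]
    rw [intervalIntegral.integral_sub intervalIntegrable_const (hgi _ _)] at this
    simp only [intervalIntegral.integral_const, sub_zero, smul_eq_mul, mul_one] at this
    linarith
  obtain ⟨h', hs', hp', hd', hm'⟩ := exists_periodic_primitive (f := fun x => g x - θ')
    (hgs.sub contDiff_const) (fun x => by simp only [hgp x])
    (by rw [intervalIntegral.integral_sub (hgi _ _) intervalIntegrable_const]; simp [hθ'])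
  -- The first primitive was normalized to mean zero precisely so that it has a periodic, hence
  -- bounded, primitive of its own.
  obtain ⟨h, hs, hp, hd, -⟩ := exists_periodic_primitive hs' hp' hm'
  obtain ⟨C₁, hC₁⟩ := (hp'.isBounded_of_continuous one_ne_zero hs'.continuous).exists_norm_le
  obtain ⟨C₂, hC₂⟩ := (hp.isBounded_of_continuous one_ne_zero hs.continuous).exists_norm_le
  exact ⟨g, h, h', θ', max C₁ C₂, hgs, hs, hgp, hg01, abs_le.2 ⟨by linarith, by linarith⟩, hd, hd',
    fun x => (hC₂ _ (mem_range_self x)).trans (le_max_right _ _),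
    fun x => (hC₁ _ (mem_range_self x)).trans (le_max_left _ _), hone, hzero⟩

end Profile

/-! ### Equidistribution of fast oscillations, and cutoffs. -/

section Oscillation

theorem exists_norm_le_of_hasCompactSupport {E F : Type*} [NormedAddCommGroup E]
    [NormedAddCommGroup F] {f : E → F} (hf : Continuous f) (hfc : HasCompactSupport f) :
    ∃ c, 0 ≤ c ∧ ∀ x, ‖f x‖ ≤ c := by
  obtain ⟨c, hc⟩ := hf.bounded_above_of_compact_support hfc
  exact ⟨c, (norm_nonneg _).trans (hc 0), hc⟩

theorem ContinuousLinearMap.norm_smul_eq {E F : Type*} [NormedAddCommGroup E] [NormedSpace ℝ E]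
    [NormedAddCommGroup F] [NormedSpace ℝ F] (a : ℝ) (A : E →L[ℝ] F) :
    ‖a • A‖ = |a| * ‖A‖ :=
  norm_smul a A

variable {E : Type*} [NormedAddCommGroup E] [NormedSpace ℝ E] [FiniteDimensional ℝ E]

/-- Translation is continuous in `L¹` at a continuous compactly supported function. -/
theorem tendsto_integral_abs_translate_sub [MeasurableSpace E] [BorelSpace E] (μ : Measure E)
    [μ.IsAddHaarMeasure] {χ : E → ℝ} (hχ : Continuous χ) (hχc : HasCompactSupport χ) :
    Filter.Tendsto (fun v => ∫ y, |χ (y + v) - χ y| ∂μ) (𝓝 0) (𝓝 0) := by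
  -- For `‖v‖ < 1` the integrand vanishes outside one fixed ball, so continuity of parametric
  -- integrals over a compact set applies.
  obtain ⟨R, hR⟩ := hχc.isCompact.isBounded.subset_closedBall (0 : E)
  have hcont : Continuous fun v => ∫ y in Metric.closedBall (0 : E) (R + 1),
      |χ (y + v) - χ y| ∂μ := by
    apply continuous_parametric_integral_of_continuous _ (isCompact_closedBall _ _)
    simp only [Function.uncurry_def]
    fun_prop
  have h0 := hcont.tendsto 0
  simp only [add_zero, sub_self, abs_zero, integral_zero] at h0
  refine h0.congr' ?_
  filter_upwards [Metric.ball_mem_nhds (0 : E) one_pos] with v hv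
  rw [mem_ball_zero_iff] at hv
  apply setIntegral_eq_integral_of_forall_compl_eq_zero
  intro y hy
  have hz : ∀ z : E, R < ‖z‖ → χ z = 0 := by
    intro z hz
    by_contra h
    have := hR (subset_tsupport _ h)
    rw [mem_closedBall_zero_iff] at this
    linarith
  rw [mem_closedBall_zero_iff, not_le] at hy
  have h1 : ‖y‖ - ‖v‖ ≤ ‖y + v‖ := by
    have := norm_sub_le (y + v) v
    rw [add_sub_cancel_right] at this
    linarith
  rw [hz y (by linarith), hz (y + v) (by linarith)]
  simp

/-- Equidistribution of fast oscillations along a linear form. -/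
theorem tendsto_integral_mul_periodic [MeasurableSpace E] [BorelSpace E] (μ : Measure E)
    [μ.IsAddHaarMeasure] {χ : E → ℝ} (hχ : Continuous χ) (hχc : HasCompactSupport χ)
    {φ : E →L[ℝ] ℝ} (hφ : φ ≠ 0) {q : ℝ → ℝ} (hq : Measurable q) (hq0 : ∀ x, 0 ≤ q x)
    (hq1 : ∀ x, q x ≤ 1) (hp : Function.Periodic q 1) :
    Filter.Tendsto (fun k : ℕ => ∫ y, χ y * q (k * φ y) ∂μ) Filter.atTop
      (𝓝 ((∫ x in (0 : ℝ)..1, q x) * ∫ y, χ y ∂μ)) := by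
  obtain ⟨e, he⟩ : ∃ e, φ e = 1 := by
    obtain ⟨z, hz⟩ : ∃ z, φ z ≠ 0 := by
      by_contra! h
      exact hφ (ContinuousLinearMap.ext h)
    exact ⟨(φ z)⁻¹ • z, by simp [hz]⟩
  have hχi : Integrable χ μ := hχ.integrable_of_hasCompactSupport hχc
  have habs : ∀ x, |q x| ≤ 1 := fun x => by rw [abs_of_nonneg (hq0 x)]; exact hq1 x
  rw [Metric.tendsto_atTop]
  intro δ hδ
  obtain ⟨ρ, hρ, hρδ⟩ := Metric.eventually_nhds_iff.1
    ((tendsto_integral_abs_translate_sub μ hχ hχc).eventually (gt_mem_nhds (half_pos hδ)))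
  obtain ⟨k₀, hk₀⟩ := exists_nat_gt (‖e‖ / ρ)
  refine ⟨k₀ + 1, fun k hk => ?_⟩
  have hkpos : (0 : ℝ) < k := by
    have : 0 < k := by omega
    exact_mod_cast this
  have hk' : ‖e‖ / k < ρ := by
    rw [div_lt_iff₀ hkpos]
    rw [div_lt_iff₀ hρ] at hk₀
    have : (k₀ : ℝ) ≤ k := by exact_mod_cast (by omega : k₀ ≤ k)
    nlinarith
  -- A phase shift by `τ` is a translation by `(τ / k) e`, which barely changes `χ`; thus every `D
  -- τ` is close to the integral in question, while the mean of `D` over one period is exactly the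
  -- limit, by Fubini.
  set D : ℝ → ℝ := fun τ => ∫ y, χ y * q (k * φ y + τ) ∂μ with hD
  have hmeas : ∀ τ : ℝ, Measurable fun y => q (k * φ y + τ) := fun τ =>
    hq.comp (by fun_prop)
  have hint : ∀ (ψ : E → ℝ) (τ : ℝ), Integrable ψ μ →
      Integrable (fun y => ψ y * q (k * φ y + τ)) μ := fun ψ τ hψ =>
    hψ.mul_bdd (hmeas τ).aestronglyMeasurable (Filter.Eventually.of_forall fun y => habs _)
  have hclose : ∀ τ ∈ Icc (0 : ℝ) 1, |(∫ y, χ y * q (k * φ y) ∂μ) - D τ| ≤ δ / 2 := by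
    intro τ hτ
    set v := (τ / k) • e with hv
    have hshift : (∫ y, χ y * q (k * φ y) ∂μ) = ∫ y, χ (y + v) * q (k * φ y + τ) ∂μ := by
      rw [← integral_add_right_eq_self _ v]
      congr 1
      ext y
      congr 2
      rw [map_add, hv, map_smul, he]
      simp
      field_simp
    rw [hshift, hD]
    have hχv : Integrable (fun y => χ (y + v)) μ := hχi.comp_add_right v
    simp only
    rw [← integral_sub (hint _ τ hχv) (hint _ τ hχi)]
    have hnv : dist v 0 < ρ := by
      rw [dist_zero_right, hv, norm_smul, Real.norm_eq_abs,
        abs_of_nonneg (div_nonneg hτ.1 hkpos.le)]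
      refine lt_of_le_of_lt ?_ hk'
      rw [div_mul_eq_mul_div]
      gcongr
      exact mul_le_of_le_one_left (norm_nonneg _) hτ.2
    refine le_trans ?_ (hρδ hnv).le
    rw [← Real.norm_eq_abs]
    refine norm_integral_le_of_norm_le ((hχv.sub hχi).norm)
      (Filter.Eventually.of_forall fun y => ?_)
    rw [← sub_mul, norm_mul]
    exact mul_le_of_le_one_right (norm_nonneg _) (habs _)
  have hprod : Integrable (Function.uncurry fun (τ : ℝ) (y : E) => χ y * q (k * φ y + τ))
      ((volume.restrict (uIoc (0 : ℝ) 1)).prod μ) := by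
    rw [uIoc_of_le zero_le_one]
    have h1 : Integrable (fun z : ℝ × E => χ z.2) ((volume.restrict (Ioc (0 : ℝ) 1)).prod μ) :=
      hχi.comp_snd _
    refine h1.mul_bdd (c := 1) ?_ (Filter.Eventually.of_forall fun y => habs _)
    exact (hq.comp (by fun_prop : Measurable fun z : ℝ × E =>
      (k : ℝ) * φ z.2 + z.1)).aestronglyMeasurable
  have hDi : IntervalIntegrable D volume 0 1 := by
    rw [intervalIntegrable_iff]
    exact hprod.integral_prod_left
  have hDint : ∫ τ in (0 : ℝ)..1, D τ = (∫ x in (0 : ℝ)..1, q x) * ∫ y, χ y ∂μ := by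
    rw [hD, intervalIntegral_integral_swap hprod, ← integral_const_mul]
    congr 1
    ext y
    rw [intervalIntegral.integral_const_mul, mul_comm, intervalIntegral.integral_comp_add_left]
    have := hp.intervalIntegral_add_eq (k * φ y) 0
    rw [zero_add] at this
    rw [add_zero, this]
  rw [← hDint, Real.dist_eq]
  have hconst : (∫ y, χ y * q (k * φ y) ∂μ) =
      ∫ _ in (0 : ℝ)..1, (∫ y, χ y * q (k * φ y) ∂μ) := by simp
  rw [hconst, ← intervalIntegral.integral_sub intervalIntegrable_const hDi]
  have := intervalIntegral.norm_integral_le_of_norm_le_const (a := 0) (b := 1) (C := δ / 2)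
    (f := fun τ => (∫ y, χ y * q (k * φ y) ∂μ) - D τ) (fun τ hτ => by
      rw [uIoc_of_le zero_le_one] at hτ
      exact hclose τ ⟨hτ.1.le, hτ.2⟩)
  rw [Real.norm_eq_abs] at this
  simp only [sub_zero, abs_one, mul_one] at this
  exact this.trans_lt (half_lt_self hδ)

/-- A smooth cutoff function between a compact set and an open neighbourhood. -/
theorem exists_smooth_cutoff {K U : Set E} (hK : IsCompact K) (hU : IsOpen U) (hKU : K ⊆ U) :
    ∃ (ζ : E → ℝ) (K' : Set E), IsCompact K' ∧ K' ⊆ U ∧ ContDiff ℝ ∞ ζ ∧ (∀ x, 0 ≤ ζ x ∧ ζ x ≤ 1) ∧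
      (∀ x ∈ K, ζ x = 1) ∧ tsupport ζ ⊆ K' := by
  obtain ⟨K', hK', hKK', hK'U⟩ := exists_compact_between hK hU hKU
  obtain ⟨ζ, h1, h0, h01⟩ := exists_contMDiffMap_one_nhds_of_subset_interior
    (modelWithCornersSelf ℝ E) (n := ⊤) hK.isClosed hKK'
  refine ⟨ζ, K', hK', hK'U, contMDiff_iff_contDiff.1 ζ.contMDiff, h01,
    fun x hx => h1.self_of_nhdsSet x hx, closure_minimal (fun x hx => ?_) hK'.isClosed⟩
  by_contra h
  exact hx (h0 x h)

end Oscillation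

/-- First and second derivatives of a localized fast oscillation. -/
theorem exists_bound_fderiv_oscillation {E : Type*} [NormedAddCommGroup E] [NormedSpace ℝ E]
    {ζ : E → ℝ} (hζ : ContDiff ℝ ∞ ζ)
    (hζc : HasCompactSupport ζ) (φ : E →L[ℝ] ℝ) {h h' h'' : ℝ → ℝ} {c : ℝ}
    (hd : ∀ x, HasDerivAt h (h' x) x) (hd' : ∀ x, HasDerivAt h' (h'' x) x)
    (hb : ∀ x, |h x| ≤ c) (hb' : ∀ x, |h' x| ≤ c) :
    ∃ C : ℝ, ∀ k : ℕ, 1 ≤ k → ∀ y,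
      ‖fderiv ℝ (fun y => ((k : ℝ)⁻¹ ^ 2 * h (k * φ y)) • ζ y) y‖ ≤ C / k ∧
      ‖fderiv ℝ (fderiv ℝ (fun y => ((k : ℝ)⁻¹ ^ 2 * h (k * φ y)) • ζ y)) y -
        (ζ y * h'' (k * φ y)) • φ.smulRight φ‖ ≤ C / k := by
  have hζ1 : ContDiff ℝ ∞ (fderiv ℝ ζ) := hζ.fderiv_right (by simp)
  have hζ2 : ContDiff ℝ ∞ (fderiv ℝ (fderiv ℝ ζ)) := hζ1.fderiv_right (by simp)
  have hc1 : HasCompactSupport (fderiv ℝ ζ) := hζc.fderiv (𝕜 := ℝ)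
  have hc2 : HasCompactSupport (fderiv ℝ (fderiv ℝ ζ)) := hc1.fderiv (𝕜 := ℝ)
  obtain ⟨c₀, hc₀', hc₀⟩ := exists_norm_le_of_hasCompactSupport hζ.continuous hζc
  obtain ⟨c₁, hc₁', hc₁⟩ := exists_norm_le_of_hasCompactSupport hζ1.continuous hc1
  obtain ⟨c₂, hc₂', hc₂⟩ := exists_norm_le_of_hasCompactSupport hζ2.continuous hc2
  have hc : 0 ≤ c := (abs_nonneg _).trans (hb 0)
  -- The sum of the constants of the gradient bound and of the Hessian remainder.
  refine ⟨c * c₁ + c * ‖φ‖ * c₀ + (c * c₂ + c * ‖φ‖ * c₁ + c * ‖φ‖ * c₁), fun k hk => ?_⟩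
  have hk0 : (0 : ℝ) < k := by exact_mod_cast hk
  have hk1 : (k : ℝ)⁻¹ ≤ 1 := by
    rw [inv_le_one₀ hk0]
    exact_mod_cast hk
  have hkk : (k : ℝ)⁻¹ ^ 2 ≤ (k : ℝ)⁻¹ := by
    rw [sq]
    exact mul_le_of_le_one_left (by positivity) hk1
  have hlin : ∀ y, HasFDerivAt (fun y => (k : ℝ) * φ y) ((k : ℝ) • φ) y := fun y =>
    φ.hasFDerivAt.const_mul _
  have hA : ∀ y, HasFDerivAt (fun y => (k : ℝ)⁻¹ ^ 2 * h (k * φ y))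
      (((k : ℝ)⁻¹ * h' (k * φ y)) • φ) y := by
    intro y
    have := ((hd (k * φ y)).comp_hasFDerivAt y (hlin y)).const_mul ((k : ℝ)⁻¹ ^ 2)
    refine this.congr_fderiv ?_
    ext z
    simp only [smul_apply, smul_eq_mul]
    field_simp
  have hB : ∀ y, HasFDerivAt (fun y => (k : ℝ)⁻¹ * h' (k * φ y)) (h'' (k * φ y) • φ) y := by
    intro y
    have := ((hd' (k * φ y)).comp_hasFDerivAt y (hlin y)).const_mul ((k : ℝ)⁻¹)
    refine this.congr_fderiv ?_
    ext z
    simp only [smul_apply, smul_eq_mul]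
    field_simp
  have hdζ : ∀ y, HasFDerivAt ζ (fderiv ℝ ζ y) y := fun y =>
    (hζ.differentiable (by simp) y).hasFDerivAt
  have hdζ1 : ∀ y, HasFDerivAt (fderiv ℝ ζ) (fderiv ℝ (fderiv ℝ ζ) y) y := fun y =>
    (hζ1.differentiable (by simp) y).hasFDerivAt
  have h1 : ∀ y, HasFDerivAt (fun y => ((k : ℝ)⁻¹ ^ 2 * h (k * φ y)) • ζ y)
      (((k : ℝ)⁻¹ ^ 2 * h (k * φ y)) • fderiv ℝ ζ y +
        ((k : ℝ)⁻¹ * h' (k * φ y)) • ζ y • φ) y := by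
    intro y
    refine ((hA y).fun_smul (hdζ y)).congr_fderiv ?_
    ext z
    simp
    ring
  have h1' : fderiv ℝ (fun y => ((k : ℝ)⁻¹ ^ 2 * h (k * φ y)) • ζ y) = fun y =>
      ((k : ℝ)⁻¹ ^ 2 * h (k * φ y)) • fderiv ℝ ζ y + ((k : ℝ)⁻¹ * h' (k * φ y)) • ζ y • φ :=
    funext fun y => (h1 y).fderiv
  have hN1 : ∀ y, |(k : ℝ)⁻¹ ^ 2 * h (k * φ y)| ≤ (k : ℝ)⁻¹ * c := by
    intro y
    rw [abs_mul, abs_of_nonneg (by positivity)]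
    exact mul_le_mul hkk (hb _) (abs_nonneg _) (by positivity)
  have hN2 : ∀ y, |(k : ℝ)⁻¹ * h' (k * φ y)| ≤ (k : ℝ)⁻¹ * c := by
    intro y
    rw [abs_mul, abs_of_nonneg (by positivity)]
    exact mul_le_mul le_rfl (hb' _) (abs_nonneg _) (by positivity)
  intro y
  constructor
  · rw [h1']
    refine (norm_add_le _ _).trans ?_
    rw [norm_smul, norm_smul, norm_smul, Real.norm_eq_abs, Real.norm_eq_abs]
    calc _ ≤ (k : ℝ)⁻¹ * c * c₁ + (k : ℝ)⁻¹ * c * (c₀ * ‖φ‖) := by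
          gcongr
          exacts [hN1 y, hc₁ y, hN2 y, hc₀ y]
      _ ≤ _ := by
          rw [div_eq_inv_mul]
          have : 0 ≤ (k : ℝ)⁻¹ * (c * c₂ + c * ‖φ‖ * c₁ + c * ‖φ‖ * c₁) := by positivity
          linarith
  · have h2 := ((hA y).fun_smul (hdζ1 y)).fun_add ((hB y).fun_smul ((hdζ y).smul_const φ))
    rw [h1', h2.fderiv]
    -- Only the term in which both derivatives fall on the oscillation is of order one, and it
    -- cancels; every other term keeps a factor `k⁻¹` or `k⁻²`.
    have hrw : ((k : ℝ)⁻¹ ^ 2 * h (k * φ y)) • fderiv ℝ (fderiv ℝ ζ) y +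
        (((k : ℝ)⁻¹ * h' (k * φ y)) • φ).smulRight (fderiv ℝ ζ y) +
        (((k : ℝ)⁻¹ * h' (k * φ y)) • (fderiv ℝ ζ y).smulRight φ +
          (h'' (k * φ y) • φ).smulRight (ζ y • φ)) - (ζ y * h'' (k * φ y)) • φ.smulRight φ =
        ((k : ℝ)⁻¹ ^ 2 * h (k * φ y)) • fderiv ℝ (fderiv ℝ ζ) y +
        ((k : ℝ)⁻¹ * h' (k * φ y)) • φ.smulRight (fderiv ℝ ζ y) +
        ((k : ℝ)⁻¹ * h' (k * φ y)) • (fderiv ℝ ζ y).smulRight φ := by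
      ext z z'
      simp
      ring
    rw [hrw]
    have tri : ∀ A B D : E →L[ℝ] E →L[ℝ] ℝ, ‖A + B + D‖ ≤ ‖A‖ + ‖B‖ + ‖D‖ :=
      fun A B D => (norm_add_le (A + B) D).trans (by gcongr; exact norm_add_le A B)
    refine (tri _ _ _).trans ?_
    rw [ContinuousLinearMap.norm_smul_eq, ContinuousLinearMap.norm_smul_eq,
      ContinuousLinearMap.norm_smul_eq, ContinuousLinearMap.norm_smulRight_apply,
      ContinuousLinearMap.norm_smulRight_apply]
    calc _ ≤ (k : ℝ)⁻¹ * c * c₂ + (k : ℝ)⁻¹ * c * (‖φ‖ * c₁) + (k : ℝ)⁻¹ * c * (c₁ * ‖φ‖) := by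
          gcongr
          exacts [hN1 y, hc₂ y, hN2 y, hc₁ y, hN2 y, hc₁ y]
      _ ≤ _ := by
          rw [div_eq_inv_mul]
          have : 0 ≤ (k : ℝ)⁻¹ * (c * c₁ + c * ‖φ‖ * c₀) := by positivity
          linarith

/-! ### Localized scalar potentials with prescribed Hessian distribution. -/

section ScalarPotential

variable {n : ℕ}

instance SpaceTime.isAddHaarMeasure_volume :
    (volume : Measure (SpaceTime n)).IsAddHaarMeasure := by
  rw [Measure.volume_eq_prod]
  infer_instance

/-- A compactly supported scalar potential in a bounded open set `Q` with small gradient, whose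
Hessian stays close to the segment `{(t - θ) φ ⊗ φ : 0 ≤ t ≤ 1}` and is close to its endpoints on
sets of relative measure nearly `θ` and `1 - θ`. -/
theorem exists_scalar_potential {Q : Set (SpaceTime n)} (hQ : IsOpen Q)
    (hQb : Bornology.IsBounded Q) {φ : SpaceTime n →L[ℝ] ℝ} (hφ : φ ≠ 0) {θ η : ℝ} (h0 : 0 ≤ θ)
    (h1 : θ ≤ 1) (hη : 0 < η) :
    ∃ Φ : SpaceTime n → ℝ, IsTestFun Q Φ ∧ (∀ y, ‖fderiv ℝ Φ y‖ ≤ η) ∧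
      (∀ y, ∃ t ∈ Icc (0 : ℝ) 1,
        ‖fderiv ℝ (fderiv ℝ Φ) y - (t - θ) • φ.smulRight φ‖ ≤ η) ∧
      ∃ E₁ E₂ : Set (SpaceTime n), IsOpen E₁ ∧ IsOpen E₂ ∧ E₁ ⊆ Q ∧ E₂ ⊆ Q ∧ Disjoint E₁ E₂ ∧
        (θ - η) * volume.real Q ≤ volume.real E₁ ∧
        (1 - θ - η) * volume.real Q ≤ volume.real E₂ ∧
        (∀ y ∈ E₁, ‖fderiv ℝ (fderiv ℝ Φ) y - (1 - θ) • φ.smulRight φ‖ ≤ η) ∧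
        (∀ y ∈ E₂, ‖fderiv ℝ (fderiv ℝ Φ) y - (0 - θ) • φ.smulRight φ‖ ≤ η) := by
  have hQfin : volume Q ≠ ⊤ := hQb.measure_lt_top.ne
  set W : SpaceTime n →L[ℝ] SpaceTime n →L[ℝ] ℝ := φ.smulRight φ with hW
  obtain ⟨η', hη'0, hη'1, hη'2⟩ : ∃ η' : ℝ, 0 < η' ∧ 2 * η' * ‖W‖ ≤ η / 2 ∧ 4 * η' ≤ η := by
    have hW0 := norm_nonneg W
    refine ⟨η / (4 * (‖W‖ + 1)), by positivity, ?_, ?_⟩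
    · rw [mul_div_assoc', div_mul_eq_mul_div, div_le_div_iff₀ (by positivity) (by positivity)]
      nlinarith
    · rw [mul_div_assoc', div_le_iff₀ (by positivity)]
      nlinarith
  -- The bound `η₁ < 1 / 2` separates the values near `1` from those near `0`, which makes the two
  -- sets below disjoint.
  obtain ⟨η₁, hη₁0, hη₁1, hη₁2⟩ : ∃ η₁ : ℝ, 0 < η₁ ∧ η₁ ≤ η' ∧ η₁ < 1 / 2 :=
    ⟨min η' (1 / 4), by positivity, min_le_left _ _, (min_le_right _ _).trans_lt (by norm_num)⟩
  obtain ⟨g, h, h', θ', c, hg, hh, hgp, hg01, hθ', hd, hd', hb, hb', hone, hzero⟩ :=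
    exists_oscillating_profile h0 h1 hη₁0
  obtain ⟨K, hKQ, hK, hKvol⟩ : ∃ K ⊆ Q, IsCompact K ∧
      volume.real Q * (1 - η₁) - η₁ * volume.real Q ≤ volume.real K := by
    rcases eq_or_ne (volume Q) 0 with hz | hz
    · exact ⟨∅, empty_subset _, isCompact_empty, by simp [Measure.real, hz]⟩
    · have hpos : 0 < volume.real Q := ENNReal.toReal_pos hz hQfin
      obtain ⟨K, hKQ, hK, hlt⟩ := hQ.exists_lt_isCompact (μ := volume)
        (r := ENNReal.ofReal (volume.real Q * (1 - η₁) - η₁ * volume.real Q)) (by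
          rw [← ofReal_measureReal hQfin]
          exact (ENNReal.ofReal_lt_ofReal_iff hpos).2 (by nlinarith))
      refine ⟨K, hKQ, hK, ?_⟩
      exact (ENNReal.ofReal_le_iff_le_toReal hK.measure_lt_top.ne).1 hlt.le
  -- Two nested cutoffs: `χ` is the weight in the equidistribution statement, and `ζ`, which
  -- localizes the potential, equals `1` wherever `χ` does not vanish.
  obtain ⟨χ, K₁, hK₁, hK₁Q, hχ, hχ01, hχone, hχsupp⟩ := exists_smooth_cutoff hK hQ hKQ
  obtain ⟨ζ, K₂, hK₂, hK₂Q, hζ, hζ01, hζone, hζsupp⟩ := exists_smooth_cutoff hK₁ hQ hK₁Q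
  have hχc : HasCompactSupport χ := hK₁.of_isClosed_subset (isClosed_tsupport _) hχsupp
  have hζc : HasCompactSupport ζ := hK₂.of_isClosed_subset (isClosed_tsupport _) hζsupp
  have hχK₁ : ∀ y, χ y ≠ 0 → y ∈ K₁ := fun y hy => hχsupp (subset_tsupport _ hy)
  have hχi : Integrable χ (volume : Measure (SpaceTime n)) :=
    hχ.continuous.integrable_of_hasCompactSupport hχc
  have hχint : (1 - 2 * η₁) * volume.real Q ≤ ∫ y, χ y := by
    calc (1 - 2 * η₁) * volume.real Q ≤ volume.real K := by linarith
      _ = ∫ y, K.indicator (fun _ => (1 : ℝ)) y := by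
          rw [integral_indicator_const _ hK.measurableSet]; simp
      _ ≤ ∫ y, χ y := by
          apply integral_mono
          · exact (integrable_indicator_iff hK.measurableSet).2
              (integrableOn_const hK.measure_lt_top.ne)
          · exact hχi
          · intro y
            by_cases hy : y ∈ K
            · simp [hy, hχone y hy]
            · simp [hy, (hχ01 y).1]
  obtain ⟨C, hC⟩ := exists_bound_fderiv_oscillation hζ hζc φ hd hd' hb hb'
  have hmeas : ∀ a : ℝ, MeasurableSet {x | g x = a} := fun a =>
    hg.continuous.measurable (measurableSet_singleton a)
  have hequi : ∀ a : ℝ, Filter.Tendsto (fun k : ℕ => ∫ y : SpaceTime n,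
      χ y * ({x | g x = a}.indicator (fun _ => (1 : ℝ))) (k * φ y)) Filter.atTop
      (𝓝 ((∫ x in (0 : ℝ)..1, ({x | g x = a}.indicator (fun _ => (1 : ℝ))) x) *
        ∫ y : SpaceTime n, χ y)) := by
    intro a
    apply tendsto_integral_mul_periodic _ hχ.continuous hχc hφ
    · exact measurable_const.indicator (hmeas a)
    · exact fun x => indicator_nonneg (fun _ _ => zero_le_one) x
    · exact fun x => indicator_le_self' (fun _ _ => zero_le_one) x
    · intro x
      simp only [indicator, mem_ofPred_eq, hgp x]
  have hlim : ∀ a b : ℝ, b - η₁ ≤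
      (∫ x in (0 : ℝ)..1, ({x | g x = a}.indicator (fun _ => (1 : ℝ))) x) → b ≤ 1 →
      ∀ᶠ k : ℕ in Filter.atTop, (b - η) * volume.real Q ≤ ∫ y : SpaceTime n,
      χ y * ({x | g x = a}.indicator (fun _ => (1 : ℝ))) (k * φ y) := by
    intro a b hb hb1
    rcases (measureReal_nonneg (μ := volume) (s := Q)).eq_or_lt with hz | hpos
    · refine Filter.Eventually.of_forall fun k => ?_
      rw [← hz, mul_zero]
      exact integral_nonneg fun y =>
        mul_nonneg (hχ01 y).1 (indicator_nonneg (fun _ _ => zero_le_one) _)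
    · refine (hequi a).eventually (le_mem_nhds ?_)
      have hχ0 : 0 ≤ ∫ y, χ y := integral_nonneg fun y => (hχ01 y).1
      have h3 : 0 ≤ ∫ x in (0 : ℝ)..1, ({x | g x = a}.indicator (fun _ => (1 : ℝ))) x :=
        intervalIntegral.integral_nonneg zero_le_one
          fun x _ => indicator_nonneg (fun _ _ => zero_le_one) _
      -- For `b ≤ η₁` the left side is negative; otherwise `(b - η₁)(1 - 2 η₁)` exceeds `b - 4 η₁`,
      -- and `4 η₁ ≤ η`.
      rcases le_or_gt b η₁ with hbη | hbη
      · calc (b - η) * volume.real Q < 0 := by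
              apply mul_neg_of_neg_of_pos _ hpos
              linarith
          _ ≤ _ := mul_nonneg h3 hχ0
      · calc (b - η) * volume.real Q < (b - η₁) * ((1 - 2 * η₁) * volume.real Q) := by
              rw [← mul_assoc]
              apply mul_lt_mul_of_pos_right _ hpos
              nlinarith
          _ ≤ _ := mul_le_mul hb hχint (by apply mul_nonneg _ hpos.le; linarith) h3
  obtain ⟨k₀, hk₀⟩ := exists_nat_gt (C / (η / 2))
  obtain ⟨k, hk1, hk2, hkk₀, hk⟩ :=
    ((hlim 1 θ hone h1).and ((hlim 0 (1 - θ) hzero (by linarith)).and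
    ((Filter.eventually_ge_atTop k₀).and (Filter.eventually_ge_atTop 1)))).exists
  have hkpos : (0 : ℝ) < k := by exact_mod_cast hk
  have hCk : C / k ≤ η / 2 := by
    rw [div_le_iff₀ hkpos]
    rw [div_lt_iff₀ (by positivity)] at hk₀
    have : (k₀ : ℝ) ≤ k := by exact_mod_cast hkk₀
    nlinarith
  set Φ : SpaceTime n → ℝ := fun y => ((k : ℝ)⁻¹ ^ 2 * h (k * φ y)) • ζ y with hΦ
  have hΦsupp : tsupport Φ ⊆ tsupport ζ := tsupport_smul_subset_right _ _
  have hHess : ∀ y t, |ζ y * (g (k * φ y) - θ') - (t - θ)| ≤ 2 * η' →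
      ‖fderiv ℝ (fderiv ℝ Φ) y - (t - θ) • W‖ ≤ η := by
    intro y t ht
    have e : fderiv ℝ (fderiv ℝ Φ) y - (t - θ) • W =
        (fderiv ℝ (fderiv ℝ Φ) y - (ζ y * (g (k * φ y) - θ')) • W) +
        (ζ y * (g (k * φ y) - θ') - (t - θ)) • W := by
      rw [sub_smul (ζ y * (g (k * φ y) - θ')) (t - θ) W]
      abel
    rw [e]
    refine (ContinuousLinearMap.opNorm_add_le _ _).trans ?_
    rw [ContinuousLinearMap.norm_smul_eq]
    have := mul_le_mul_of_nonneg_right ht (norm_nonneg W)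
    linarith [(hC k hk y).2]
  have hθ'' := abs_le.1 (hθ'.trans hη₁1)
  have hΦE : ∀ a : ℝ, ∀ y, ζ y = 1 → |g (k * φ y) - a| < η₁ →
      ‖fderiv ℝ (fderiv ℝ Φ) y - (a - θ) • W‖ ≤ η := by
    intro a y hy hga
    apply hHess y a
    have := abs_lt.1 hga
    rw [hy, abs_le]
    constructor <;> linarith
  -- The level set where `g (k φ) = a` need not be open; it is enlarged to `|g (k φ) - a| < η₁`,
  -- since later perturbations are supported in open sets.
  have hmE : ∀ a : ℝ, (∫ y : SpaceTime n,
      χ y * ({x | g x = a}.indicator (fun _ => (1 : ℝ))) (k * φ y)) ≤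
      volume.real {y | χ y ≠ 0 ∧ |g (k * φ y) - a| < η₁} := by
    intro a
    have hm : MeasurableSet {y : SpaceTime n | χ y ≠ 0 ∧ |g (k * φ y) - a| < η₁} := by
      apply MeasurableSet.inter
      · exact (hχ.continuous.measurable (measurableSet_singleton 0)).compl
      · exact measurableSet_lt
          ((((hg.continuous.comp (by fun_prop : Continuous fun y : SpaceTime n =>
            (k : ℝ) * φ y)).sub continuous_const).abs).measurable) measurable_const
    have hfin : volume {y : SpaceTime n | χ y ≠ 0 ∧ |g (k * φ y) - a| < η₁} ≠ ⊤ :=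
      ((measure_mono fun y hy => hχK₁ y hy.1).trans_lt hK₁.measure_lt_top).ne
    calc _ ≤ ∫ y, ({y | χ y ≠ 0 ∧ |g (k * φ y) - a| < η₁}.indicator (fun _ => (1 : ℝ))) y := by
          apply integral_mono_of_nonneg
          · exact Filter.Eventually.of_forall fun y =>
              mul_nonneg (hχ01 y).1 (indicator_nonneg (fun _ _ => zero_le_one) _)
          · exact (integrable_indicator_iff hm).2 (integrableOn_const hfin)
          · refine Filter.Eventually.of_forall fun y => ?_
            by_cases hy : χ y = 0
            · simp [hy]
            · by_cases hga : g (k * φ y) = a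
              · simp [indicator, hy, hga, hη₁0, (hχ01 y).2]
              · simp only [indicator, mem_ofPred_eq, hga, if_false, mul_zero]
                split_ifs <;> norm_num
      _ = _ := by rw [integral_indicator_const _ hm]; simp
  have hopen : ∀ a : ℝ, IsOpen {y : SpaceTime n | χ y ≠ 0 ∧ |g (k * φ y) - a| < η₁} := by
    intro a
    apply IsOpen.inter
    · exact isOpen_ne_fun hχ.continuous continuous_const
    · exact isOpen_lt (((hg.continuous.comp (by fun_prop : Continuous fun y : SpaceTime n =>
            (k : ℝ) * φ y)).sub continuous_const).abs) continuous_const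
  refine ⟨Φ, ⟨?_, ?_, ?_⟩, fun y => ?_, fun y => ?_, {y | χ y ≠ 0 ∧ |g (k * φ y) - 1| < η₁},
    {y | χ y ≠ 0 ∧ |g (k * φ y) - 0| < η₁}, hopen 1, hopen 0, fun y hy => hK₁Q (hχK₁ y hy.1),
    fun y hy => hK₁Q (hχK₁ y hy.1), ?_, hk1.trans (hmE 1), hk2.trans (hmE 0),
    fun y hy => hΦE 1 y (hζone y (hχK₁ y hy.1)) hy.2,
    fun y hy => hΦE 0 y (hζone y (hχK₁ y hy.1)) hy.2⟩
  · exact (contDiff_const.mul (hh.comp (contDiff_const.mul φ.contDiff))).smul hζ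
  · exact hK₂.of_isClosed_subset (isClosed_tsupport _) (hΦsupp.trans hζsupp)
  · exact (hΦsupp.trans hζsupp).trans hK₂Q
  · exact (hC k hk y).1.trans (hCk.trans (by linarith))
  -- The coefficient of `W` is clipped to `[-θ, 1 - θ]`; it leaves this interval by at most `η'`,
  -- because `θ'` is not exactly `θ`.
  · refine ⟨θ + max (-θ) (min (1 - θ) (ζ y * (g (k * φ y) - θ'))), ⟨?_, ?_⟩, hHess y _ ?_⟩
    · linarith [le_max_left (-θ) (min (1 - θ) (ζ y * (g (k * φ y) - θ')))]
    · have : max (-θ) (min (1 - θ) (ζ y * (g (k * φ y) - θ'))) ≤ 1 - θ :=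
        max_le (by linarith) (min_le_left _ _)
      linarith
    · have hz := hζ01 y
      have hgk := hg01 (k * φ y)
      have hlow : -θ - η' ≤ ζ y * (g (k * φ y) - θ') := by nlinarith
      have hup : ζ y * (g (k * φ y) - θ') ≤ 1 - θ + η' := by nlinarith
      rw [abs_le]
      rcases max_cases (-θ) (min (1 - θ) (ζ y * (g (k * φ y) - θ'))) with h | h <;>
      rcases min_cases (1 - θ) (ζ y * (g (k * φ y) - θ')) with h' | h' <;>
      constructor <;> linarith
  · rw [Set.disjoint_left]
    rintro y ⟨-, hy⟩ ⟨-, hy'⟩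
    rw [abs_lt] at hy hy'
    linarith

end ScalarPotential

/-! ### Potentials for wave cone directions. -/

section DivergencePotential

variable {m n : ℕ}

/-- The divergence by rows, as a linear function of the total derivative. -/
noncomputable def divMap (m n : ℕ) :
    (SpaceTime n →L[ℝ] Mat m n) →L[ℝ] EuclideanSpace ℝ (Fin m) :=
  LinearMap.toContinuousLinearMap
    { toFun := fun T => WithLp.toLp 2 fun i => ∑ j, T (Pi.single j 1, 0) (i, j)
      map_add' := fun S T => by
        ext i
        simp [Finset.sum_add_distrib]
      map_smul' := fun c T => by
        ext i
        simp [Finset.mul_sum] }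

/-- The spatial gradient, as a linear function of the total derivative. -/
noncomputable def gradMap (m n : ℕ) :
    (SpaceTime n →L[ℝ] EuclideanSpace ℝ (Fin m)) →L[ℝ] Mat m n :=
  LinearMap.toContinuousLinearMap
    { toFun := fun T => WithLp.toLp 2 fun ij => T (Pi.single ij.2 1, 0) ij.1
      map_add' := fun S T => by
        ext i
        simp
      map_smul' := fun c T => by
        ext i
        simp }

theorem divMap_apply (T : SpaceTime n →L[ℝ] Mat m n) (i : Fin m) :
    divMap m n T i = ∑ j, T (Pi.single j 1, 0) (i, j) := rfl

theorem gradMap_apply (T : SpaceTime n →L[ℝ] EuclideanSpace ℝ (Fin m)) (ij : Fin m × Fin n) :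
    gradMap m n T ij = T (Pi.single ij.2 1, 0) ij.1 := rfl

/-- The divergence of a matrix field on space-time. -/
noncomputable def divField (w : SpaceTime n → Mat m n) (y : SpaceTime n) :
    EuclideanSpace ℝ (Fin m) :=
  divMap m n (fderiv ℝ w y)

/-- The pair `(D div w, ∂_t w)` of a matrix field on space-time. -/
noncomputable def pairField (w : SpaceTime n → Mat m n) (y : SpaceTime n) : MatPair m n :=
  WithLp.toLp 2 (gradMap m n (fderiv ℝ (divField w) y), fderiv ℝ w y (0, 1))

theorem norm_toLp_prod_le {A B : Type*} [NormedAddCommGroup A] [NormedAddCommGroup B] (a : A)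
    (b : B) : ‖WithLp.toLp 2 (a, b)‖ ≤ ‖a‖ + ‖b‖ := by
  rw [WithLp.prod_norm_eq_of_L2]
  apply Real.sqrt_le_iff.2
  refine ⟨by positivity, ?_⟩
  change ‖a‖ ^ 2 + ‖b‖ ^ 2 ≤ _
  nlinarith [mul_nonneg (norm_nonneg a) (norm_nonneg b)]

/-- The linear form `(x, t) ↦ a · x + s t`. -/
noncomputable def waveForm (a : EuclideanSpace ℝ (Fin n)) (s : ℝ) : SpaceTime n →L[ℝ] ℝ :=
  LinearMap.toContinuousLinearMap
    { toFun := fun y => (∑ j, a j * y.1 j) + s * y.2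
      map_add' := fun y z => by
        simp [mul_add, Finset.sum_add_distrib]
        ring
      map_smul' := fun c y => by
        simp only [Prod.smul_fst, Prod.smul_snd, Pi.smul_apply, smul_eq_mul, RingHom.id_apply,
          mul_add, Finset.mul_sum]
        congr 1
        · exact Finset.sum_congr rfl fun k _ => by ring
        · ring }

theorem waveForm_space (a : EuclideanSpace ℝ (Fin n)) (s : ℝ) (j : Fin n) :
    waveForm a s (Pi.single j 1, 0) = a j := by
  change (∑ i, a i * (Pi.single j 1 : Fin n → ℝ) i) + s * 0 = a j
  simp [Pi.single_apply]

theorem waveForm_time (a : EuclideanSpace ℝ (Fin n)) (s : ℝ) : waveForm a s (0, 1) = s := by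
  change (∑ i, a i * (0 : Fin n → ℝ) i) + s * 1 = s
  simp

/-- The first order part of the wave potential, with divergence-free range. -/
noncomputable def skewMap (a : EuclideanSpace ℝ (Fin n)) (B : Mat m n) (c : ℝ) :
    (SpaceTime n →L[ℝ] ℝ) →L[ℝ] Mat m n :=
  LinearMap.toContinuousLinearMap
    { toFun := fun φ => WithLp.toLp 2 fun ij =>
        c * ∑ k, (B ij * a k - a ij.2 * B (ij.1, k)) * φ (Pi.single k 1, 0)
      map_add' := fun S T => by
        ext i
        simp [Finset.sum_add_distrib, mul_add]
      map_smul' := fun c T => by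
        ext i
        simp only [smul_apply, smul_eq_mul, Finset.mul_sum, RingHom.id_apply, PiLp.smul_apply]
        refine Finset.sum_congr rfl fun k _ => ?_
        ring }

theorem skewMap_apply (a : EuclideanSpace ℝ (Fin n)) (B : Mat m n) (c : ℝ)
    (φ : SpaceTime n →L[ℝ] ℝ) (ij : Fin m × Fin n) : skewMap a B c φ ij =
      c * ∑ k, (B ij * a k - a ij.2 * B (ij.1, k)) * φ (Pi.single k 1, 0) := rfl

/-- The linear map `φ ↦ c (φ · a) p` for a linear form `φ` on space-time. -/
noncomputable def axialMap (p : EuclideanSpace ℝ (Fin m)) (a : EuclideanSpace ℝ (Fin n)) (c : ℝ) :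
    (SpaceTime n →L[ℝ] ℝ) →L[ℝ] EuclideanSpace ℝ (Fin m) :=
  LinearMap.toContinuousLinearMap
    { toFun := fun φ => (c * ∑ j, a j * φ (Pi.single j 1, 0)) • p
      map_add' := fun S T => by
        simp [Finset.sum_add_distrib, mul_add, add_smul]
      map_smul' := fun d T => by
        rw [RingHom.id_apply, smul_smul]
        congr 1
        simp only [smul_apply, smul_eq_mul, Finset.mul_sum]
        refine Finset.sum_congr rfl fun k _ => ?_
        ring }

theorem axialMap_apply (p : EuclideanSpace ℝ (Fin m)) (a : EuclideanSpace ℝ (Fin n)) (c : ℝ)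
    (φ : SpaceTime n →L[ℝ] ℝ) :
    axialMap p a c φ = (c * ∑ j, a j * φ (Pi.single j 1, 0)) • p := rfl

/-- Row `i` of `p ⊗ a` is `p_i a`, so the divergence of `Φ p ⊗ a` is `p` times the derivative of `Φ`
along `a`. This part of the potential produces `D div w`. -/
theorem divMap_smulRight (p : EuclideanSpace ℝ (Fin m)) (a : EuclideanSpace ℝ (Fin n)) (c : ℝ)
    (φ : SpaceTime n →L[ℝ] ℝ) :
    divMap m n (φ.smulRight (c • tensor p a)) = axialMap p a c φ := by
  ext i
  rw [divMap_apply, axialMap_apply]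
  simp only [ContinuousLinearMap.smulRight_apply, PiLp.smul_apply, tensor, smul_eq_mul,
    Finset.mul_sum, Finset.sum_mul]
  refine Finset.sum_congr rfl fun k _ => ?_
  ring

/-- The coefficients are antisymmetric in `(j, k)` and a Hessian is symmetric, so the double sum
equals its own negative. This part of the potential can therefore produce `∂_t w` without affecting
`div w`. -/
theorem divMap_skewMap_comp (a : EuclideanSpace ℝ (Fin n)) (B : Mat m n) (c : ℝ)
    (H : SpaceTime n →L[ℝ] SpaceTime n →L[ℝ] ℝ) (hH : ∀ y z, H y z = H z y) :
    divMap m n (skewMap a B c ∘L H) = 0 := by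
  ext i
  rw [divMap_apply]
  simp only [ContinuousLinearMap.comp_apply, skewMap_apply, PiLp.zero_apply]
  rw [← Finset.mul_sum]
  have h1 : ∑ j, ∑ k, (B (i, j) * a k - a j * B (i, k)) * H (Pi.single j 1, 0) (Pi.single k 1, 0) =
      -∑ j, ∑ k, (B (i, j) * a k - a j * B (i, k)) * H (Pi.single j 1, 0) (Pi.single k 1, 0) := by
    nth_rewrite 1 [Finset.sum_comm]
    rw [← Finset.sum_neg_distrib]
    refine Finset.sum_congr rfl fun j _ => ?_
    rw [← Finset.sum_neg_distrib]
    refine Finset.sum_congr rfl fun k _ => ?_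
    rw [hH (Pi.single k 1, 0)]
    ring
  have h2 : ∑ j, ∑ k, (B (i, j) * a k - a j * B (i, k)) *
      H (Pi.single j 1, 0) (Pi.single k 1, 0) = 0 := by linarith
  rw [h2, mul_zero]

/-- The algebra of plane waves: the potential attached to `φ ⊗ φ` gives the wave cone vector. -/
theorem planeWave_algebra {p : EuclideanSpace ℝ (Fin m)} {a : EuclideanSpace ℝ (Fin n)}
    {B : Mat m n} (ha : a ≠ 0) (hB : ∀ i, ∑ j, B (i, j) * a j = 0) {s : ℝ} (hs : s ≠ 0) :
    axialMap p a (∑ k, a k ^ 2)⁻¹ (waveForm a s) = p ∧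
      skewMap a B (s * ∑ k, a k ^ 2)⁻¹ (waveForm a s) = s⁻¹ • B := by
  have hA : ∑ k, a k ^ 2 ≠ 0 := by
    rw [← EuclideanSpace.real_norm_sq_eq]
    exact pow_ne_zero 2 (norm_ne_zero_iff.2 ha)
  constructor
  · rw [axialMap_apply]
    simp only [waveForm_space, ← sq]
    rw [inv_mul_cancel₀ hA, one_smul]
  · ext ij
    rw [skewMap_apply]
    simp only [waveForm_space, PiLp.smul_apply, smul_eq_mul]
    -- The condition `B a = 0` removes the second sum and leaves `|a|² B`.
    have h1 : ∑ k, (B ij * a k - a ij.2 * B (ij.1, k)) * a k =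
        B ij * ∑ k, a k ^ 2 - a ij.2 * ∑ k, B (ij.1, k) * a k := by
      rw [Finset.mul_sum, Finset.mul_sum, ← Finset.sum_sub_distrib]
      refine Finset.sum_congr rfl fun k _ => ?_
      ring
    rw [h1, hB]
    field_simp
    ring

/-- Derivatives of the wave potential built from a scalar potential. -/
theorem divField_pairField_potential (p : EuclideanSpace ℝ (Fin m))
    (a : EuclideanSpace ℝ (Fin n)) (B : Mat m n) (c c' : ℝ) {Φ : SpaceTime n → ℝ}
    (hΦ : ContDiff ℝ ∞ Φ) :
    (divField (fun y => Φ y • (c • tensor p a) + skewMap a B c' (fderiv ℝ Φ y)) =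
      fun y => axialMap p a c (fderiv ℝ Φ y)) ∧
    (∀ y, fderiv ℝ (fun y => axialMap p a c (fderiv ℝ Φ y)) y =
      axialMap p a c ∘L fderiv ℝ (fderiv ℝ Φ) y) ∧
    ∀ y, pairField (fun y => Φ y • (c • tensor p a) + skewMap a B c' (fderiv ℝ Φ y)) y =
      WithLp.toLp 2 (gradMap m n (axialMap p a c ∘L fderiv ℝ (fderiv ℝ Φ) y),
        fderiv ℝ Φ y (0, 1) • (c • tensor p a) +
          skewMap a B c' (fderiv ℝ (fderiv ℝ Φ) y (0, 1))) := by
  have hΦ1 : ContDiff ℝ ∞ (fderiv ℝ Φ) := hΦ.fderiv_right (by simp)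
  have hd : ∀ y, HasFDerivAt Φ (fderiv ℝ Φ y) y := fun y =>
    (hΦ.differentiable (by simp) y).hasFDerivAt
  have hd1 : ∀ y, HasFDerivAt (fderiv ℝ Φ) (fderiv ℝ (fderiv ℝ Φ) y) y := fun y =>
    (hΦ1.differentiable (by simp) y).hasFDerivAt
  have hw : ∀ y, HasFDerivAt (fun y => Φ y • (c • tensor p a) + skewMap a B c' (fderiv ℝ Φ y))
      ((fderiv ℝ Φ y).smulRight (c • tensor p a) +
        skewMap a B c' ∘L fderiv ℝ (fderiv ℝ Φ) y) y := fun y =>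
    ((hd y).smul_const _).add ((skewMap a B c').hasFDerivAt.comp y (hd1 y))
  have hdiv : divField (fun y => Φ y • (c • tensor p a) + skewMap a B c' (fderiv ℝ Φ y)) =
      fun y => axialMap p a c (fderiv ℝ Φ y) := by
    ext1 y
    rw [divField, (hw y).fderiv, map_add, divMap_smulRight, divMap_skewMap_comp, add_zero]
    exact fun z z' => hΦ.contDiffAt.isSymmSndFDerivAt (by simpa using ENat.LEInfty.out) z z'
  have hax : ∀ y, fderiv ℝ (fun y => axialMap p a c (fderiv ℝ Φ y)) y =
      axialMap p a c ∘L fderiv ℝ (fderiv ℝ Φ) y := fun y =>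
    ((axialMap p a c).hasFDerivAt.comp y (hd1 y)).fderiv
  refine ⟨hdiv, hax, fun y => ?_⟩
  rw [pairField, hdiv, hax, (hw y).fderiv]
  rfl

end DivergencePotential

/-! ### Localized plane waves. -/

section PlaneWave

variable {m n : ℕ}

theorem IsTestFun.potential {Q : Set (SpaceTime n)} {Φ : SpaceTime n → ℝ} (hΦ : IsTestFun Q Φ)
    (P : Mat m n) (Λ : (SpaceTime n →L[ℝ] ℝ) →L[ℝ] Mat m n) :
    IsTestFun Q (fun y => Φ y • P + Λ (fderiv ℝ Φ y)) := by
  obtain ⟨h1, h2, h3⟩ := hΦ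
  have hsub : tsupport (fun y => Φ y • P + Λ (fderiv ℝ Φ y)) ⊆ tsupport Φ := by
    apply closure_minimal _ (isClosed_tsupport _)
    intro y hy
    by_contra hyΦ
    apply hy
    have h0 : Φ y = 0 := image_eq_zero_of_notMem_tsupport hyΦ
    have h1 : fderiv ℝ Φ y = 0 := fderiv_of_notMem_tsupport ℝ hyΦ
    simp [h0, h1]
  have h1' : ContDiff ℝ ∞ (fderiv ℝ Φ) := h1.fderiv_right (by simp)
  exact ⟨(h1.smul contDiff_const).add (Λ.contDiff.comp h1'),
    h2.of_isClosed_subset (isClosed_tsupport _) hsub, hsub.trans h3⟩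

/-- Estimates for the wave potential of a scalar potential with small gradient and with Hessian
close to a multiple of `φ ⊗ φ`. -/
theorem exists_bound_wavePotential {p : EuclideanSpace ℝ (Fin m)}
    {a : EuclideanSpace ℝ (Fin n)} {B : Mat m n} (ha : a ≠ 0)
    (hB : ∀ i, ∑ j, B (i, j) * a j = 0) {s : ℝ} (hs : 0 < s) :
    ∃ (C : ℝ) (P : Mat m n) (Λ : (SpaceTime n →L[ℝ] ℝ) →L[ℝ] Mat m n), 0 ≤ C ∧
      ∀ (Φ : SpaceTime n → ℝ), ContDiff ℝ ∞ Φ → ∀ (y : SpaceTime n) (η τ : ℝ),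
      ‖fderiv ℝ Φ y‖ ≤ η →
      ‖fderiv ℝ (fderiv ℝ Φ) y - τ • (waveForm a s).smulRight (waveForm a s)‖ ≤ η →
      ‖pairField (fun y => Φ y • P + Λ (fderiv ℝ Φ y)) y -
        τ • (WithLp.toLp 2 (tensor p a, B) : MatPair m n)‖ ≤ C * η ∧
      ‖divField (fun y => Φ y • P + Λ (fderiv ℝ Φ y)) y‖ ≤ C * η ∧
      ‖fderiv ℝ (divField (fun y => Φ y • P + Λ (fderiv ℝ Φ y))) y (0, 1)‖ ≤
        C * η + |τ| * (s * ‖p‖) := by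
  obtain ⟨hAω, hΛω⟩ := planeWave_algebra (p := p) ha hB hs.ne'
  generalize hc : (∑ k, a k ^ 2)⁻¹ = c at *
  generalize hc' : (s * ∑ k, a k ^ 2)⁻¹ = c' at *
  have hpot := fun (Φ : SpaceTime n → ℝ) (hΦ : ContDiff ℝ ∞ Φ) =>
    divField_pairField_potential p a B c c' hΦ
  generalize hA : axialMap p a c = A at *
  generalize hΛ : skewMap a B c' = Λ at *
  have hφj := waveForm_space a s
  have hφe := waveForm_time a s
  generalize hφ : waveForm a s = φ at *
  generalize hP : c • tensor p a = P at *
  generalize he : ((0, 1) : SpaceTime n) = e at *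
  have hW1 : gradMap m n (A ∘L φ.smulRight φ) = tensor p a := by
    ext ij
    rw [gradMap_apply]
    simp only [ContinuousLinearMap.comp_apply, ContinuousLinearMap.smulRight_apply, map_smul, hAω]
    rw [hφj]
    simp [tensor, mul_comm]
  have hW2 : Λ (φ.smulRight φ e) = B := by
    rw [ContinuousLinearMap.smulRight_apply, map_smul, hΛω, hφe, smul_smul,
      mul_inv_cancel₀ hs.ne', one_smul]
  have hW3 : A (φ.smulRight φ e) = s • p := by
    rw [ContinuousLinearMap.smulRight_apply, map_smul, hAω, hφe]
  have h0A := norm_nonneg A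
  have h0Λ := norm_nonneg Λ
  have h0e := norm_nonneg e
  have h0P := norm_nonneg P
  have h0g := norm_nonneg (gradMap m n)
  refine ⟨‖gradMap m n‖ * ‖A‖ + (‖e‖ * ‖P‖ + ‖Λ‖ * ‖e‖) + ‖A‖ * ‖e‖ + ‖A‖, P, Λ, by positivity,
    fun Φ hΦ y η τ h1 h2 => ?_⟩
  obtain ⟨hdiv, hddiv, hpair⟩ := hpot Φ hΦ
  have hη : 0 ≤ η := (norm_nonneg _).trans h1
  generalize hH : fderiv ℝ (fderiv ℝ Φ) y = H at *
  -- All second order quantities are linear in the Hessian: `τ φ ⊗ φ` contributes the exact plane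
  -- wave and `D` the error.
  obtain ⟨D, hD⟩ : ∃ D, D = H - τ • φ.smulRight φ := ⟨_, rfl⟩
  rw [← hD] at h2
  have hHD : H = D + τ • φ.smulRight φ := by rw [hD]; abel
  have hDe : ‖D e‖ ≤ η * ‖e‖ := (ContinuousLinearMap.le_opNorm _ _).trans (by gcongr)
  refine ⟨?_, ?_, ?_⟩
  · have e1 : gradMap m n (A ∘L H) - τ • tensor p a = gradMap m n (A ∘L D) := by
      rw [hHD, ContinuousLinearMap.comp_add, ContinuousLinearMap.comp_smul, map_add, map_smul,
        hW1, add_sub_cancel_right]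
    have e2 : fderiv ℝ Φ y e • P + Λ (H e) - τ • B = fderiv ℝ Φ y e • P + Λ (D e) := by
      rw [hHD, add_apply, smul_apply, map_add, map_smul, hW2]
      abel
    have e3 : pairField (fun y => Φ y • P + Λ (fderiv ℝ Φ y)) y -
        τ • (WithLp.toLp 2 (tensor p a, B) : MatPair m n) =
        WithLp.toLp 2 (gradMap m n (A ∘L D), fderiv ℝ Φ y e • P + Λ (D e)) := by
      rw [← e1, ← e2, hpair, hH]
      rfl
    rw [e3]
    refine (norm_toLp_prod_le _ _).trans ?_
    have b1 : ‖gradMap m n (A ∘L D)‖ ≤ ‖gradMap m n‖ * (‖A‖ * η) := by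
      refine (ContinuousLinearMap.le_opNorm _ _).trans ?_
      gcongr
      exact (ContinuousLinearMap.opNorm_comp_le _ _).trans (by gcongr)
    have b2 : ‖fderiv ℝ Φ y e • P‖ ≤ η * ‖e‖ * ‖P‖ := by
      rw [norm_smul]
      gcongr
      exact (ContinuousLinearMap.le_opNorm _ _).trans (by gcongr)
    have b3 : ‖Λ (D e)‖ ≤ ‖Λ‖ * (η * ‖e‖) :=
      (ContinuousLinearMap.le_opNorm _ _).trans (by gcongr)
    have b4 : ‖fderiv ℝ Φ y e • P + Λ (D e)‖ ≤ ‖fderiv ℝ Φ y e • P‖ + ‖Λ (D e)‖ := norm_add_le _ _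
    have b5 : 0 ≤ ‖A‖ * ‖e‖ * η := by positivity
    have b6 : 0 ≤ ‖A‖ * η := by positivity
    linarith
  · rw [hdiv]
    have b1 : ‖A (fderiv ℝ Φ y)‖ ≤ ‖A‖ * η :=
      (ContinuousLinearMap.le_opNorm _ _).trans (by gcongr)
    have b2 : 0 ≤ (‖gradMap m n‖ * ‖A‖ + (‖e‖ * ‖P‖ + ‖Λ‖ * ‖e‖) + ‖A‖ * ‖e‖) * η := by
      positivity
    linarith
  · rw [hdiv, hddiv, ContinuousLinearMap.comp_apply, hH, hHD, add_apply, smul_apply, map_add,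
      map_smul, hW3]
    refine (norm_add_le _ _).trans ?_
    have b1 : ‖A (D e)‖ ≤ ‖A‖ * (η * ‖e‖) :=
      (ContinuousLinearMap.le_opNorm _ _).trans (by gcongr)
    have b2 : 0 ≤ (‖gradMap m n‖ * ‖A‖ + (‖e‖ * ‖P‖ + ‖Λ‖ * ‖e‖) + ‖A‖) * η := by
      positivity
    have b3 : ‖τ • s • p‖ = |τ| * (s * ‖p‖) := by
      rw [norm_smul, norm_smul, Real.norm_eq_abs, Real.norm_of_nonneg hs.le]
    rw [b3]
    linarith

/-- Localized plane waves: a compactly supported field `w` in `Q` for which `(D div w, ∂_t w)`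
stays close to the segment `{(t - θ) (α - β) : 0 ≤ t ≤ 1}`, is close to its endpoints on sets of
relative measure nearly `θ` and `1 - θ`, while `div w` and `∂_t div w` are small. -/
theorem exists_localized_planeWave {Q : Set (SpaceTime n)} (hQ : IsOpen Q)
    (hQb : Bornology.IsBounded Q) {g : MatPair m n} (hg : g ∈ waveCone m n) {θ ε : ℝ}
    (h0 : 0 ≤ θ) (h1 : θ ≤ 1) (hε : 0 < ε) :
    ∃ w : SpaceTime n → Mat m n, IsTestFun Q w ∧
      (∀ y, ‖divField w y‖ < ε ∧ ‖fderiv ℝ (divField w) y (0, 1)‖ < ε) ∧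
      (∀ y, ∃ t ∈ Icc (0 : ℝ) 1, ‖pairField w y - (t - θ) • g‖ < ε) ∧
      ∃ E₁ E₂ : Set (SpaceTime n), IsOpen E₁ ∧ IsOpen E₂ ∧ E₁ ⊆ Q ∧ E₂ ⊆ Q ∧ Disjoint E₁ E₂ ∧
        (θ - ε) * volume.real Q ≤ volume.real E₁ ∧
        (1 - θ - ε) * volume.real Q ≤ volume.real E₂ ∧
        (∀ y ∈ E₁, ‖pairField w y - (1 - θ) • g‖ < ε) ∧
        (∀ y ∈ E₂, ‖pairField w y - (0 - θ) • g‖ < ε) := by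
  obtain ⟨p, a, B, ha, hB, rfl⟩ := hg
  -- The main part `τ s p` of `∂_t div w` does not shrink with the wavelength, so the time frequency
  -- `s` is taken small. It must stay positive because the potential contains `1 / s`; the constant
  -- `C` depends on `s`, hence `η` is chosen afterwards.
  obtain ⟨s, hs, hsp⟩ : ∃ s : ℝ, 0 < s ∧ s * ‖p‖ ≤ ε / 4 := by
    have := norm_nonneg p
    refine ⟨ε / (4 * (‖p‖ + 1)), by positivity, ?_⟩
    rw [div_mul_eq_mul_div, div_le_div_iff₀ (by positivity) (by positivity)]
    nlinarith
  obtain ⟨C, P, Λ, hC, hbound⟩ := exists_bound_wavePotential (p := p) ha hB hs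
  have hφ0 : waveForm a s ≠ 0 := by
    intro h
    have := waveForm_time a s
    rw [h] at this
    simp at this
    exact hs.ne this
  obtain ⟨η, hη, hηε, hηC⟩ : ∃ η : ℝ, 0 < η ∧ η ≤ ε ∧ C * η ≤ ε / 2 := by
    refine ⟨min ε (ε / (2 * (C + 1))), by positivity, min_le_left _ _, ?_⟩
    calc C * min ε (ε / (2 * (C + 1))) ≤ C * (ε / (2 * (C + 1))) := by
          gcongr
          exact min_le_right _ _
      _ ≤ ε / 2 := by
          rw [mul_div_assoc', div_le_div_iff₀ (by positivity) (by positivity)]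
          nlinarith
  obtain ⟨Φ, hΦ, hΦ1, hΦ2, E₁, E₂, hE₁, hE₂, hE₁Q, hE₂Q, hE, hm₁, hm₂, hH₁, hH₂⟩ :=
    exists_scalar_potential hQ hQb hφ0 h0 h1 hη
  have hkey := fun y τ => hbound Φ hΦ.1 y η τ (hΦ1 y)
  have hvol : 0 ≤ volume.real Q := measureReal_nonneg
  refine ⟨fun y => Φ y • P + Λ (fderiv ℝ Φ y), hΦ.potential _ _, fun y => ?_, fun y => ?_, E₁, E₂,
    hE₁, hE₂, hE₁Q, hE₂Q, hE, ?_, ?_, fun y hy => ?_, fun y hy => ?_⟩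
  · obtain ⟨t, ht, htH⟩ := hΦ2 y
    obtain ⟨-, b1, b2⟩ := hkey y _ htH
    have ht1 : |t - θ| ≤ 1 := abs_le.2 ⟨by linarith [ht.1], by linarith [ht.2]⟩
    have b3 : |t - θ| * (s * ‖p‖) ≤ 1 * (s * ‖p‖) :=
      mul_le_mul_of_nonneg_right ht1 (by positivity)
    exact ⟨by linarith, by linarith⟩
  · obtain ⟨t, ht, htH⟩ := hΦ2 y
    exact ⟨t, ht, (hkey y _ htH).1.trans_lt (by linarith)⟩
  · exact le_trans (mul_le_mul_of_nonneg_right (by linarith) hvol) hm₁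
  · exact le_trans (mul_le_mul_of_nonneg_right (by linarith) hvol) hm₂
  · exact (hkey y _ (hH₁ y hy)).1.trans_lt (by linarith)
  · exact (hkey y _ (hH₂ y hy)).1.trans_lt (by linarith)

end PlaneWave

/-! ### Linearity and locality of the differential operators. -/

section FieldCalculus

variable {m n : ℕ}

theorem contDiff_divField {w : SpaceTime n → Mat m n} (hw : ContDiff ℝ ∞ w) :
    ContDiff ℝ ∞ (divField w) :=
  (divMap m n).contDiff.comp (hw.fderiv_right (by simp))

theorem continuous_pairField {w : SpaceTime n → Mat m n} (hw : ContDiff ℝ ∞ w) :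
    Continuous (pairField w) := by
  have h1 : Continuous (fderiv ℝ w) := hw.continuous_fderiv (by simp)
  have h2 : Continuous (fderiv ℝ (divField w)) := (contDiff_divField hw).continuous_fderiv (by simp)
  refine (WithLp.prod_continuous_toLp 2 _ _).comp ?_
  exact ((gradMap m n).continuous.comp h2).prodMk (h1.clm_apply continuous_const)

theorem divField_sum {ι : Type*} (s : Finset ι) {w : ι → SpaceTime n → Mat m n}
    (hw : ∀ i ∈ s, ContDiff ℝ ∞ (w i)) (y : SpaceTime n) :
    divField (∑ i ∈ s, w i) y = ∑ i ∈ s, divField (w i) y := by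
  rw [divField, fderiv_sum fun i hi => (hw i hi).differentiable (by simp) y, map_sum]
  rfl

theorem fderiv_divField_sum {ι : Type*} (s : Finset ι) {w : ι → SpaceTime n → Mat m n}
    (hw : ∀ i ∈ s, ContDiff ℝ ∞ (w i)) (y : SpaceTime n) :
    fderiv ℝ (divField (∑ i ∈ s, w i)) y = ∑ i ∈ s, fderiv ℝ (divField (w i)) y := by
  have h : divField (∑ i ∈ s, w i) = ∑ i ∈ s, divField (w i) := by
    ext1 y
    rw [divField_sum s hw, Finset.sum_apply]
  rw [h, fderiv_sum fun i hi => (contDiff_divField (hw i hi)).differentiable (by simp) y]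

theorem pairField_sum {ι : Type*} (s : Finset ι) {w : ι → SpaceTime n → Mat m n}
    (hw : ∀ i ∈ s, ContDiff ℝ ∞ (w i)) (y : SpaceTime n) :
    pairField (∑ i ∈ s, w i) y = ∑ i ∈ s, pairField (w i) y := by
  simp only [pairField]
  rw [fderiv_divField_sum s hw, fderiv_sum fun i hi => (hw i hi).differentiable (by simp) y,
    map_sum, sum_apply]
  induction s using Finset.cons_induction with
  | empty => simp
  | cons a s ha ih =>
    simp only [Finset.sum_cons]
    rw [← ih fun i hi => hw i (Finset.mem_cons_of_mem hi)]
    rfl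

theorem fderiv_divField_eq_zero {w : SpaceTime n → Mat m n} {y : SpaceTime n}
    (hy : y ∉ tsupport w) : divField w y = 0 ∧ fderiv ℝ (divField w) y = 0 ∧
      pairField w y = 0 := by
  have h1 : fderiv ℝ w y = 0 := fderiv_of_notMem_tsupport ℝ hy
  have h2 : divField w =ᶠ[𝓝 y] fun _ => 0 := by
    filter_upwards [(isClosed_tsupport w).isOpen_compl.mem_nhds hy] with z hz
    rw [divField, fderiv_of_notMem_tsupport ℝ hz, map_zero]
  have h3 : fderiv ℝ (divField w) y = 0 := by
    rw [h2.fderiv_eq]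
    simp
  refine ⟨h2.self_of_nhds, h3, ?_⟩
  rw [pairField, h1, h3, map_zero]
  rfl

theorem IsTestFun.sum {F : Type*} [NormedAddCommGroup F] [NormedSpace ℝ F]
    {G : Set (SpaceTime n)} {ι : Type*} (s : Finset ι) {w : ι → SpaceTime n → F}
    (hw : ∀ i ∈ s, IsTestFun G (w i)) : IsTestFun G (∑ i ∈ s, w i) := by
  induction s using Finset.cons_induction with
  | empty =>
    rw [Finset.sum_empty]
    exact ⟨contDiff_const, HasCompactSupport.zero, by simp [tsupport]⟩
  | cons a s ha ih =>
    obtain ⟨h1, h2, h3⟩ := hw a (Finset.mem_cons_self a s)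
    obtain ⟨g1, g2, g3⟩ := ih fun i hi => hw i (Finset.mem_cons_of_mem hi)
    rw [Finset.sum_cons]
    refine ⟨h1.add g1, h2.add g2, (tsupport_add _ _).trans (union_subset h3 g3)⟩

theorem IsTestFun.mono {F : Type*} [NormedAddCommGroup F] [NormedSpace ℝ F]
    {G G' : Set (SpaceTime n)} {w : SpaceTime n → F} (hw : IsTestFun G w) (h : G ⊆ G') :
    IsTestFun G' w :=
  ⟨hw.1, hw.2.1, hw.2.2.trans h⟩

theorem IsTestFun.isTestFun_divField {G : Set (SpaceTime n)} {w : SpaceTime n → Mat m n}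
    (hw : IsTestFun G w) : IsTestFun G (divField w) := by
  have hsub : tsupport (divField w) ⊆ tsupport w := by
    apply closure_minimal _ (isClosed_tsupport _)
    intro y hy
    by_contra h
    exact hy (fderiv_divField_eq_zero h).1
  exact ⟨contDiff_divField hw.1, hw.2.1.of_isClosed_subset (isClosed_tsupport _) hsub,
    hsub.trans hw.2.2⟩

end FieldCalculus

/-! ### Approximate realization of laminates. -/

section Realization

variable {m n : ℕ}

/-- `c`, thought of as a probability measure with barycentre `Y`, can be realized approximately in
every bounded open set as the distribution of `Y + (D div w, ∂_t w)` with a compactly supported `w`,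
keeping all values close to `K`, and with `div w` and `∂_t div w` small. -/
def Realizes (K : Set (MatPair m n)) (Y : MatPair m n) (c : Set (MatPair m n) → ℝ) : Prop :=
  (∀ A, 0 ≤ c A ∧ c A ≤ 1) ∧
  ∀ Q : Set (SpaceTime n), IsOpen Q → Bornology.IsBounded Q → ∀ ε : ℝ, 0 < ε →
  ∃ w : SpaceTime n → Mat m n, IsTestFun Q w ∧
    (∀ y, ‖divField w y‖ < ε ∧ ‖fderiv ℝ (divField w) y (0, 1)‖ < ε) ∧
    (∀ y, Y + pairField w y ∈ Metric.thickening ε K) ∧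
    ∀ A : Set (MatPair m n), (c A - ε) * volume.real Q ≤
      volume.real (Q ∩ {y | Y + pairField w y ∈ Metric.thickening ε A})

/-- A Dirac mass is realized by the zero field. -/
theorem Realizes.of_mem {K : Set (MatPair m n)} {Y : MatPair m n} (hY : Y ∈ K) :
    Realizes K Y fun A => A.indicator (fun _ => 1) Y := by
  refine ⟨fun A => ⟨indicator_nonneg (fun _ _ => zero_le_one) _,
    indicator_le_self' (fun _ _ => zero_le_one) _⟩, fun Q hQ hQb ε hε => ?_⟩
  have hts : tsupport (0 : SpaceTime n → Mat m n) = ∅ := by simp [tsupport]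
  have hz : ∀ y, pairField (0 : SpaceTime n → Mat m n) y = 0 := fun y =>
    (fderiv_divField_eq_zero (by simp [hts])).2.2
  refine ⟨0, ⟨contDiff_const, HasCompactSupport.zero, by simp [hts]⟩, fun y => ?_, fun y => ?_,
    fun A => ?_⟩
  · obtain ⟨h1, h2, -⟩ := fderiv_divField_eq_zero (w := (0 : SpaceTime n → Mat m n)) (y := y)
      (by simp [hts])
    rw [h1, h2]
    simp [hε]
  · rw [hz, add_zero]
    exact Metric.self_subset_thickening hε K hY
  · simp only [hz, add_zero]
    by_cases hA : Y ∈ A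
    · have : Y ∈ Metric.thickening ε A := Metric.self_subset_thickening hε A hA
      simp only [indicator_of_mem hA, this, ofPred_true, inter_univ]
      nlinarith [measureReal_nonneg (μ := volume) (s := Q)]
    · rw [indicator_of_notMem hA]
      have := measureReal_nonneg (μ := volume) (s := Q)
      exact le_trans (by nlinarith) measureReal_nonneg

/-- The weights enter only as lower bounds, with no additivity required, so mass may be discarded;
the induction around the cycle starts from weight `0`. -/
theorem Realizes.mono {K : Set (MatPair m n)} {Y : MatPair m n} {c c' : Set (MatPair m n) → ℝ}
    (h : Realizes K Y c) (h0 : ∀ A, 0 ≤ c' A) (hcc : ∀ A, c' A ≤ c A) : Realizes K Y c' := by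
  refine ⟨fun A => ⟨h0 A, (hcc A).trans (h.1 A).2⟩, fun Q hQ hQb ε hε => ?_⟩
  obtain ⟨w, h1, h2, h3, h4⟩ := h.2 Q hQ hQb ε hε
  exact ⟨w, h1, h2, h3, fun A => le_trans (mul_le_mul_of_nonneg_right (by linarith [hcc A])
    measureReal_nonneg) (h4 A)⟩

theorem mem_thickening_of_norm_sub_lt {E : Type*} [SeminormedAddCommGroup E] {A : Set E}
    {x x' : E} {δ ε : ℝ} (hx : x ∈ Metric.thickening δ A) (h : ‖x' - x‖ < ε) :
    x' ∈ Metric.thickening (δ + ε) A := by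
  rw [Metric.mem_thickening_iff] at hx ⊢
  obtain ⟨z, hz, hd⟩ := hx
  refine ⟨z, hz, ?_⟩
  rw [← dist_eq_norm] at h
  linarith [dist_triangle x' x z]

/-- If `c ≤ ε` the left side is nonpositive; otherwise `(c - ε)(θ - ε) ≥ c θ - 2 ε`. This accounts
for the loss when a realization is placed inside a set carrying a proportion `θ - ε`. -/
theorem weight_mul_le {c θ ε V x e : ℝ} (hc0 : 0 ≤ c) (hc1 : c ≤ 1)
    (hθ1 : θ ≤ 1) (hε : 0 < ε) (hV : 0 ≤ V) (hx : 0 ≤ x) (he : (θ - ε) * V ≤ e)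
    (hxe : (c - ε) * e ≤ x) : (c * θ - 2 * ε) * V ≤ x := by
  rcases le_or_gt c ε with h | h
  · exact le_trans (mul_nonpos_of_nonpos_of_nonneg (by nlinarith) hV) hx
  · calc (c * θ - 2 * ε) * V ≤ ((c - ε) * (θ - ε)) * V := by
          gcongr
          nlinarith
      _ = (c - ε) * ((θ - ε) * V) := by ring
      _ ≤ (c - ε) * e := by
          apply mul_le_mul_of_nonneg_left he
          linarith
      _ ≤ x := hxe

/-- Splitting along a segment in the direction of the wave cone. -/
theorem Realizes.split {K : Set (MatPair m n)} {α β : MatPair m n}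
    {c₁ c₂ : Set (MatPair m n) → ℝ} (h₁ : Realizes K α c₁) (h₂ : Realizes K β c₂)
    (hαβ : α - β ∈ waveCone m n) (hK : segment ℝ α β ⊆ K) {θ : ℝ} (hθ0 : 0 ≤ θ) (hθ1 : θ ≤ 1) :
    Realizes K (θ • α + (1 - θ) • β) fun A => θ * c₁ A + (1 - θ) * c₂ A := by
  refine ⟨fun A => ?_, fun Q hQ hQb ε hε => ?_⟩
  · obtain ⟨a1, a2⟩ := h₁.1 A
    obtain ⟨b1, b2⟩ := h₂.1 A
    have : 0 ≤ 1 - θ := by linarith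
    exact ⟨by positivity, by nlinarith⟩
  -- Three fields are added, and each of the two proportions loses `2 ε₁`; the latter makes `ε / 4`
  -- exact.
  set ε₁ := ε / 4 with hε₁
  have hε₁0 : 0 < ε₁ := by positivity
  obtain ⟨w₀, hw₀, hd₀, hp₀, E₁, E₂, hE₁, hE₂, hE₁Q, hE₂Q, hE, hm₁, hm₂, hc₁, hc₂⟩ :=
    exists_localized_planeWave hQ hQb hαβ hθ0 hθ1 hε₁0
  -- The finer fields are supported where the plane wave has brought the value near `α` or near `β`.
  -- Outside `E₁ ∪ E₂` they vanish, and the value stays near the segment, which lies in `K`.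
  obtain ⟨w₁, hw₁, hd₁, hp₁, ht₁⟩ := h₁.2 E₁ hE₁ (hQb.subset hE₁Q) ε₁ hε₁0
  obtain ⟨w₂, hw₂, hd₂, hp₂, ht₂⟩ := h₂.2 E₂ hE₂ (hQb.subset hE₂Q) ε₁ hε₁0
  set W : Fin 3 → SpaceTime n → Mat m n := ![w₀, w₁, w₂] with hW
  have hWs : ∀ i ∈ Finset.univ, ContDiff ℝ ∞ (W i) := by
    intro i _
    fin_cases i
    exacts [hw₀.1, hw₁.1, hw₂.1]
  have hdiv : ∀ y, divField (∑ i, W i) y = divField w₀ y + divField w₁ y + divField w₂ y := by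
    intro y
    rw [divField_sum _ hWs, Fin.sum_univ_three]
    rfl
  have hddiv : ∀ y, fderiv ℝ (divField (∑ i, W i)) y =
      fderiv ℝ (divField w₀) y + fderiv ℝ (divField w₁) y + fderiv ℝ (divField w₂) y := by
    intro y
    rw [fderiv_divField_sum _ hWs, Fin.sum_univ_three]
    rfl
  have hpair : ∀ y, pairField (∑ i, W i) y = pairField w₀ y + pairField w₁ y + pairField w₂ y := by
    intro y
    rw [pairField_sum _ hWs, Fin.sum_univ_three]
    rfl
  have hz₁ : ∀ y, y ∉ E₁ → pairField w₁ y = 0 := fun y hy =>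
    (fderiv_divField_eq_zero fun h => hy (hw₁.2.2 h)).2.2
  have hz₂ : ∀ y, y ∉ E₂ → pairField w₂ y = 0 := fun y hy =>
    (fderiv_divField_eq_zero fun h => hy (hw₂.2.2 h)).2.2
  have hon₁ : ∀ y ∈ E₁, ∀ A, α + pairField w₁ y ∈ Metric.thickening ε₁ A →
      θ • α + (1 - θ) • β + pairField (∑ i, W i) y ∈ Metric.thickening ε A := by
    intro y hy A hA
    refine Metric.thickening_mono (by linarith : ε₁ + ε₁ ≤ ε) _
      (mem_thickening_of_norm_sub_lt hA ?_)
    have : θ • α + (1 - θ) • β + pairField (∑ i, W i) y - (α + pairField w₁ y) =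
        pairField w₀ y - (1 - θ) • (α - β) := by
      rw [hpair, hz₂ y (Set.disjoint_left.1 hE hy)]
      module
    rw [this]
    exact hc₁ y hy
  have hon₂ : ∀ y ∈ E₂, ∀ A, β + pairField w₂ y ∈ Metric.thickening ε₁ A →
      θ • α + (1 - θ) • β + pairField (∑ i, W i) y ∈ Metric.thickening ε A := by
    intro y hy A hA
    refine Metric.thickening_mono (by linarith : ε₁ + ε₁ ≤ ε) _
      (mem_thickening_of_norm_sub_lt hA ?_)
    have : θ • α + (1 - θ) • β + pairField (∑ i, W i) y - (β + pairField w₂ y) =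
        pairField w₀ y - (0 - θ) • (α - β) := by
      rw [hpair, hz₁ y (Set.disjoint_right.1 hE hy)]
      module
    rw [this]
    exact hc₂ y hy
  refine ⟨∑ i, W i, IsTestFun.sum _ fun i _ => ?_, fun y => ?_, fun y => ?_, fun A => ?_⟩
  · fin_cases i
    exacts [hw₀, hw₁.mono hE₁Q, hw₂.mono hE₂Q]
  · rw [hdiv, hddiv, add_apply, add_apply]
    constructor
    · refine norm_add₃_le.trans_lt ?_
      linarith [(hd₀ y).1, (hd₁ y).1, (hd₂ y).1]
    · refine norm_add₃_le.trans_lt ?_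
      linarith [(hd₀ y).2, (hd₁ y).2, (hd₂ y).2]
  · by_cases hy₁ : y ∈ E₁
    · exact hon₁ y hy₁ K (hp₁ y)
    by_cases hy₂ : y ∈ E₂
    · exact hon₂ y hy₂ K (hp₂ y)
    obtain ⟨t, ht, htn⟩ := hp₀ y
    rw [Metric.mem_thickening_iff]
    refine ⟨t • α + (1 - t) • β, hK ⟨t, 1 - t, ht.1, by linarith [ht.2], by ring, rfl⟩, ?_⟩
    rw [dist_eq_norm]
    have : θ • α + (1 - θ) • β + pairField (∑ i, W i) y - (t • α + (1 - t) • β) =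
        pairField w₀ y - (t - θ) • (α - β) := by
      rw [hpair, hz₁ y hy₁, hz₂ y hy₂]
      module
    rw [this]
    linarith
  · have hfin : volume Q ≠ ⊤ := hQb.measure_lt_top.ne
    have hopen : MeasurableSet (E₂ ∩ {y | β + pairField w₂ y ∈ Metric.thickening ε₁ A}) :=
      (hE₂.inter (Metric.isOpen_thickening.preimage
        (continuous_const.add (continuous_pairField hw₂.1)))).measurableSet
    have hle : volume.real (E₁ ∩ {y | α + pairField w₁ y ∈ Metric.thickening ε₁ A}) +
        volume.real (E₂ ∩ {y | β + pairField w₂ y ∈ Metric.thickening ε₁ A}) ≤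
        volume.real (Q ∩ {y | θ • α + (1 - θ) • β + pairField (∑ i, W i) y ∈
          Metric.thickening ε A}) := by
      rw [← measureReal_union (hE.mono inter_subset_left inter_subset_left) hopen
        ((measure_mono (inter_subset_left.trans hE₁Q)).trans_lt hQb.measure_lt_top).ne
        ((measure_mono (inter_subset_left.trans hE₂Q)).trans_lt hQb.measure_lt_top).ne]
      apply measureReal_mono
      · rintro y (⟨hy, hyA⟩ | ⟨hy, hyA⟩)
        · exact ⟨hE₁Q hy, hon₁ y hy A hyA⟩
        · exact ⟨hE₂Q hy, hon₂ y hy A hyA⟩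
      · exact ((measure_mono inter_subset_left).trans_lt hQb.measure_lt_top).ne
    have hV : 0 ≤ volume.real Q := measureReal_nonneg
    have b₁ := weight_mul_le (h₁.1 A).1 (h₁.1 A).2 hθ1 hε₁0 hV measureReal_nonneg hm₁ (ht₁ A)
    have b₂ := weight_mul_le (h₂.1 A).1 (h₂.1 A).2 (by linarith) hε₁0 hV
      measureReal_nonneg hm₂ (ht₂ A)
    refine le_trans ?_ hle
    refine le_trans (le_of_eq ?_) (add_le_add b₁ b₂)
    rw [hε₁]
    ring

end Realization

theorem smul_mem_waveCone {m n : ℕ} {g : MatPair m n} (hg : g ∈ waveCone m n) (c : ℝ) :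
    c • g ∈ waveCone m n := by
  obtain ⟨p, a, B, ha, hB, rfl⟩ := hg
  refine ⟨c • p, a, c • B, ha, fun i => ?_, ?_⟩
  · simp only [PiLp.smul_apply, smul_eq_mul, mul_assoc, ← Finset.mul_sum, hB, mul_zero]
  · have : tensor (c • p) a = c • tensor p a := by
      ext ij
      simp [tensor, mul_assoc]
    rw [this]
    rfl

/-! ### Geometry of the rays, and the cycle of vertices. -/

namespace ONData

variable {m n N : ℕ} {σ : Mat m n → Mat m n}

/-- The point `lam ξ_i(ρ) + (1 - lam) π_i(ρ)`. -/
noncomputable def ray (d : ONData m n N) (i : Fin N) (lam : ℝ) (ρ : MatPair m n) : MatPair m n :=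
  lam • d.endpoint i ρ + (1 - lam) • d.vertex i ρ

theorem ray_eq (d : ONData m n N) (i : Fin N) (lam : ℝ) (ρ : MatPair m n) :
    d.ray i lam ρ = d.vertex i ρ + (lam * d.κ i ρ) • d.γ i ρ := by
  rw [ray, endpoint]
  module

theorem ray_zero (d : ONData m n N) (i : Fin N) (ρ : MatPair m n) :
    d.ray i 0 ρ = d.vertex i ρ := by
  simp [ray_eq]

/-- The ray point is affine in its parameter and equals the vertex at parameter `0`. This is the
source of the factor `lam / mu` in (f). -/
theorem ray_eq_combo (d : ONData m n N) (i : Fin N) {lam mu : ℝ} (hmu : mu ≠ 0)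
    (ρ : MatPair m n) :
    d.ray i lam ρ = (lam / mu) • d.ray i mu ρ + (1 - lam / mu) • d.vertex i ρ := by
  simp only [ray, smul_add, smul_smul, mul_sub]
  rw [div_mul_cancel₀ _ hmu]
  module

theorem ray_sub_vertex (d : ONData m n N) (i : Fin N) (lam : ℝ) (ρ : MatPair m n) :
    d.ray i lam ρ - d.vertex i ρ = (lam * d.κ i ρ) • d.γ i ρ := by
  rw [ray_eq, add_sub_cancel_left]

theorem mem_Si {d : ONData m n N} {i : Fin N} {r lam : ℝ} {Y : MatPair m n} :
    Y ∈ d.Si i r lam ↔ ∃ ρ, ‖ρ‖ < r ∧ d.ray i lam ρ = Y := by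
  simp only [Si, mem_image, mem_ball_zero_iff, ray]

theorem ray_mem_Si (d : ONData m n N) (i : Fin N) {r : ℝ} (lam : ℝ) {ρ : MatPair m n}
    (hρ : ‖ρ‖ < r) : d.ray i lam ρ ∈ d.Si i r lam :=
  mem_Si.2 ⟨ρ, hρ, rfl⟩

theorem vertex_mem_Si (d : ONData m n N) (i : Fin N) {r : ℝ} {ρ : MatPair m n}
    (hρ : ‖ρ‖ < r) : d.vertex i ρ ∈ d.Si i r 0 :=
  mem_Si.2 ⟨ρ, hρ, d.ray_zero i ρ⟩

theorem Si_mono (d : ONData m n N) (i : Fin N) (lam : ℝ) {r s : ℝ} (h : r ≤ s) :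
    d.Si i r lam ⊆ d.Si i s lam :=
  image_mono (Metric.ball_subset_ball h)

theorem Li_mono (d : ONData m n N) (i : Fin N) (lam : ℝ) {r s : ℝ} (h : r ≤ s) :
    d.Li i r lam ⊆ d.Li i s lam := by
  rintro Y ⟨α, hα, β, hβ, hαβ, hY⟩
  exact ⟨α, d.Si_mono i lam h hα, β, d.Si_mono i 0 h hβ, hαβ, hY⟩

theorem mem_Sig {d : ONData m n N} {r lam : ℝ} {Y : MatPair m n} :
    Y ∈ d.Sig r lam ↔ ∃ lam', (d.δ₀ ≤ lam' ∧ lam' ≤ lam) ∧ ∃ i, Y ∈ d.Li i r lam' := by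
  simp only [Sig, L, mem_iUnion, exists_prop, mem_Icc]

theorem Sig_mono (d : ONData m n N) {r s lam mu : ℝ} (h : r ≤ s) (h' : lam ≤ mu) :
    d.Sig r lam ⊆ d.Sig s mu := by
  intro Y hY
  obtain ⟨lam', ⟨h1, h2⟩, i, hY⟩ := mem_Sig.1 hY
  exact mem_Sig.2 ⟨lam', ⟨h1, h2.trans h'⟩, i, d.Li_mono i lam' h hY⟩

theorem Sig_subset_SigOne (d : ONData m n N) {s mu : ℝ} (hs : s ≤ d.r₀) (hmu : d.δ₀ ≤ mu)
    (hmu1 : mu < 1) : d.Sig s mu ⊆ d.SigOne := by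
  intro Y hY
  exact mem_iUnion₂.2 ⟨mu, ⟨hmu, hmu1⟩, d.Sig_mono hs le_rfl hY⟩

namespace Witnesses

variable {d : ONData m n N}

theorem ray_sub_vertex_mem (h : d.Witnesses σ) (i : Fin N) (lam : ℝ) {ρ : MatPair m n}
    (hρ : ‖ρ‖ ≤ d.r₀) :
    d.ray i lam ρ - d.vertex i ρ ∈ waveCone m n := by
  rw [ray_sub_vertex]
  exact smul_mem_waveCone (h.γ_mem i ρ (mem_closedBall_zero_iff.2 hρ)) _

theorem segment_subset_Li (h : d.Witnesses σ) (i : Fin N) {r lam : ℝ} (hr : r ≤ d.r₀)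
    {ρ : MatPair m n}
    (hρ : ‖ρ‖ < r) : segment ℝ (d.ray i lam ρ) (d.vertex i ρ) ⊆ d.Li i r lam := fun _ hY =>
  ⟨_, d.ray_mem_Si i lam hρ, _, d.vertex_mem_Si i hρ,
    h.ray_sub_vertex_mem i lam (hρ.le.trans hr), hY⟩

/-- Translating a whole segment by a small vector keeps its ends in the open sets `S_i^r(lam)` and
`S_i^r(0)` and does not change `α - β`, so the wave cone condition persists. -/
theorem isOpen_Li (h : d.Witnesses σ) (i : Fin N) {r lam : ℝ} (hr0 : 0 < r) (hr : r ≤ d.r₀)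
    (h0 : d.δ₀ ≤ lam)
    (h1 : lam < 1) : IsOpen (d.Li i r lam) := by
  rw [Metric.isOpen_iff]
  rintro Y ⟨α, hα, β, hβ, hαβ, a, b, ha, hb, hab, rfl⟩
  obtain ⟨δ, hδ, hδα⟩ := Metric.isOpen_iff.1 (h.Si_isOpen r lam hr0 hr (Or.inr ⟨h0, h1⟩) i) α hα
  obtain ⟨δ', hδ', hδβ⟩ := Metric.isOpen_iff.1 (h.Si_isOpen r 0 hr0 hr (Or.inl rfl) i) β hβ
  refine ⟨min δ δ', lt_min hδ hδ', fun Z hZ => ?_⟩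
  rw [Metric.mem_ball, dist_eq_norm, lt_min_iff] at hZ
  set v := Z - (a • α + b • β) with hv
  refine ⟨α + v, hδα ?_, β + v, hδβ ?_, ?_, a, b, ha, hb, hab, ?_⟩
  · simpa [dist_eq_norm] using hZ.1
  · simpa [dist_eq_norm] using hZ.2
  · rwa [add_sub_add_right_eq_sub]
  · have : a • (α + v) + b • (β + v) = a • α + b • β + (a + b) • v := by module
    rw [this, hab, one_smul, hv, add_sub_cancel]

theorem isOpen_Sig (h : d.Witnesses σ) {r lam : ℝ} (hr0 : 0 < r) (hr : r ≤ d.r₀) (h1 : lam < 1) :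
    IsOpen (d.Sig r lam) :=
  isOpen_biUnion fun _ hlam' => isOpen_iUnion fun i =>
    h.isOpen_Li i hr0 hr hlam'.1 (hlam'.2.trans_lt h1)

theorem continuousOn_vertex (h : d.Witnesses σ) (i : Fin N) :
    ContinuousOn (d.vertex i) (Metric.closedBall 0 d.r₀) := by
  have : ContinuousOn (fun ρ => ∑ k ∈ Finset.univ.filter (fun k : Fin N => k < i), d.γ k ρ)
      (Metric.closedBall 0 d.r₀) := continuousOn_finsetSum _ fun k _ => h.γ_continuousOn k
  exact continuousOn_id.add this

theorem continuousOn_endpoint (h : d.Witnesses σ) (i : Fin N) :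
    ContinuousOn (d.endpoint i) (Metric.closedBall 0 d.r₀) :=
  (h.continuousOn_vertex i).add ((h.κ_continuousOn i).smul (h.γ_continuousOn i))

theorem continuousOn_ray (h : d.Witnesses σ) (i : Fin N) (lam : ℝ) :
    ContinuousOn (d.ray i lam) (Metric.closedBall 0 d.r₀) :=
  ((h.continuousOn_endpoint i).const_smul lam).add ((h.continuousOn_vertex i).const_smul (1 - lam))

/-- Endpoints and vertices are continuous on a compact ball, and every point of `Σ(1)` is a convex
combination of them. Boundedness is what gives `Metric.diam` its meaning, as it is `0` on unbounded
sets. -/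
theorem isBounded_SigOne (h : d.Witnesses σ) : Bornology.IsBounded d.SigOne := by
  have hb : ∀ i : Fin N, ∃ C, ∀ ρ ∈ Metric.closedBall (0 : MatPair m n) d.r₀,
      ‖d.endpoint i ρ‖ ≤ C ∧ ‖d.vertex i ρ‖ ≤ C := by
    intro i
    obtain ⟨C₁, h₁⟩ := (isCompact_closedBall (0 : MatPair m n) d.r₀).exists_bound_of_continuousOn
      (h.continuousOn_endpoint i)
    obtain ⟨C₂, h₂⟩ := (isCompact_closedBall (0 : MatPair m n) d.r₀).exists_bound_of_continuousOn
      (h.continuousOn_vertex i)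
    exact ⟨max C₁ C₂, fun ρ hρ => ⟨(h₁ ρ hρ).trans (le_max_left _ _),
      (h₂ ρ hρ).trans (le_max_right _ _)⟩⟩
  choose C hC using hb
  refine (isBounded_iff_forall_norm_le.2 ⟨∑ i, |C i|, fun Y hY => ?_⟩)
  obtain ⟨lam, hlam, hY⟩ := mem_iUnion₂.1 hY
  obtain ⟨lam', ⟨h1, h2⟩, i, α, hα, β, hβ, -, a, b, ha, hb, hab, rfl⟩ := mem_Sig.1 hY
  obtain ⟨ρ, hρ, rfl⟩ := mem_Si.1 hα
  obtain ⟨ρ', hρ', rfl⟩ := mem_Si.1 hβ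
  have hδ := h.δ₀_mem.1
  have hδ2 := h.δ₁_lt_δ₂
  have hδ1 := h.δ₁_pos
  have hl0 : 0 ≤ lam' := by linarith
  have hl1 : 0 ≤ 1 - lam' := by linarith [hlam.2]
  have hCi : C i ≤ ∑ i, |C i| :=
    (le_abs_self _).trans (Finset.single_le_sum (f := fun i => |C i|)
      (fun _ _ => abs_nonneg _) (Finset.mem_univ i))
  have hα' : ‖d.ray i lam' ρ‖ ≤ C i := by
    obtain ⟨e1, e2⟩ := hC i ρ (mem_closedBall_zero_iff.2 hρ.le)
    calc ‖d.ray i lam' ρ‖ ≤ lam' * ‖d.endpoint i ρ‖ + (1 - lam') * ‖d.vertex i ρ‖ := by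
          refine (norm_add_le _ _).trans ?_
          rw [norm_smul, norm_smul, Real.norm_of_nonneg hl0, Real.norm_of_nonneg hl1]
      _ ≤ lam' * C i + (1 - lam') * C i := by gcongr
      _ = C i := by ring
  have hβ' : ‖d.ray i 0 ρ'‖ ≤ C i := by
    rw [ray_zero]
    exact (hC i ρ' (mem_closedBall_zero_iff.2 hρ'.le)).2
  calc ‖a • d.ray i lam' ρ + b • d.ray i 0 ρ'‖ ≤ a * ‖d.ray i lam' ρ‖ + b * ‖d.ray i 0 ρ'‖ := by
        refine (norm_add_le _ _).trans ?_
        rw [norm_smul, norm_smul, Real.norm_of_nonneg ha, Real.norm_of_nonneg hb]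
    _ ≤ a * C i + b * C i := by gcongr
    _ = C i := by rw [← add_mul, hab, one_mul]
    _ ≤ _ := hCi

/-- Consecutive vertices, in the cyclic order. -/
theorem vertex_succ (h : d.Witnesses σ) {i i' : Fin N} (hi : (i : ℕ) + 1 ≡ i' [MOD N])
    {ρ : MatPair m n}
    (hρ : ‖ρ‖ ≤ d.r₀) : d.vertex i' ρ = d.vertex i ρ + d.γ i ρ := by
  have hins : ∀ i : Fin N, Finset.univ.filter (fun k : Fin N => k ≤ i) =
      insert i (Finset.univ.filter (fun k : Fin N => k < i)) := by
    intro i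
    ext k
    simp only [Finset.mem_filter, Finset.mem_univ, true_and, Finset.mem_insert]
    exact le_iff_eq_or_lt
  have hsum : d.vertex i ρ + d.γ i ρ =
      ρ + ∑ k ∈ Finset.univ.filter (fun k : Fin N => k ≤ i), d.γ k ρ := by
    rw [hins, Finset.sum_insert (by simp), vertex]
    abel
  rw [hsum]
  rcases Nat.lt_or_ge (i + 1) N with hlt | hge
  · have : (i' : ℕ) = i + 1 := by
      have := hi.symm
      rwa [Nat.ModEq, Nat.mod_eq_of_lt i'.2, Nat.mod_eq_of_lt hlt] at this
    rw [vertex]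
    congr 2
    ext k
    simp only [Finset.mem_filter, Finset.mem_univ, true_and, Fin.lt_def, Fin.le_def]
    omega
  -- Wrapping around from the last index to `0`, where the total sum of the `γ_k` vanishes.
  · have hN : (i : ℕ) + 1 = N := le_antisymm i.2 hge
    have h0 : (i' : ℕ) = 0 := by
      have := hi.symm
      rwa [Nat.ModEq, Nat.mod_eq_of_lt i'.2, hN, Nat.mod_self] at this
    have e1 : Finset.univ.filter (fun k : Fin N => k ≤ i) = Finset.univ := by
      ext k
      simp only [Finset.mem_filter, Finset.mem_univ, true_and, Fin.le_def, iff_true]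
      omega
    have e2 : Finset.univ.filter (fun k : Fin N => k < i') = ∅ := by
      ext k
      simp [Fin.lt_def, h0]
    rw [vertex, e1, e2, h.γ_sum ρ (mem_closedBall_zero_iff.2 hρ), Finset.sum_empty]

/-- The weight of the outgoing endpoint in the decomposition of the next vertex. -/
theorem exists_weight (h : d.Witnesses σ) (i : Fin N) {mu : ℝ} (hmu : d.δ₂ < mu) (hmu1 : mu ≤ 1)
    {ρ : MatPair m n}
    (hρ : ‖ρ‖ ≤ d.r₀) : ∃ t : ℝ, d.δ₁ ≤ t ∧ t ≤ 1 ∧ mu - d.δ₂ ≤ 1 - t ∧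
      d.vertex i ρ + d.γ i ρ = t • d.ray i mu ρ + (1 - t) • d.vertex i ρ := by
  have h1 := h.δ₁_pos
  have h2 : 0 < d.δ₂ := h1.trans h.δ₁_lt_δ₂
  have hmu0 : 0 < mu := h2.trans hmu
  obtain ⟨hk1, hk2⟩ := h.κ_mem i ρ (mem_closedBall_zero_iff.2 hρ)
  have hκ : 0 < d.κ i ρ := lt_of_lt_of_le (by positivity) hk1
  have hk1' : 1 ≤ d.κ i ρ * d.δ₂ := by rwa [div_le_iff₀ h2] at hk1
  have hk2' : d.κ i ρ * d.δ₁ ≤ 1 := by rwa [le_div_iff₀ h1] at hk2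
  -- The weight is `1 / (mu κ)`, since the ray point is `π_i + mu κ γ_i`. From `κ δ₂ ≥ 1` it is at
  -- most `δ₂ / mu`, and `1 - δ₂ / mu = (mu - δ₂) / mu ≥ mu - δ₂`.
  have ht : (mu * d.κ i ρ)⁻¹ ≤ 1 - (mu - d.δ₂) := by
    rw [inv_le_iff_one_le_mul₀ (by positivity)]
    have e1 : mu * (d.κ i ρ * d.δ₂) ≥ mu := by nlinarith
    have e2 : mu * d.κ i ρ * (1 - mu) * 1 ≥ (1 - mu) := by
      have : 1 ≤ mu * d.κ i ρ := by nlinarith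
      nlinarith
    nlinarith
  refine ⟨(mu * d.κ i ρ)⁻¹, ?_, by linarith, by linarith, ?_⟩
  · rw [le_inv_comm₀ h1 (by positivity)]
    rw [← one_div, le_div_iff₀ h1]
    nlinarith
  · rw [ray_eq, smul_add, smul_smul, inv_mul_cancel₀ (by positivity), one_smul]
    module

/-- Going around the cycle: a vertex is the barycentre of laminates that give weight close to `1`
to the endpoints, and a definite weight to each of them. -/
theorem exists_realizes_vertex_steps (h : d.Witnesses σ) {K : Set (MatPair m n)} {mu : ℝ}
    (hmu : d.δ₂ < mu)
    (hmu1 : mu ≤ 1) {ρ : MatPair m n} (hρ : ‖ρ‖ ≤ d.r₀)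
    (hK : ∀ i, segment ℝ (d.ray i mu ρ) (d.vertex i ρ) ⊆ K) (M : ℕ) (i : Fin N) :
    ∃ c, Realizes K (d.vertex i ρ) c ∧
      (∀ A, (∀ k, d.ray k mu ρ ∈ A) → 1 - (1 - d.δ₁) ^ M ≤ c A) ∧
      ∀ (k : Fin N) (A : Set (MatPair m n)), d.ray k mu ρ ∈ A → ∀ l < M,
        (k : ℕ) + 1 + l ≡ i [MOD N] → (mu - d.δ₂) ^ l * d.δ₁ ≤ c A := by
  have hδ1 := h.δ₁_pos
  -- `M` counts splittings, each going back to the preceding vertex `i'`. The mass still at a vertex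
  -- after `M` of them is at most `(1 - δ₁)^M`, and is discarded; `l` is the number of steps before
  -- the ray over `k` is reached.
  induction M generalizing i with
  | zero =>
    refine ⟨fun _ => 0, (Realizes.of_mem (hK i (right_mem_segment ℝ _ _))).mono
      (fun _ => le_rfl) (fun A => indicator_nonneg (fun _ _ => zero_le_one) _), ?_, ?_⟩
    · simp
    · intro k A _ l hl
      omega
  | succ M ih =>
    have hN : 0 < N := i.pos
    obtain ⟨i', hi'⟩ : ∃ i' : Fin N, (i' : ℕ) + 1 ≡ i [MOD N] := by
      refine ⟨⟨(i + (N - 1)) % N, Nat.mod_lt _ hN⟩, ?_⟩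
      have : (i : ℕ) + (N - 1) + 1 ≡ i [MOD N] := by
        rw [show (i : ℕ) + (N - 1) + 1 = i + N by omega]
        exact Nat.add_modEq_right
      exact ((Nat.mod_modEq _ _).add_right 1).trans this
    obtain ⟨c, hc, hcall, hck⟩ := ih i'
    obtain ⟨t, ht0, ht1, htmu, hcombo⟩ := h.exists_weight i' hmu hmu1 hρ
    have hsplit := Realizes.split (Realizes.of_mem (hK i' (left_mem_segment ℝ _ _))) hc
      (h.ray_sub_vertex_mem i' mu hρ) (hK i') (hδ1.le.trans ht0) ht1
    rw [← hcombo, ← h.vertex_succ hi' hρ] at hsplit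
    have h1t : 0 ≤ 1 - t := by linarith
    refine ⟨_, hsplit, fun A hA => ?_, fun k A hA l hl hmod => ?_⟩
    · have := hcall A hA
      rw [indicator_of_mem (hA i')]
      have h2 : (1 - t) * (1 - (1 - d.δ₁) ^ M) ≤ (1 - t) * c A := by gcongr
      have h3 : (1 - t) * (1 - d.δ₁) ^ M ≤ (1 - d.δ₁) * (1 - d.δ₁) ^ M := by
        apply mul_le_mul_of_nonneg_right (by linarith)
        apply pow_nonneg
        linarith [h.δ₁_lt_δ₂, h.δ₂_lt_one]
      rw [pow_succ]
      nlinarith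
    · have hmu0 : 0 ≤ mu - d.δ₂ := by linarith
      rcases Nat.eq_zero_or_pos l with rfl | hl0
      · have hki : k = i' := by
          have : (k : ℕ) + 1 ≡ i' + 1 [MOD N] := by
            rw [add_zero] at hmod
            exact hmod.trans hi'.symm
          have := Nat.ModEq.add_right_cancel' 1 this
          rw [Nat.ModEq, Nat.mod_eq_of_lt k.2, Nat.mod_eq_of_lt i'.2] at this
          exact Fin.ext this
        rw [← hki, indicator_of_mem hA]
        have := mul_nonneg h1t (hc.1 A).1
        linarith
      · obtain ⟨l, rfl⟩ : ∃ l', l = l' + 1 := ⟨l - 1, by omega⟩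
        have hmod' : (k : ℕ) + 1 + l ≡ i' [MOD N] :=
          Nat.ModEq.add_right_cancel' 1 (hmod.trans hi'.symm)
        have h2 := hck k A hA l (by omega) hmod'
        have h3 : (mu - d.δ₂) * ((mu - d.δ₂) ^ l * d.δ₁) ≤ (1 - t) * c A := by
          apply mul_le_mul htmu h2 (by positivity) h1t
        have h4 : 0 ≤ t * A.indicator (fun _ => (1 : ℝ)) (d.ray i' mu ρ) :=
          mul_nonneg (hδ1.le.trans ht0) (indicator_nonneg (fun _ _ => zero_le_one) _)
        rw [pow_succ]
        linarith

/-- Enough turns of the cycle make the discarded mass less than `η`, and at least one full turn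
reaches every index `k` after at most `N - 1` steps. -/
theorem exists_realizes_vertex (h : d.Witnesses σ) {K : Set (MatPair m n)} {mu η : ℝ}
    (hmu : d.δ₂ < mu)
    (hmu1 : mu ≤ 1) (hη : 0 < η) {ρ : MatPair m n} (hρ : ‖ρ‖ ≤ d.r₀)
    (hK : ∀ i, segment ℝ (d.ray i mu ρ) (d.vertex i ρ) ⊆ K) (i : Fin N) :
    ∃ c, Realizes K (d.vertex i ρ) c ∧
      (∀ A, (∀ k, d.ray k mu ρ ∈ A) → 1 - η ≤ c A) ∧
      ∀ (k : Fin N) (A : Set (MatPair m n)), d.ray k mu ρ ∈ A →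
        (mu - d.δ₂) ^ (N - 1) * d.δ₁ ≤ c A := by
  have hN : 0 < N := i.pos
  have hδ1 := h.δ₁_pos
  have hδ2 : d.δ₁ < 1 := h.δ₁_lt_δ₂.trans h.δ₂_lt_one
  obtain ⟨M₀, hM₀⟩ := exists_pow_lt_of_lt_one hη (by linarith : 1 - d.δ₁ < 1)
  obtain ⟨c, hc, hall, hk⟩ := h.exists_realizes_vertex_steps hmu hmu1 hρ hK (max M₀ N) i
  refine ⟨c, hc, fun A hA => ?_, fun k A hA => ?_⟩
  · have : (1 - d.δ₁) ^ max M₀ N ≤ (1 - d.δ₁) ^ M₀ :=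
      pow_le_pow_of_le_one (by linarith) (by linarith) (le_max_left _ _)
    linarith [hall A hA]
  -- The number `l < N` of steps back from `i` that satisfies `k + 1 + l ≡ i` modulo `N`.
  · have hlt : ((i : ℕ) + (N - 1 - k)) % N < N := Nat.mod_lt _ hN
    refine le_trans ?_ (hk k A hA (((i : ℕ) + (N - 1 - k)) % N)
      (hlt.trans_le (le_max_right _ _)) ?_)
    · apply mul_le_mul_of_nonneg_right _ hδ1.le
      apply pow_le_pow_of_le_one (by linarith) (by linarith [h.δ₁_lt_δ₂])
      omega
    · have h1 := (Nat.mod_modEq ((i : ℕ) + (N - 1 - k)) N).add_left ((k : ℕ) + 1)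
      refine h1.trans ?_
      rw [show (k : ℕ) + 1 + (i + (N - 1 - k)) = i + N by omega]
      exact Nat.add_modEq_right

end Witnesses

end ONData

theorem isCompact_segment_real {E : Type*} [NormedAddCommGroup E] [NormedSpace ℝ E] (x y : E) :
    IsCompact (segment ℝ x y) := by
  rw [segment_eq_image_lineMap]
  exact isCompact_Icc.image AffineMap.lineMap_continuous

/-! ### Laminates for the points of `Σ` and of `S`. -/

namespace ONData

variable {m n N : ℕ} {σ : Mat m n → Mat m n}

/-- The points `mu ξ_i(ρ) + (1 - mu) π_i(ρ)` with `|ρ| ≤ r`. -/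
def closedSi (d : ONData m n N) (i : Fin N) (r mu : ℝ) : Set (MatPair m n) :=
  d.ray i mu '' Metric.closedBall 0 r

/-- The union of the segments between `mu ξ_i(ρ) + (1 - mu) π_i(ρ)` and `π_i(ρ)`, `|ρ| ≤ r`. -/
def raySet (d : ONData m n N) (r mu : ℝ) : Set (MatPair m n) :=
  ⋃ i, (fun z : MatPair m n × ℝ => z.2 • d.ray i mu z.1 + (1 - z.2) • d.vertex i z.1) ''
    (Metric.closedBall 0 r ×ˢ Icc 0 1)

theorem segment_subset_raySet (d : ONData m n N) (i : Fin N) {r mu : ℝ} {ρ : MatPair m n}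
    (hρ : ‖ρ‖ ≤ r) : segment ℝ (d.ray i mu ρ) (d.vertex i ρ) ⊆ d.raySet r mu := by
  rintro Y ⟨a, b, ha, hb, hab, rfl⟩
  refine mem_iUnion.2 ⟨i, (ρ, a), ⟨mem_closedBall_zero_iff.2 hρ, ha, by linarith⟩, ?_⟩
  simp only
  rw [← hab, add_sub_cancel_left]

namespace Witnesses

variable {d : ONData m n N}

theorem isCompact_closedSi (h : d.Witnesses σ) (i : Fin N) {r : ℝ} (mu : ℝ) (hr : r ≤ d.r₀) :
    IsCompact (d.closedSi i r mu) :=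
  (isCompact_closedBall _ _).image_of_continuousOn
    ((h.continuousOn_ray i mu).mono (Metric.closedBall_subset_closedBall hr))

theorem isCompact_raySet (h : d.Witnesses σ) {r : ℝ} (mu : ℝ) (hr : r ≤ d.r₀) :
    IsCompact (d.raySet r mu) := by
  refine isCompact_iUnion fun i =>
    ((isCompact_closedBall _ _).prod isCompact_Icc).image_of_continuousOn ?_
  have hm : MapsTo (Prod.fst : MatPair m n × ℝ → MatPair m n)
      (Metric.closedBall 0 r ×ˢ Icc (0 : ℝ) 1) (Metric.closedBall 0 d.r₀) := fun z hz =>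
    Metric.closedBall_subset_closedBall hr hz.1
  have h1 := (h.continuousOn_ray i mu).comp continuousOn_fst hm
  have h2 := (h.continuousOn_vertex i).comp continuousOn_fst hm
  exact (continuousOn_snd.smul h1).add ((continuousOn_const.sub continuousOn_snd).smul h2)

/-- The strict inequality `r < s` puts the closed ball of parameters inside the larger open ball. So
the compact support of the laminates sits in an open set and tolerates small errors. -/
theorem raySet_subset_Sig (h : d.Witnesses σ) {r s mu : ℝ} (hrs : r < s) (hs : s ≤ d.r₀)
    (hmu : d.δ₀ ≤ mu) : d.raySet r mu ⊆ d.Sig s mu := by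
  rintro Y hY
  obtain ⟨i, ⟨ρ, t⟩, ⟨hρ, ht0, ht1⟩, rfl⟩ := mem_iUnion.1 hY
  exact mem_Sig.2 ⟨mu, ⟨hmu, le_rfl⟩, i, h.segment_subset_Li i hs
    ((mem_closedBall_zero_iff.1 hρ).trans_lt hrs)
    ⟨t, 1 - t, ht0, by linarith, by ring, rfl⟩⟩

/-- A ray has the direction of `γ_i`, which lies in the wave cone, so splitting along it is allowed.
-/
theorem realizes_ray (h : d.Witnesses σ) {K : Set (MatPair m n)} {c : Set (MatPair m n) → ℝ}
    {lam mu : ℝ} (hlam : 0 ≤ lam) (hle : lam ≤ mu) (hmu : 0 < mu) {i : Fin N} {ρ : MatPair m n}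
    (hρ : ‖ρ‖ ≤ d.r₀) (hK : segment ℝ (d.ray i mu ρ) (d.vertex i ρ) ⊆ K)
    (hc : Realizes K (d.vertex i ρ) c) : Realizes K (d.ray i lam ρ) fun A =>
      lam / mu * A.indicator (fun _ => 1) (d.ray i mu ρ) + (1 - lam / mu) * c A := by
  rw [d.ray_eq_combo i hmu.ne' ρ]
  exact Realizes.split (Realizes.of_mem (hK (left_mem_segment ℝ _ _))) hc
    (h.ray_sub_vertex_mem i mu hρ) hK (div_nonneg hlam hmu.le) ((div_le_one hmu).2 hle)

/-- Every point of `Σ^r(lam)` is the barycentre of laminates supported in `Σ^s(mu)` which give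
weight close to `1` to `S^s(mu)` and a definite weight to each `S_k^s(mu)`. -/
theorem exists_realizes_of_mem_Sig (h : d.Witnesses σ) {r s lam mu η : ℝ} (hrs : r < s)
    (hs : s ≤ d.r₀) (hlm : lam < mu) (hmu1 : mu < 1) (hη : 0 < η) {Y : MatPair m n}
    (hY : Y ∈ d.Sig r lam) :
    ∃ K c, IsCompact K ∧ K ⊆ d.Sig s mu ∧ Realizes K Y c ∧
      1 - η ≤ c (⋃ k, d.closedSi k r mu) ∧
      ∀ k, (mu - lam) * (mu - d.δ₂) ^ (N - 1) * d.δ₁ ≤ c (d.closedSi k r mu) := by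
  obtain ⟨lam', ⟨h1, h2⟩, i, hL⟩ := mem_Sig.1 hY
  have hL' := hL
  obtain ⟨α, hα, β, hβ, hαβ, a, b, ha, hb, hab, rfl⟩ := hL
  obtain ⟨ρ, hρ, rfl⟩ := mem_Si.1 hα
  obtain ⟨ρ', hρ', rfl⟩ := mem_Si.1 hβ
  rw [ray_zero] at hβ hαβ hL' hY ⊢
  have hδ1 := h.δ₁_pos
  have hδ2 := h.δ₁_lt_δ₂
  have hδ0 := h.δ₀_mem.1
  have hl0 : 0 < lam' := by linarith
  have hmu0 : 0 < mu := by linarith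
  -- The rays carry all later splittings; the extra segment carries the initial one, whose ends may
  -- belong to different parameters `ρ` and `ρ'`.
  set K := d.raySet r mu ∪ segment ℝ (d.ray i lam' ρ) (d.vertex i ρ') with hK
  have hKseg : ∀ ρ : MatPair m n, ‖ρ‖ < r → ∀ i, segment ℝ (d.ray i mu ρ) (d.vertex i ρ) ⊆ K :=
    fun ρ hρ i => (d.segment_subset_raySet i hρ.le).trans subset_union_left
  have hKc : IsCompact K := by
    refine (h.isCompact_raySet mu (hrs.le.trans hs)).union ?_
    exact isCompact_segment_real _ _
  have hKS : K ⊆ d.Sig s mu := by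
    refine union_subset (h.raySet_subset_Sig hrs hs (by linarith)) fun Z hZ => ?_
    refine mem_Sig.2 ⟨lam', ⟨h1, h2.trans hlm.le⟩, i, d.Li_mono i lam' hrs.le ?_⟩
    exact ⟨_, hα, _, hβ, hαβ, hZ⟩
  have hr0 : r ≤ d.r₀ := hrs.le.trans hs
  obtain ⟨c₁, hc₁, hall₁, hk₁⟩ := h.exists_realizes_vertex (by linarith) hmu1.le hη
    (hρ.le.trans hr0) (hKseg ρ hρ) i
  obtain ⟨c₂, hc₂, hall₂, hk₂⟩ := h.exists_realizes_vertex (by linarith) hmu1.le hη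
    (hρ'.le.trans hr0) (hKseg ρ' hρ') i
  have hray := h.realizes_ray hl0.le (h2.trans hlm.le) hmu0 (hρ.le.trans hr0) (hKseg ρ hρ i) hc₁
  have hfin := hray.split hc₂ hαβ subset_union_right ha (by linarith)
  rw [show 1 - a = b by linarith] at hfin
  have hmem : ∀ ρ : MatPair m n, ‖ρ‖ < r → ∀ k, d.ray k mu ρ ∈ d.closedSi k r mu := fun ρ hρ k =>
    ⟨ρ, mem_closedBall_zero_iff.2 hρ.le, rfl⟩
  have hmem' : ∀ ρ : MatPair m n, ‖ρ‖ < r → ∀ k, d.ray k mu ρ ∈ ⋃ k, d.closedSi k r mu :=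
    fun ρ hρ k => mem_iUnion.2 ⟨k, hmem ρ hρ k⟩
  have ht1 : lam' / mu ≤ 1 := (div_le_one hmu0).2 (h2.trans hlm.le)
  have ht0 : 0 ≤ lam' / mu := by positivity
  refine ⟨K, _, hKc, hKS, hfin, ?_, fun k => ?_⟩
  · have e1 := hall₁ _ (hmem' ρ hρ)
    have e2 := hall₂ _ (hmem' ρ' hρ')
    rw [indicator_of_mem (hmem' ρ hρ i)]
    have e3 : (1 - lam' / mu) * (1 - η) ≤ (1 - lam' / mu) * c₁ (⋃ k, d.closedSi k r mu) :=
      mul_le_mul_of_nonneg_left e1 (by linarith)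
    have e4 : 0 ≤ lam' / mu * η := by positivity
    have e5 : a * (1 - η) ≤ a * (lam' / mu * 1 +
        (1 - lam' / mu) * c₁ (⋃ k, d.closedSi k r mu)) :=
      mul_le_mul_of_nonneg_left (by linarith) ha
    have e6 := mul_le_mul_of_nonneg_left e2 hb
    have e7 : a * (1 - η) + b * (1 - η) = 1 - η := by rw [← add_mul, hab, one_mul]
    linarith
  · have e1 := hk₁ k _ (hmem ρ hρ k)
    have e2 := hk₂ k _ (hmem ρ' hρ' k)
    have hq : 0 ≤ (mu - d.δ₂) ^ (N - 1) * d.δ₁ :=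
      mul_nonneg (pow_nonneg (by linarith) _) hδ1.le
    set q := (mu - d.δ₂) ^ (N - 1) * d.δ₁ with hqdef
    rw [mul_assoc, ← hqdef]
    -- The mass sent to the vertex is `(mu - lam') / mu`, and `mu < 1`, `lam' ≤ lam`.
    have e0 : mu - lam ≤ 1 - lam' / mu := by
      rw [le_sub_comm, div_le_iff₀ hmu0]
      nlinarith
    have e3 : (mu - lam) * q ≤ (1 - lam' / mu) * c₁ (d.closedSi k r mu) :=
      mul_le_mul e0 e1 hq (by linarith)
    have e4 : 0 ≤ lam' / mu * (d.closedSi k r mu).indicator (fun _ => (1 : ℝ)) (d.ray i mu ρ) :=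
      mul_nonneg ht0 (indicator_nonneg (fun _ _ => zero_le_one) _)
    have e5 : (mu - lam) * q ≤ c₂ (d.closedSi k r mu) := by
      refine le_trans ?_ e2
      exact mul_le_of_le_one_left hq (by linarith)
    have e6 : a * ((mu - lam) * q) ≤ a * (lam' / mu * (d.closedSi k r mu).indicator
        (fun _ => (1 : ℝ)) (d.ray i mu ρ) + (1 - lam' / mu) * c₁ (d.closedSi k r mu)) :=
      mul_le_mul_of_nonneg_left (by linarith) ha
    have e7 := mul_le_mul_of_nonneg_left e5 hb
    have e8 : a * ((mu - lam) * q) + b * ((mu - lam) * q) = (mu - lam) * q := by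
      rw [← add_mul, hab, one_mul]
    linarith

/-- Points of `S_i^r(lam)` are barycentres of laminates which moreover give weight `lam / mu` to a
point of `S_i^s(mu)` on the same ray. -/
theorem exists_realizes_of_mem_Si (h : d.Witnesses σ) {r s lam mu η : ℝ} (hrs : r < s)
    (hs : s ≤ d.r₀) (h0 : d.δ₀ ≤ lam) (hlm : lam < mu) (hmu1 : mu < 1) (hη : 0 < η) {i : Fin N}
    {ρ : MatPair m n} (hρ : ‖ρ‖ < r) :
    ∃ K c, IsCompact K ∧ K ⊆ d.Sig s mu ∧ Realizes K (d.ray i lam ρ) c ∧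
      1 - η ≤ c (⋃ k, d.closedSi k r mu) ∧
      (∀ k, (mu - lam) * (mu - d.δ₂) ^ (N - 1) * d.δ₁ ≤ c (d.closedSi k r mu)) ∧
      lam / mu + (mu - lam) * (mu - d.δ₂) ^ (N - 1) * d.δ₁ ≤ c (d.closedSi i r mu) ∧
      lam / mu ≤ c {d.ray i mu ρ} := by
  have hδ1 := h.δ₁_pos
  have hδ2 := h.δ₁_lt_δ₂
  have hδ0 := h.δ₀_mem.1
  have hl0 : 0 < lam := by linarith
  have hmu0 : 0 < mu := by linarith
  have hr0 : r ≤ d.r₀ := hrs.le.trans hs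
  have hseg : ∀ i, segment ℝ (d.ray i mu ρ) (d.vertex i ρ) ⊆ d.raySet r mu := fun i =>
    d.segment_subset_raySet i hρ.le
  obtain ⟨c, hc, hall, hk⟩ := h.exists_realizes_vertex (by linarith) hmu1.le hη
    (hρ.le.trans hr0) hseg i
  have hfin := h.realizes_ray hl0.le hlm.le hmu0 (hρ.le.trans hr0) (hseg i) hc
  have hmem : ∀ k, d.ray k mu ρ ∈ d.closedSi k r mu := fun k =>
    ⟨ρ, mem_closedBall_zero_iff.2 hρ.le, rfl⟩
  have hmem' : ∀ k, d.ray k mu ρ ∈ ⋃ k, d.closedSi k r mu := fun k => mem_iUnion.2 ⟨k, hmem k⟩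
  have ht1 : lam / mu ≤ 1 := (div_le_one hmu0).2 hlm.le
  have ht0 : 0 ≤ lam / mu := by positivity
  have hq : 0 ≤ (mu - d.δ₂) ^ (N - 1) * d.δ₁ :=
    mul_nonneg (pow_nonneg (by linarith) _) hδ1.le
  set q := (mu - d.δ₂) ^ (N - 1) * d.δ₁ with hqdef
  have e0 : mu - lam ≤ 1 - lam / mu := by
    rw [le_sub_comm, div_le_iff₀ hmu0]
    nlinarith
  have e3 : ∀ k, (mu - lam) * q ≤ (1 - lam / mu) * c (d.closedSi k r mu) := fun k =>
    mul_le_mul e0 (hk k _ (hmem k)) hq (by linarith)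
  have e3' : ∀ k, (mu - lam) * (mu - d.δ₂) ^ (N - 1) * d.δ₁ ≤
      (1 - lam / mu) * c (d.closedSi k r mu) := fun k => by rw [mul_assoc]; exact e3 k
  refine ⟨d.raySet r mu, _, h.isCompact_raySet mu hr0,
    h.raySet_subset_Sig hrs hs (by linarith), hfin, ?_, fun k => ?_, ?_, ?_⟩
  · have e1 := hall _ hmem'
    rw [indicator_of_mem (hmem' i)]
    have e3 : (1 - lam / mu) * (1 - η) ≤ (1 - lam / mu) * c (⋃ k, d.closedSi k r mu) :=
      mul_le_mul_of_nonneg_left e1 (by linarith)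
    have e4 : 0 ≤ lam / mu * η := by positivity
    linarith
  · have e4 : 0 ≤ lam / mu * (d.closedSi k r mu).indicator (fun _ => (1 : ℝ)) (d.ray i mu ρ) :=
      mul_nonneg ht0 (indicator_nonneg (fun _ _ => zero_le_one) _)
    linarith [e3' k]
  · rw [indicator_of_mem (hmem i)]
    linarith [e3' i]
  · rw [indicator_of_mem (mem_singleton _)]
    have := mul_nonneg (by linarith : 0 ≤ 1 - lam / mu) (hc.1 {d.ray i mu ρ}).1
    linarith

end Witnesses

end ONData

/-! ### From laminates to perturbations in small cubes. -/

section LocalPerturbation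

variable {m n : ℕ}

/-- Near a point of continuity of the field `Y`, a realization of `Y x` perturbs `Y` in all small
cubes centred at `x`. -/
theorem Realizes.eventually_exists_ball {ι : Type*} [Finite ι] {K U : Set (MatPair m n)}
    {Y : SpaceTime n → MatPair m n} {x : SpaceTime n} {c : Set (MatPair m n) → ℝ}
    (hR : Realizes K (Y x) c) (hK : IsCompact K) (hU : IsOpen U) (hKU : K ⊆ U)
    {T O : ι → Set (MatPair m n)} (hT : ∀ i, IsCompact (T i)) (hO : ∀ i, IsOpen (O i))
    (hTO : ∀ i, T i ⊆ O i) (hY : ContinuousAt Y x) {ε : ℝ} (hε : 0 < ε) :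
    ∀ᶠ R in 𝓝[>] (0 : ℝ), (∀ y ∈ Metric.ball x R, ‖Y y - Y x‖ < ε) ∧
      ∃ w : SpaceTime n → Mat m n, IsTestFun (Metric.ball x R) w ∧
      (∀ y, ‖divField w y‖ < ε ∧ ‖fderiv ℝ (divField w) y (0, 1)‖ < ε) ∧
      (∀ y ∈ Metric.ball x R, Y y + pairField w y ∈ U) ∧
      (∀ i, (c (T i) - ε) * volume.real (Metric.ball x R) ≤
        volume.real (Metric.ball x R ∩ {y | Y y + pairField w y ∈ O i})) ∧
      ∀ p, (c {p} - ε) * volume.real (Metric.ball x R) ≤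
        volume.real (Metric.ball x R ∩ {y | ‖Y y + pairField w y - p‖ < ε}) := by
  -- The factor `2` leaves room for one `η` from the realization and one from the oscillation of `Y`
  -- about `Y x`.
  have hthick : ∀ {A B : Set (MatPair m n)}, IsCompact A → IsOpen B → A ⊆ B →
      ∀ᶠ η in 𝓝[>] (0 : ℝ), Metric.thickening (2 * η) A ⊆ B := by
    intro A B hA hB hAB
    obtain ⟨δ, hδ, hδB⟩ := hA.exists_thickening_subset_open hB hAB
    filter_upwards [Ioo_mem_nhdsGT (half_pos hδ)] with η hη
    exact (Metric.thickening_mono (by linarith [hη.2]) A).trans hδB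
  obtain ⟨η, hηU, hηO, hη0, hηε⟩ := ((hthick hK hU hKU).and
    ((Filter.eventually_all.2 fun i => hthick (hT i) (hO i) (hTO i)).and
      (Ioo_mem_nhdsGT (half_pos hε)))).exists
  obtain ⟨δ, hδ, hδY⟩ := Metric.eventually_nhds_iff_ball.1
    (hY.eventually (Metric.ball_mem_nhds (Y x) hη0))
  filter_upwards [Ioo_mem_nhdsGT hδ] with R hR'
  have hclose : ∀ y ∈ Metric.ball x R, ‖Y y - Y x‖ < η := fun y hy => by
    rw [← dist_eq_norm]
    exact hδY y (Metric.ball_subset_ball hR'.2.le hy)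
  obtain ⟨w, hw, hd, hp, hm⟩ :=
    hR.2 (Metric.ball x R) Metric.isOpen_ball Metric.isBounded_ball η hη0
  have hmove : ∀ y ∈ Metric.ball x R, ∀ A, Y x + pairField w y ∈ Metric.thickening η A →
      Y y + pairField w y ∈ Metric.thickening (2 * η) A := by
    intro y hy A hA
    rw [two_mul]
    apply mem_thickening_of_norm_sub_lt hA
    rw [add_sub_add_right_eq_sub]
    exact hclose y hy
  have hmeas : ∀ A B : Set (MatPair m n), Metric.thickening (2 * η) A ⊆ B →
      (c A - ε) * volume.real (Metric.ball x R) ≤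
        volume.real (Metric.ball x R ∩ {y | Y y + pairField w y ∈ B}) := by
    intro A B hAB
    refine le_trans (mul_le_mul_of_nonneg_right (by linarith) measureReal_nonneg)
      ((hm A).trans (measureReal_mono ?_ ?_))
    · exact fun y hy => ⟨hy.1, hAB (hmove y hy.1 A hy.2)⟩
    · exact ((measure_mono inter_subset_left).trans_lt measure_ball_lt_top).ne
  refine ⟨fun y hy => (hclose y hy).trans (by linarith), w, hw,
    fun y => ⟨(hd y).1.trans (by linarith), (hd y).2.trans (by linarith)⟩,
    fun y hy => hηU (hmove y hy K (hp y)), fun i => hmeas _ _ (hηO i), fun p => ?_⟩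
  refine hmeas {p} {z | ‖z - p‖ < ε} fun z hz => ?_
  rw [Metric.thickening_singleton, mem_ball_iff_norm] at hz
  exact hz.trans (by linarith)

end LocalPerturbation

/-! ### One stage in a small cube. -/

namespace ONData

variable {m n N : ℕ} {σ : Mat m n → Mat m n}

/-- The lower bound for the proportion of each `S_k` after one stage. -/
noncomputable def stageWeight (d : ONData m n N) (lam mu : ℝ) : ℝ :=
  (mu - lam) * (mu - d.δ₂) ^ (N - 1) * d.δ₁

/-- The field `w`, supported in the cube `Q`, perturbs the field `Y` as one stage of convex
integration requires, up to the error `ε`. -/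
structure IsStage (d : ONData m n N) (Y : SpaceTime n → MatPair m n) (r lam s mu ε C : ℝ)
    (Q : Set (SpaceTime n)) (w : SpaceTime n → Mat m n) : Prop where
  isTestFun : IsTestFun Q w
  norm_div_lt : ∀ y, ‖divField w y‖ < ε ∧ ‖fderiv ℝ (divField w) y (0, 1)‖ < ε
  mem_Sig : ∀ y ∈ Q, Y y + pairField w y ∈ d.Sig s mu
  measure_S : (1 - 2 * ε) * volume.real Q ≤ volume.real (Q ∩ {y | Y y + pairField w y ∈ d.S s mu})
  measure_Si : ∀ k, lam / mu * volume.real (Q ∩ {y | Y y ∈ d.Si k r lam}) +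
    (d.stageWeight lam mu - 2 * ε) * volume.real Q ≤
      volume.real (Q ∩ {y | Y y + pairField w y ∈ d.Si k s mu})
  lintegral_le : ∫⁻ y in Q, ‖pairField w y‖ₑ ≤ ENNReal.ofReal
    (C * (volume.real (Q ∩ {y | Y y ∉ d.S r lam}) + (ε + (mu - lam)) * volume.real Q))

namespace Witnesses

variable {d : ONData m n N}

/-- The good set `E₀` is bounded by all of `Q` in the first term, so the estimate stays usable when
only a lower bound for its measure is known. -/
theorem lintegral_enorm_le {E : Type*} [NormedAddCommGroup E] {Z : SpaceTime n → E}
    {Q E₀ : Set (SpaceTime n)} (hQ : MeasurableSet Q) (hE : MeasurableSet E₀) (hEQ : E₀ ⊆ Q)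
    (hfin : volume Q ≠ ⊤) {a D : ℝ} (ha : 0 ≤ a) (hD : 0 ≤ D) (h1 : ∀ y ∈ E₀, ‖Z y‖ ≤ a)
    (h2 : ∀ y ∈ Q, ‖Z y‖ ≤ D) : ∫⁻ y in Q, ‖Z y‖ₑ ≤
      ENNReal.ofReal (a * volume.real Q + D * (volume.real Q - volume.real E₀)) := by
  have hconst : ∀ (A : Set (SpaceTime n)) (b : ℝ), MeasurableSet A → A ⊆ Q → 0 ≤ b →
      (∀ y ∈ A, ‖Z y‖ ≤ b) → ∫⁻ y in A, ‖Z y‖ₑ ≤ ENNReal.ofReal (b * volume.real A) := by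
    intro A b hA hAQ hb h
    have hAfin : volume A ≠ ⊤ := ((measure_mono hAQ).trans_lt hfin.lt_top).ne
    calc ∫⁻ y in A, ‖Z y‖ₑ ≤ ∫⁻ _ in A, ENNReal.ofReal b := by
          refine setLIntegral_mono' hA fun y hy => ?_
          rw [← ofReal_norm]
          exact ENNReal.ofReal_le_ofReal (h y hy)
      _ = ENNReal.ofReal (b * volume.real A) := by
          rw [setLIntegral_const, ENNReal.ofReal_mul hb, ofReal_measureReal hAfin]
  rw [← inter_union_sdiff Q E₀, inter_eq_self_of_subset_right hEQ,
    lintegral_union (hQ.diff hE) disjoint_sdiff_right, union_sdiff_cancel hEQ]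
  refine (add_le_add (hconst E₀ a hE hEQ ha h1)
    (hconst (Q \ E₀) D (hQ.diff hE) sdiff_subset hD fun y hy => h2 y hy.1)).trans ?_
  rw [← ENNReal.ofReal_add (by positivity) (by positivity), measureReal_sdiff hEQ hE hfin]
  apply ENNReal.ofReal_le_ofReal
  gcongr

/-- As `S_i^r(lam)` is open, `Y` stays in it on small cubes, and by disjointness only `k = i` has
measure to preserve; the ray point `p` of parameter `mu` provides it with weight `lam / mu`. For
(g), where the new value is near `p` the change is of order `ε + (mu - lam)`; elsewhere it is at
most the diameter of `Σ(1)`, on a proportion at most `1 - lam / mu + ε`. -/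
theorem eventually_isStage_of_mem_Si (h : d.Witnesses σ) {Y : SpaceTime n → MatPair m n}
    {G : Set (SpaceTime n)} (hG : IsOpen G) (hY : ContinuousOn Y G) {r s lam mu ε : ℝ}
    (hr : 0 < r) (hrs : r < s) (hs : s < d.r₀) (h0 : d.δ₀ ≤ lam) (hlm : lam < mu) (hmu1 : mu < 1)
    (hε : 0 < ε) (hYS : ∀ y ∈ G, Y y ∈ d.Sig r lam) {x : SpaceTime n} (hx : x ∈ G) {i : Fin N}
    (hxi : Y x ∈ d.Si i r lam) :
    ∀ᶠ R in 𝓝[>] (0 : ℝ), ∃ w, d.IsStage Y r lam s mu ε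
      (2 + 2 * |Metric.diam d.SigOne / d.δ₀|) (Metric.ball x R) w := by
  have hδ1 := h.δ₁_pos
  have hδ2 := h.δ₁_lt_δ₂
  have hδ0 := h.δ₀_mem.1
  have hδ0pos : 0 < d.δ₀ := by linarith
  have hl0 : 0 < lam := by linarith
  have hmu0 : 0 < mu := by linarith
  have hs0 : 0 < s := hr.trans hrs
  have hmuIco : mu ∈ Ico d.δ₀ 1 := ⟨by linarith, hmu1⟩
  have hlamIco : lam ∈ Ico d.δ₀ 1 := ⟨h0, by linarith⟩
  obtain ⟨ρ, hρ, hρY⟩ := mem_Si.1 hxi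
  obtain ⟨K, c, hK, hKS, hc, hcall, hck, hci, hcp⟩ :=
    h.exists_realizes_of_mem_Si hrs hs.le h0 hlm hmu1 hε (i := i) hρ
  rw [hρY] at hc
  have hopenSi : ∀ k, IsOpen (d.Si k s mu) := h.Si_isOpen s mu hs0 hs.le (Or.inr hmuIco)
  have hTk : ∀ k, d.closedSi k r mu ⊆ d.Si k s mu := by
    rintro k _ ⟨ρ, hρ, rfl⟩
    exact d.ray_mem_Si k mu ((mem_closedBall_zero_iff.1 hρ).trans_lt hrs)
  -- The index `none` stands for the union `S^s(mu)`, and `some k` for `S_k^s(mu)`.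
  have hev := hc.eventually_exists_ball (ι := Option (Fin N)) hK
    (h.isOpen_Sig hs0 hs.le hmu1) hKS
    (T := fun o => o.elim (⋃ k, d.closedSi k r mu) fun k => d.closedSi k r mu)
    (O := fun o => o.elim (d.S s mu) fun k => d.Si k s mu)
    (by
      rintro (_ | k)
      · exact isCompact_iUnion fun k => h.isCompact_closedSi k mu (hrs.trans hs).le
      · exact h.isCompact_closedSi k mu (hrs.trans hs).le)
    (by
      rintro (_ | k)
      · exact isOpen_iUnion hopenSi
      · exact hopenSi k)
    (by
      rintro (_ | k)
      · exact iUnion_mono hTk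
      · exact hTk k)
    (hY.continuousAt (hG.mem_nhds hx)) hε
  have hA : IsOpen (G ∩ Y ⁻¹' d.Si i r lam) :=
    hY.isOpen_inter_preimage hG
      (h.Si_isOpen r lam hr (hrs.trans hs).le (Or.inr hlamIco) i)
  obtain ⟨R₀, hR₀, hR₀A⟩ := Metric.isOpen_iff.1 hA x ⟨hx, hxi⟩
  filter_upwards [hev, Ioo_mem_nhdsGT hR₀] with R ⟨hclose, w, hw, hd, hmem, hmeas, hp⟩ hR
  have hQA : Metric.ball x R ⊆ G ∩ Y ⁻¹' d.Si i r lam :=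
    (Metric.ball_subset_ball hR.2.le).trans hR₀A
  set Q := Metric.ball x R with hQ
  have hQfin : volume Q ≠ ⊤ := measure_ball_lt_top.ne
  have hV : 0 ≤ volume.real Q := measureReal_nonneg
  refine ⟨w, hw, hd, hmem, ?_, fun k => ?_, ?_⟩
  -- One `ε` is the mass the laminate misses, the other is the error of its realization.
  · have := hmeas none
    exact le_trans (mul_le_mul_of_nonneg_right (by simp only [Option.elim]; linarith) hV) this
  · have hk := hmeas (some k)
    simp only [Option.elim] at hk
    refine le_trans ?_ hk
    rcases eq_or_ne k i with rfl | hki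
    · have e1 : volume.real (Q ∩ {y | Y y ∈ d.Si k r lam}) ≤ volume.real Q :=
        measureReal_mono inter_subset_left hQfin
      have e2 : lam / mu * volume.real (Q ∩ {y | Y y ∈ d.Si k r lam}) ≤
          lam / mu * volume.real Q := mul_le_mul_of_nonneg_left e1 (by positivity)
      have e3 : (lam / mu + d.stageWeight lam mu) * volume.real Q ≤
          c (d.closedSi k r mu) * volume.real Q := mul_le_mul_of_nonneg_right hci hV
      have e4 : 0 ≤ ε * volume.real Q := by positivity
      linarith
    · have e1 : Q ∩ {y | Y y ∈ d.Si k r lam} = ∅ := by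
        rw [← disjoint_iff_inter_eq_empty, Set.disjoint_left]
        intro y hy hyk
        exact Set.disjoint_left.1 (h.Si_disjoint r lam hr (hrs.trans hs).le (Or.inr hlamIco)
          k i hki) hyk (hQA hy).2
      rw [e1, measureReal_empty, mul_zero, zero_add]
      have e3 : d.stageWeight lam mu ≤ c (d.closedSi k r mu) := hck k
      apply mul_le_mul_of_nonneg_right _ hV
      linarith
  · set D := Metric.diam d.SigOne with hDdef
    have hD : 0 ≤ D := Metric.diam_nonneg
    have hdiam : ∀ a ∈ d.SigOne, ∀ b ∈ d.SigOne, ‖a - b‖ ≤ D := fun a ha b hb => by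
      rw [← dist_eq_norm]
      exact Metric.dist_le_diam_of_mem h.isBounded_SigOne ha hb
    have hSig1 : d.Sig s mu ⊆ d.SigOne := d.Sig_subset_SigOne hs.le hmuIco.1 hmu1
    have hSig2 : d.Sig r lam ⊆ d.SigOne := (d.Sig_mono hrs.le hlm.le).trans hSig1
    set p := d.ray i mu ρ with hpdef
    -- `p - Y x` is `(mu - lam) / lam` times the difference of two points of `Σ(1)`, and `lam ≥ δ₀`.
    have hpx : ‖p - Y x‖ ≤ (mu - lam) * (D / d.δ₀) := by
      have e1 : p - Y x = ((mu - lam) / lam) • (d.ray i lam ρ - d.vertex i ρ) := by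
        rw [hpdef, ← hρY, ray_sub_vertex, ray_eq, ray_eq, smul_smul]
        rw [show (mu - lam) / lam * (lam * d.κ i ρ) = (mu - lam) * d.κ i ρ by field_simp]
        module
      have e2 : ‖d.ray i lam ρ - d.vertex i ρ‖ ≤ D := by
        have hsub := h.segment_subset_Li i (lam := lam) (hrs.trans hs).le hρ
        apply hdiam
        · exact hSig2 (ONData.mem_Sig.2 ⟨lam, ⟨h0, le_rfl⟩, i, hsub (left_mem_segment ℝ _ _)⟩)
        · exact hSig2 (ONData.mem_Sig.2 ⟨lam, ⟨h0, le_rfl⟩, i, hsub (right_mem_segment ℝ _ _)⟩)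
      rw [e1, norm_smul, Real.norm_of_nonneg (div_nonneg (by linarith) hl0.le), div_mul_eq_mul_div,
        mul_div_assoc]
      have hml : 0 ≤ mu - lam := by linarith
      gcongr
    have hE : MeasurableSet (Q ∩ {y | ‖Y y + pairField w y - p‖ < ε}) := by
      have hc' : ContinuousOn (fun y => ‖Y y + pairField w y - p‖) Q :=
        (((hY.mono (hQA.trans inter_subset_left)).add
          (continuous_pairField hw.1).continuousOn).sub continuousOn_const).norm
      exact (hc'.isOpen_inter_preimage Metric.isOpen_ball (isOpen_Iio (a := ε))).measurableSet
    refine (lintegral_enorm_le Metric.isOpen_ball.measurableSet hE inter_subset_left hQfin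
      (a := 2 * ε + (mu - lam) * (D / d.δ₀)) (D := D) ?_ hD ?_ ?_).trans ?_
    · have : 0 ≤ (mu - lam) * (D / d.δ₀) := mul_nonneg (by linarith) (by positivity)
      linarith
    · rintro y ⟨hy, hyp⟩
      have e1 : pairField w y = (Y y + pairField w y - p) + (p - Y x) - (Y y - Y x) := by abel
      rw [e1]
      refine (norm_sub_le _ _).trans ?_
      have e2 := norm_add_le (Y y + pairField w y - p) (p - Y x)
      have e3 := hclose y hy
      rw [mem_ofPred_eq] at hyp
      linarith
    · intro y hy
      have := hdiam _ (hSig1 (hmem y hy)) _ (hSig2 (hYS y (hQA hy).1))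
      rwa [add_sub_cancel_left] at this
    -- The sum is at most `2 ε + (mu - lam) D / δ₀ + D ((mu - lam) / δ₀ + ε)` times `|Q|`, whence
    -- the constant `2 + 2 D / δ₀`.
    · apply ENNReal.ofReal_le_ofReal
      have e1 := hp p
      have e2 : (lam / mu - ε) * volume.real Q ≤ (c {p} - ε) * volume.real Q :=
        mul_le_mul_of_nonneg_right (by linarith) hV
      have e3 : D * (volume.real Q - volume.real (Q ∩ {y | ‖Y y + pairField w y - p‖ < ε})) ≤
          D * (volume.real Q - (lam / mu - ε) * volume.real Q) := by
        gcongr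
        linarith
      have e4 : 1 - lam / mu ≤ (mu - lam) / d.δ₀ := by
        rw [show 1 - lam / mu = (mu - lam) / mu by field_simp]
        have : 0 ≤ mu - lam := by linarith
        gcongr
        exact hmuIco.1
      have e5 : D * ((1 - lam / mu) * volume.real Q) ≤
          D * ((mu - lam) / d.δ₀ * volume.real Q) := by gcongr
      have e6 : D ≤ D / d.δ₀ := by
        rw [le_div_iff₀ hδ0pos]
        exact mul_le_of_le_one_right hD h.δ₀_mem.2.le
      have e7 : D * (ε * volume.real Q) ≤ D / d.δ₀ * (ε * volume.real Q) := by gcongr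
      have hDδ : 0 ≤ D / d.δ₀ := by positivity
      rw [abs_of_nonneg hDδ]
      have e8 : 0 ≤ (2 + 2 * (D / d.δ₀)) * volume.real (Q ∩ {y | Y y ∉ d.S r lam}) := by positivity
      have e9 : 0 ≤ D / d.δ₀ * (ε * volume.real Q) := by positivity
      have e10 : 0 ≤ (mu - lam) * volume.real Q := mul_nonneg (by linarith) hV
      have e11 : D * ((mu - lam) / d.δ₀ * volume.real Q) =
          D / d.δ₀ * ((mu - lam) * volume.real Q) := by ring
      linarith

/-- Small cubes lie almost entirely outside `{Y ∈ S^r(lam)}`. The measure to be preserved in `S_k`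
is thus at most `ε |Q|`, and for (g) the crude bound by the diameter suffices, since `|Q|` is
controlled by the measure of `{Y ∉ S^r(lam)}` in `Q` plus `ε |Q|`. -/
theorem eventually_isStage_of_density (h : d.Witnesses σ) {Y : SpaceTime n → MatPair m n}
    {G : Set (SpaceTime n)} (hG : IsOpen G) (hY : ContinuousOn Y G) {r s lam mu ε : ℝ}
    (hr : 0 < r) (hrs : r < s) (hs : s < d.r₀) (h0 : d.δ₀ ≤ lam) (hlm : lam < mu) (hmu1 : mu < 1)
    (hε : 0 < ε) (hYS : ∀ y ∈ G, Y y ∈ d.Sig r lam) {x : SpaceTime n} (hx : x ∈ G)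
    (hxd : Filter.Tendsto (fun R => volume (G ∩ {y | Y y ∉ d.S r lam} ∩ Metric.closedBall x R) /
      volume (Metric.closedBall x R)) (𝓝[>] 0) (𝓝 1)) :
    ∀ᶠ R in 𝓝[>] (0 : ℝ), ∃ w, d.IsStage Y r lam s mu ε
      (2 + 2 * |Metric.diam d.SigOne / d.δ₀|) (Metric.ball x R) w := by
  have hδ1 := h.δ₁_pos
  have hδ2 := h.δ₁_lt_δ₂
  have hδ0 := h.δ₀_mem.1
  have hδ0pos : 0 < d.δ₀ := by linarith
  have hl0 : 0 < lam := by linarith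
  have hmu0 : 0 < mu := by linarith
  have hs0 : 0 < s := hr.trans hrs
  have hmuIco : mu ∈ Ico d.δ₀ 1 := ⟨by linarith, hmu1⟩
  have hlamIco : lam ∈ Ico d.δ₀ 1 := ⟨h0, by linarith⟩
  obtain ⟨K, c, hK, hKS, hc, hcall, hck⟩ :=
    h.exists_realizes_of_mem_Sig hrs hs.le hlm hmu1 hε (hYS x hx)
  have hopenSi : ∀ k, IsOpen (d.Si k s mu) := h.Si_isOpen s mu hs0 hs.le (Or.inr hmuIco)
  have hTk : ∀ k, d.closedSi k r mu ⊆ d.Si k s mu := by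
    rintro k _ ⟨ρ, hρ, rfl⟩
    exact d.ray_mem_Si k mu ((mem_closedBall_zero_iff.1 hρ).trans_lt hrs)
  have hev := hc.eventually_exists_ball (ι := Option (Fin N)) hK
    (h.isOpen_Sig hs0 hs.le hmu1) hKS
    (T := fun o => o.elim (⋃ k, d.closedSi k r mu) fun k => d.closedSi k r mu)
    (O := fun o => o.elim (d.S s mu) fun k => d.Si k s mu)
    (by
      rintro (_ | k)
      · exact isCompact_iUnion fun k => h.isCompact_closedSi k mu (hrs.trans hs).le
      · exact h.isCompact_closedSi k mu (hrs.trans hs).le)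
    (by
      rintro (_ | k)
      · exact isOpen_iUnion hopenSi
      · exact hopenSi k)
    (by
      rintro (_ | k)
      · exact iUnion_mono hTk
      · exact hTk k)
    (hY.continuousAt (hG.mem_nhds hx)) hε
  obtain ⟨R₀, hR₀, hR₀G⟩ := Metric.isOpen_iff.1 hG x hx
  have hdens : ∀ᶠ R in 𝓝[>] (0 : ℝ), ENNReal.ofReal (1 - ε) <
      volume (G ∩ {y | Y y ∉ d.S r lam} ∩ Metric.closedBall x R) /
        volume (Metric.closedBall x R) := by
    refine hxd.eventually (lt_mem_nhds ?_)
    rw [ENNReal.ofReal_lt_one]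
    linarith
  filter_upwards [hev, hdens, Ioo_mem_nhdsGT hR₀] with R ⟨hclose, w, hw, hd, hmem, hmeas, hp⟩
    hdR hR
  have hQG : Metric.ball x R ⊆ G := (Metric.ball_subset_ball hR.2.le).trans hR₀G
  have hcb : volume (Metric.closedBall x R) = volume (Metric.ball x R) :=
    Measure.addHaar_closedBall_eq_addHaar_ball _ _ _
  have hF : (1 - ε) * volume.real (Metric.ball x R) ≤
      volume.real (Metric.ball x R ∩ {y | Y y ∉ d.S r lam}) := by
    have hpos : volume (Metric.ball x R) ≠ 0 := (Metric.measure_ball_pos _ _ hR.1).ne'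
    -- The density theorem uses closed balls; spheres are null.
    have hle : volume (G ∩ {y | Y y ∉ d.S r lam} ∩ Metric.closedBall x R) ≤
        volume (Metric.ball x R ∩ {y | Y y ∉ d.S r lam}) := by
      have hsub : G ∩ {y | Y y ∉ d.S r lam} ∩ Metric.closedBall x R ⊆
          (Metric.ball x R ∩ {y | Y y ∉ d.S r lam}) ∪ Metric.sphere x R := by
        rintro y ⟨⟨hyG, hyS⟩, hyB⟩
        rw [← Metric.ball_union_sphere] at hyB
        rcases hyB with hyB | hyB
        · exact Or.inl ⟨hyB, hyS⟩
        · exact Or.inr hyB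
      refine (measure_mono hsub).trans ((measure_union_le _ _).trans ?_)
      rw [Measure.addHaar_sphere_of_ne_zero _ _ hR.1.ne', add_zero]
    rw [hcb] at hdR
    have h1 := (ENNReal.le_div_iff_mul_le (Or.inl hpos) (Or.inl measure_ball_lt_top.ne)).1 hdR.le
    have h2 := ENNReal.toReal_mono
      ((measure_mono inter_subset_left).trans_lt measure_ball_lt_top).ne (h1.trans hle)
    rw [ENNReal.toReal_mul] at h2
    refine le_trans ?_ h2
    apply mul_le_mul_of_nonneg_right _ measureReal_nonneg
    rw [ENNReal.toReal_ofReal']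
    exact le_max_left _ _
  set Q := Metric.ball x R with hQ
  have hQfin : volume Q ≠ ⊤ := measure_ball_lt_top.ne
  have hV : 0 ≤ volume.real Q := measureReal_nonneg
  refine ⟨w, hw, hd, hmem, ?_, fun k => ?_, ?_⟩
  · have := hmeas none
    exact le_trans (mul_le_mul_of_nonneg_right (by simp only [Option.elim]; linarith) hV) this
  · have hk := hmeas (some k)
    simp only [Option.elim] at hk
    refine le_trans ?_ hk
    have hopen : MeasurableSet (Q ∩ {y | Y y ∈ d.Si k r lam}) :=
      ((hY.mono hQG).isOpen_inter_preimage Metric.isOpen_ball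
        (h.Si_isOpen r lam hr (hrs.trans hs).le (Or.inr hlamIco) k)).measurableSet
    have hdisj : Disjoint (Q ∩ {y | Y y ∉ d.S r lam}) (Q ∩ {y | Y y ∈ d.Si k r lam}) := by
      rw [Set.disjoint_left]
      exact fun y hy hy' => hy.2 (mem_iUnion.2 ⟨k, hy'.2⟩)
    have e1 : volume.real (Q ∩ {y | Y y ∉ d.S r lam}) +
        volume.real (Q ∩ {y | Y y ∈ d.Si k r lam}) ≤ volume.real Q := by
      rw [← measureReal_union hdisj hopen
        ((measure_mono inter_subset_left).trans_lt hQfin.lt_top).ne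
        ((measure_mono inter_subset_left).trans_lt hQfin.lt_top).ne]
      exact measureReal_mono (union_subset inter_subset_left inter_subset_left) hQfin
    have e2 : lam / mu * volume.real (Q ∩ {y | Y y ∈ d.Si k r lam}) ≤
        1 * (ε * volume.real Q) := by
      refine mul_le_mul ((div_le_one hmu0).2 hlm.le) (by linarith) measureReal_nonneg zero_le_one
    have e3 : d.stageWeight lam mu * volume.real Q ≤ c (d.closedSi k r mu) * volume.real Q :=
      mul_le_mul_of_nonneg_right (hck k) hV
    linarith
  · set D := Metric.diam d.SigOne with hDdef
    have hD : 0 ≤ D := Metric.diam_nonneg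
    have hdiam : ∀ a ∈ d.SigOne, ∀ b ∈ d.SigOne, ‖a - b‖ ≤ D := fun a ha b hb => by
      rw [← dist_eq_norm]
      exact Metric.dist_le_diam_of_mem h.isBounded_SigOne ha hb
    have hSig1 : d.Sig s mu ⊆ d.SigOne := d.Sig_subset_SigOne hs.le hmuIco.1 hmu1
    have hSig2 : d.Sig r lam ⊆ d.SigOne := (d.Sig_mono hrs.le hlm.le).trans hSig1
    refine (lintegral_enorm_le Metric.isOpen_ball.measurableSet MeasurableSet.empty
      (empty_subset _) hQfin (a := 0) (D := D) le_rfl hD (by simp) ?_).trans ?_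
    · intro y hy
      have := hdiam _ (hSig1 (hmem y hy)) _ (hSig2 (hYS y (hQG hy)))
      rwa [add_sub_cancel_left] at this
    · apply ENNReal.ofReal_le_ofReal
      rw [measureReal_empty, zero_mul, zero_add, sub_zero]
      have e6 : D ≤ D / d.δ₀ := by
        rw [le_div_iff₀ hδ0pos]
        exact mul_le_of_le_one_right hD h.δ₀_mem.2.le
      have e1 : volume.real Q ≤ volume.real (Q ∩ {y | Y y ∉ d.S r lam}) +
          (ε + (mu - lam)) * volume.real Q := by
        have : 0 ≤ (mu - lam) * volume.real Q := mul_nonneg (by linarith) hV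
        linarith
      have hDδ : 0 ≤ D / d.δ₀ := by positivity
      rw [abs_of_nonneg hDδ]
      exact mul_le_mul (by linarith) e1 hV (by linarith)

/-- At almost every point of `G`, all small cubes carry a stage perturbation. -/
theorem ae_eventually_isStage (h : d.Witnesses σ) {Y : SpaceTime n → MatPair m n}
    {G : Set (SpaceTime n)} (hG : IsOpen G) (hY : ContinuousOn Y G) {r s lam mu ε : ℝ}
    (hr : 0 < r) (hrs : r < s) (hs : s < d.r₀) (h0 : d.δ₀ ≤ lam) (hlm : lam < mu) (hmu1 : mu < 1)
    (hε : 0 < ε) (hYS : ∀ y ∈ G, Y y ∈ d.Sig r lam) :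
    ∀ᵐ x, x ∈ G → ∀ᶠ R in 𝓝[>] (0 : ℝ), ∃ w, d.IsStage Y r lam s mu ε
      (2 + 2 * |Metric.diam d.SigOne / d.δ₀|) (Metric.ball x R) w := by
  have hlamIco : lam ∈ Ico d.δ₀ 1 := ⟨h0, by linarith⟩
  have hopen : IsOpen (G ∩ Y ⁻¹' d.S r lam) := hY.isOpen_inter_preimage hG
    (isOpen_iUnion fun k => h.Si_isOpen r lam hr (hrs.trans hs).le (Or.inr hlamIco) k)
  have hmeas : MeasurableSet (G ∩ {y | Y y ∉ d.S r lam}) := by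
    have : G ∩ {y | Y y ∉ d.S r lam} = G \ (G ∩ Y ⁻¹' d.S r lam) := by
      ext y
      simp
    rw [this]
    exact hG.measurableSet.diff hopen.measurableSet
  have hdens := (ae_restrict_iff' hmeas).1
    (Besicovitch.ae_tendsto_measure_inter_div volume (G ∩ {y | Y y ∉ d.S r lam}))
  filter_upwards [hdens] with x hxd hx
  by_cases hxS : Y x ∈ d.S r lam
  · obtain ⟨i, hi⟩ := mem_iUnion.1 hxS
    exact h.eventually_isStage_of_mem_Si hG hY hr hrs hs h0 hlm hmu1 hε hYS hx hi
  · exact h.eventually_isStage_of_density hG hY hr hrs hs h0 hlm hmu1 hε hYS hx (hxd ⟨hx, hxS⟩)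

end Witnesses

end ONData

/-! ### Derivatives up to the boundary; cubes as balls. -/

section ClosureCalculus

variable {m n : ℕ} {G : Set (SpaceTime n)}

theorem clDeriv_add {F : Type*} [NormedAddCommGroup F] [NormedSpace ℝ F] {f g : SpaceTime n → F}
    (hf : IsC1Closure G f) (hg : ContDiff ℝ ∞ g) {y : SpaceTime n} (hy : y ∈ closure G) :
    clDeriv G (f + g) y = clDeriv G f y + fderiv ℝ g y := by
  obtain ⟨-, f', hc, hd⟩ := hf
  rw [clDeriv_eq hc hd hy]
  exact clDeriv_eq (f' := fun y => f' y + fderiv ℝ g y)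
    (hc.add (hg.continuous_fderiv (by simp)).continuousOn)
    (fun z hz => (hd z hz).add (hg.differentiable (by simp) z).hasFDerivAt) hy

theorem spaceDiv_add {v w : SpaceTime n → Mat m n} (hv : IsC1Closure G v) (hw : ContDiff ℝ ∞ w)
    {y : SpaceTime n} (hy : y ∈ closure G) :
    spaceDiv G (v + w) y = spaceDiv G v y + divField w y := by
  change divMap m n (clDeriv G (v + w) y) = divMap m n (clDeriv G v y) + divMap m n (fderiv ℝ w y)
  rw [clDeriv_add hv hw hy, map_add]

theorem timeDeriv_add {F : Type*} [NormedAddCommGroup F] [NormedSpace ℝ F]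
    {f g : SpaceTime n → F} (hf : IsC1Closure G f) (hg : ContDiff ℝ ∞ g) {y : SpaceTime n}
    (hy : y ∈ closure G) : timeDeriv G (f + g) y = timeDeriv G f y + fderiv ℝ g y (0, 1) := by
  rw [timeDeriv, clDeriv_add hf hg hy]
  rfl

theorem spaceGrad_add {f g : SpaceTime n → EuclideanSpace ℝ (Fin m)} (hf : IsC1Closure G f)
    (hg : ContDiff ℝ ∞ g) {y : SpaceTime n} (hy : y ∈ closure G) :
    spaceGrad G (f + g) y = spaceGrad G f y + gradMap m n (fderiv ℝ g y) := by
  change gradMap m n (clDeriv G (f + g) y) = gradMap m n (clDeriv G f y) + _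
  rw [clDeriv_add hf hg hy, map_add]

theorem diffPair_add {u : SpaceTime n → EuclideanSpace ℝ (Fin m)} {v w : SpaceTime n → Mat m n}
    (hu : IsC1Closure G u) (hv : IsC1Closure G v) (hw : ContDiff ℝ ∞ w) {y : SpaceTime n}
    (hy : y ∈ closure G) :
    diffPair G (u + divField w) (v + w) y = diffPair G u v y + pairField w y := by
  rw [diffPair, spaceGrad_add hu (contDiff_divField hw) hy, timeDeriv_add hv hw hy]
  rfl

theorem continuousOn_clDeriv {F : Type*} [NormedAddCommGroup F] [NormedSpace ℝ F]
    {f : SpaceTime n → F} (hf : IsC1Closure G f) : ContinuousOn (clDeriv G f) (closure G) := by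
  obtain ⟨-, f', hc, hd⟩ := hf
  exact hc.congr fun y hy => clDeriv_eq hc hd hy

theorem continuousOn_diffPair {u : SpaceTime n → EuclideanSpace ℝ (Fin m)}
    {v : SpaceTime n → Mat m n} (hu : IsC1Closure G u) (hv : IsC1Closure G v) :
    ContinuousOn (diffPair G u v) (closure G) := by
  refine (WithLp.prod_continuous_toLp 2 _ _).comp_continuousOn (ContinuousOn.prodMk ?_ ?_)
  · exact (gradMap m n).continuous.comp_continuousOn (continuousOn_clDeriv hu)
  · exact (continuousOn_clDeriv hv).clm_apply continuousOn_const

/-- `SpaceTime n` carries the sup norm, so the Besicovitch density and covering theorems for balls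
apply directly to axis-parallel cubes. -/
theorem cube_eq_ball (c : SpaceTime n) {l : ℝ} (hl : 0 < l) : cube c l = Metric.ball c l := by
  ext y
  rw [Metric.mem_ball, Prod.dist_eq, max_lt_iff, dist_pi_lt_iff hl]
  rfl

end ClosureCalculus

/-! ### Covering by finitely many disjoint small cubes. -/

section Covering

variable {n : ℕ}

/-- Up to a small proportion, a bounded open set is a finite disjoint union of small cubes whose
centres and radii have a given property, which holds for all small cubes at almost every point. -/
theorem exists_finite_disjoint_balls {G : Set (SpaceTime n)} (hG : IsOpen G)
    (hGb : Bornology.IsBounded G) (hGne : G.Nonempty) {P : SpaceTime n → ℝ → Prop}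
    (hP : ∀ᵐ x, x ∈ G → ∀ᶠ R in 𝓝[>] (0 : ℝ), P x R) {ε : ℝ} (hε : 0 < ε) :
    ∃ (M : ℕ) (c : Fin M → SpaceTime n) (l : Fin M → ℝ),
      (∀ j, 0 < l j ∧ l j < ε ∧ P (c j) (l j) ∧ Metric.ball (c j) (l j) ⊆ G) ∧
      Pairwise (Function.onFun Disjoint fun j => Metric.ball (c j) (l j)) ∧
      volume.real (G \ ⋃ j, Metric.ball (c j) (l j)) < ε * volume.real G := by
  have hGfin : volume G ≠ ⊤ := hGb.measure_lt_top.ne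
  have hGpos : 0 < volume G := hG.measure_pos volume hGne
  set s₀ : Set (SpaceTime n) := {x | x ∈ G ∧ ∀ᶠ R in 𝓝[>] (0 : ℝ), P x R} with hs₀
  have hnull : volume (G \ s₀) = 0 := by
    rw [ae_iff] at hP
    refine measure_mono_null (fun x hx => ?_) hP
    exact fun h => hx.2 ⟨hx.1, h hx.1⟩
  obtain ⟨t, r, htc, hts, hr, htnull, htd⟩ := Besicovitch.exists_disjoint_closedBall_covering_ae
    volume (fun x => {R | P x R ∧ Metric.ball x R ⊆ G}) s₀ (by
      intro x hx δ hδ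
      obtain ⟨R₀, hR₀, hR₀G⟩ := Metric.isOpen_iff.1 hG x hx.1
      obtain ⟨R, hR1, hR2, hR3⟩ :=
        (hx.2.and (Filter.Eventually.and (Ioo_mem_nhdsGT hR₀) (Ioo_mem_nhdsGT hδ))).exists
      exact ⟨R, ⟨hR1, (Metric.ball_subset_ball hR2.2.le).trans hR₀G⟩, hR3⟩)
    (fun _ => ε) fun _ _ => hε
  have htsum : volume G ≤ ∑' x : t, volume (Metric.ball (x : SpaceTime n) (r x)) := by
    have : Countable t := htc
    calc volume G ≤ volume ((G \ s₀) ∪ ((s₀ \ ⋃ x ∈ t, Metric.closedBall x (r x)) ∪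
            ⋃ x ∈ t, Metric.closedBall x (r x))) := by
          refine measure_mono fun x hx => ?_
          by_cases h1 : x ∈ s₀
          · by_cases h2 : x ∈ ⋃ x ∈ t, Metric.closedBall x (r x)
            · exact Or.inr (Or.inr h2)
            · exact Or.inr (Or.inl ⟨h1, h2⟩)
          · exact Or.inl ⟨hx, h1⟩
      _ ≤ 0 + (0 + volume (⋃ x ∈ t, Metric.closedBall x (r x))) := by
          refine (measure_union_le _ _).trans (add_le_add hnull.le ?_)
          exact (measure_union_le _ _).trans (add_le_add htnull.le le_rfl)
      _ = volume (⋃ x : t, Metric.closedBall (x : SpaceTime n) (r x)) := by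
          rw [zero_add, zero_add, biUnion_eq_iUnion]
      _ ≤ ∑' x : t, volume (Metric.closedBall (x : SpaceTime n) (r x)) := measure_iUnion_le _
      _ = _ := tsum_congr fun x => Measure.addHaar_closedBall_eq_addHaar_ball _ _ _
  -- The strict inequality, valid because `|G|` is positive and finite, lets a finite partial sum
  -- suffice.
  have hlt : volume G - ENNReal.ofReal ε * volume G <
      ∑' x : t, volume (Metric.ball (x : SpaceTime n) (r x)) := by
    refine (ENNReal.sub_lt_self hGfin hGpos.ne' ?_).trans_le htsum
    exact mul_ne_zero (ENNReal.ofReal_pos.2 hε).ne' hGpos.ne'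
  rw [ENNReal.tsum_eq_iSup_sum, lt_iSup_iff] at hlt
  obtain ⟨F, hF⟩ := hlt
  let e := F.equivFin.symm
  have hdisj : Pairwise (Function.onFun Disjoint fun j =>
      Metric.ball ((e j : t) : SpaceTime n) (r (e j : t))) := by
    intro i j hij
    refine (htd (e i : t).2 (e j : t).2 ?_).mono Metric.ball_subset_closedBall
      Metric.ball_subset_closedBall
    exact fun h => hij (e.injective (Subtype.ext (Subtype.ext h)))
  refine ⟨F.card, fun j => (e j : t), fun j => r (e j : t), fun j => ?_, hdisj, ?_⟩
  · obtain ⟨⟨h1, h2⟩, h3, h4⟩ := hr _ (e j : t).2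
    exact ⟨h3, h4, h1, h2⟩
  · set U := ⋃ j, Metric.ball ((e j : t) : SpaceTime n) (r (e j : t)) with hU
    have hUG : U ⊆ G := iUnion_subset fun j => (hr _ (e j : t).2).1.2
    have hUm : MeasurableSet U := (isOpen_iUnion fun j => Metric.isOpen_ball).measurableSet
    have hUfin : volume U ≠ ⊤ := ((measure_mono hUG).trans_lt hGfin.lt_top).ne
    have hvol : volume U = ∑ x ∈ F, volume (Metric.ball (x : SpaceTime n) (r x)) := by
      rw [hU, measure_iUnion hdisj fun j => Metric.isOpen_ball.measurableSet, tsum_fintype,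
        ← Finset.sum_coe_sort F]
      exact Equiv.sum_comp e fun x : F =>
        volume (Metric.ball ((x : t) : SpaceTime n) (r (x : t)))
    rw [← hvol] at hF
    have h1 : volume G < ENNReal.ofReal ε * volume G + volume U :=
      ENNReal.lt_add_of_sub_lt_left (Or.inl hGfin) hF
    have h2 := ENNReal.toReal_strict_mono
      (ENNReal.add_ne_top.2 ⟨ENNReal.mul_ne_top ENNReal.ofReal_ne_top hGfin, hUfin⟩) h1
    rw [ENNReal.toReal_add (ENNReal.mul_ne_top ENNReal.ofReal_ne_top hGfin) hUfin,
      ENNReal.toReal_mul, ENNReal.toReal_ofReal hε.le] at h2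
    rw [measureReal_sdiff hUG hUm hGfin]
    simp only [measureReal_def]
    linarith

end Covering

/-! ### Gluing fields with disjoint supports. -/

section Gluing

/-- Restricting the measure to `A` turns this into additivity over the measurable sets `Q j`, so `A`
itself may be arbitrary. -/
theorem sum_measureReal_inter {X ι : Type*} [MeasurableSpace X] {μ : Measure X} [Fintype ι]
    {Q : ι → Set X} (hd : Pairwise (Function.onFun Disjoint Q)) (hm : ∀ j, MeasurableSet (Q j))
    (hfin : ∀ j, μ (Q j) ≠ ⊤) (A : Set X) :
    ∑ j, μ.real (Q j ∩ A) = μ.real ((⋃ j, Q j) ∩ A) := by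
  simp only [measureReal_def]
  rw [← Measure.restrict_apply (MeasurableSet.iUnion hm), measure_iUnion hd hm, tsum_fintype,
    ENNReal.toReal_sum]
  · exact Finset.sum_congr rfl fun j _ => by rw [Measure.restrict_apply (hm j)]
  · intro j _
    exact ((Measure.restrict_apply_le _ _).trans_lt (hfin j).lt_top).ne

variable {m n : ℕ}

/-- In each of the disjoint sets `Q j`, the sum of fields supported in these sets is governed by the
field with index `j`. -/
theorem fields_sum_eq {M : ℕ} {Q : Fin M → Set (SpaceTime n)}
    (hd : Pairwise (Function.onFun Disjoint Q)) {W : Fin M → SpaceTime n → Mat m n}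
    (hW : ∀ j, IsTestFun (Q j) (W j)) {j : Fin M} {y : SpaceTime n} (hy : y ∈ Q j) :
    divField (∑ i, W i) y = divField (W j) y ∧
    fderiv ℝ (divField (∑ i, W i)) y = fderiv ℝ (divField (W j)) y ∧
      pairField (∑ i, W i) y = pairField (W j) y := by
  have hs : ∀ i ∈ Finset.univ, ContDiff ℝ ∞ (W i) := fun i _ => (hW i).1
  have hz : ∀ i, i ≠ j → y ∉ tsupport (W i) := fun i hij hi =>
    Set.disjoint_left.1 (hd hij) ((hW i).2.2 hi) hy
  refine ⟨?_, ?_, ?_⟩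
  · rw [divField_sum _ hs]
    exact Finset.sum_eq_single j (fun i _ hij => (fderiv_divField_eq_zero (hz i hij)).1) (by simp)
  · rw [fderiv_divField_sum _ hs]
    exact Finset.sum_eq_single j (fun i _ hij => (fderiv_divField_eq_zero (hz i hij)).2.1) (by simp)
  · rw [pairField_sum _ hs]
    exact Finset.sum_eq_single j (fun i _ hij => (fderiv_divField_eq_zero (hz i hij)).2.2) (by simp)

theorem fields_sum_eq_zero {M : ℕ} {Q : Fin M → Set (SpaceTime n)}
    {W : Fin M → SpaceTime n → Mat m n} (hW : ∀ j, IsTestFun (Q j) (W j)) {y : SpaceTime n}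
    (hy : y ∉ ⋃ j, Q j) :
    divField (∑ i, W i) y = 0 ∧ fderiv ℝ (divField (∑ i, W i)) y = 0 ∧
      pairField (∑ i, W i) y = 0 := by
  apply fderiv_divField_eq_zero
  intro h
  have hU : ∀ i ∈ Finset.univ, IsTestFun (⋃ j, Q j) (W i) := fun i _ =>
    (hW i).mono (subset_iUnion Q i)
  exact hy ((IsTestFun.sum Finset.univ hU).2.2 h)

end Gluing

namespace ONData

variable {m n N : ℕ} {σ : Mat m n → Mat m n} {d : ONData m n N}

/-- Positivity provides the room into which all errors of (f) are absorbed; the bound by `1`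
controls the products of this weight with the error. -/
theorem Witnesses.stageWeight_mem (h : d.Witnesses σ) {lam mu : ℝ} (h0 : d.δ₀ ≤ lam)
    (hlm : lam < mu) (hmu1 : mu < 1) : d.stageWeight lam mu ∈ Ioo (0 : ℝ) 1 := by
  have h1 := h.δ₁_pos
  have h2 := h.δ₁_lt_δ₂
  have h3 := h.δ₂_lt_one
  have h4 := h.δ₀_mem.1
  have ha : 0 < mu - lam := by linarith
  have hb : 0 < mu - d.δ₂ := by linarith
  have hc : (mu - d.δ₂) ^ (N - 1) ≤ 1 := pow_le_one₀ hb.le (by linarith)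
  refine ⟨by unfold stageWeight; positivity, ?_⟩
  have hd : (mu - lam) * (mu - d.δ₂) ^ (N - 1) ≤ 1 := mul_le_one₀ (by linarith) (by positivity) hc
  calc d.stageWeight lam mu ≤ 1 * d.δ₁ := mul_le_mul_of_nonneg_right hd h1.le
    _ < 1 := by linarith

end ONData

theorem theorem4p1 :
    -- the constant depends only on `δ₀` and on the diameter of `Σ(1)`
    ∃ C₀ : ℝ → ℝ → ℝ, (∀ a b, 0 < C₀ a b) ∧
    ∀ (m n N : ℕ), 1 ≤ m → 1 ≤ n → 2 ≤ N →
    ∀ (σ : Mat m n → Mat m n) (d : ONData m n N), d.Witnesses σ →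
    ∀ (G : Set (SpaceTime n)), IsOpen G → Bornology.IsBounded G → G.Nonempty →
    ∀ (u : SpaceTime n → EuclideanSpace ℝ (Fin m)) (v : SpaceTime n → Mat m n),
    IsC1Closure G u → IsC1Closure G v →
    ∀ (r lam : ℝ), 0 < r → r < d.r₀ → d.δ₀ ≤ lam → lam < 1 →
    (∀ y ∈ closure G, u y = spaceDiv G v y ∧ diffPair G u v y ∈ d.Sig r lam) →
    ∀ (mu s ε : ℝ), lam < mu → mu < 1 → r < s → s < d.r₀ → 0 < ε → ε < 1 →
    ∃ (u' : SpaceTime n → EuclideanSpace ℝ (Fin m)) (v' : SpaceTime n → Mat m n)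
      (M : ℕ) (c : Fin M → SpaceTime n) (l : Fin M → ℝ),
      IsTestFun G (u' - u) ∧ IsTestFun G (v' - v) ∧
      -- the cubes
      (∀ j, cube (c j) (l j) ⊆ G) ∧
      (∀ i j, i ≠ j → Disjoint (cube (c i) (l i)) (cube (c j) (l j))) ∧
      volume.real (G \ ⋃ j, cube (c j) (l j)) < ε * volume.real G ∧
      -- (a)
      (∀ j, 0 < l j ∧ l j < ε) ∧
      -- (b)
      (∀ y ∈ closure G, u' y = spaceDiv G v' y ∧ diffPair G u' v' y ∈ d.Sig s mu) ∧
      -- (c)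
      eLpNorm (u' - u) ⊤ (volume.restrict G) +
        eLpNorm (timeDeriv G u' - timeDeriv G u) ⊤ (volume.restrict G) < ENNReal.ofReal ε ∧
      -- (d)
      (∀ j, (1 - ε) * volume.real (cube (c j) (l j)) ≤
        volume.real (cube (c j) (l j) ∩ {y | diffPair G u' v' y ∈ d.S s mu})) ∧
      -- (e)
      (1 - ε) * volume.real G ≤ volume.real (G ∩ {y | diffPair G u' v' y ∈ d.S s mu}) ∧
      -- (f)
      (∀ k : Fin N,
        (1 / 2) * (mu - lam) * (mu - d.δ₂) ^ (N - 1) * d.δ₁ * volume.real G ≤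
            volume.real (G ∩ {y | diffPair G u' v' y ∈ d.Si k s mu}) ∧
        (lam / mu) * volume.real (G ∩ {y | diffPair G u v y ∈ d.Si k r lam}) ≤
            volume.real (G ∩ {y | diffPair G u' v' y ∈ d.Si k s mu})) ∧
      -- (g)
      eLpNorm (spaceGrad G u' - spaceGrad G u) 1 (volume.restrict G) ≤
        ENNReal.ofReal (C₀ d.δ₀ (Metric.diam d.SigOne) *
          (volume.real (G ∩ {y | diffPair G u v y ∉ d.S r lam}) +
            (ε + (mu - lam)) * volume.real G)) := by
  -- The absolute value makes the constant positive for all real arguments.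
  refine ⟨fun a b => 2 + 2 * |b / a|, fun a b => by positivity, ?_⟩
  intro m n N _ _ _ σ d h G hG hGb hGne u v hu hv r lam hr hr0 h0 _ huv mu s ε hlm hmu1 hrs hs hε _
  have hq := h.stageWeight_mem h0 hlm hmu1
  have hlmu : 0 ≤ lam / mu ∧ lam / mu ≤ 1 := by
    have h1 := h.δ₁_pos
    have h2 := h.δ₁_lt_δ₂
    have h3 := h.δ₀_mem.1
    exact ⟨div_nonneg (by linarith) (by linarith), (div_le_one (by linarith)).2 hlm.le⟩
  -- (c) costs `2 η` and (e) costs `3 η`, against `ε`. In (f) the losses are `3 η` against half of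
  -- the stage weight, and `4 η` against the whole of it.
  obtain ⟨η, hη, hηε, hηq⟩ : ∃ η : ℝ, 0 < η ∧ 4 * η < ε ∧ 8 * η < d.stageWeight lam mu :=
    ⟨min ε (d.stageWeight lam mu) / 9, div_pos (lt_min hε hq.1) (by norm_num), by
      linarith [min_le_left ε (d.stageWeight lam mu)], by
      linarith [min_le_right ε (d.stageWeight lam mu), lt_min hε hq.1]⟩
  have hYc := (continuousOn_diffPair hu hv).mono (subset_closure (s := G))
  obtain ⟨M, c, l, hball, hdisj, hrest⟩ := exists_finite_disjoint_balls hG hGb hGne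
    (h.ae_eventually_isStage hG hYc hr hrs hs h0 hlm hmu1 hη
      fun y hy => (huv y (subset_closure hy)).2) hη
  choose W hW using fun j => (hball j).2.2.1
  have hl : ∀ j, 0 < l j := fun j => (hball j).1
  set Q : Fin M → Set (SpaceTime n) := fun j => Metric.ball (c j) (l j) with hQdef
  have hcube : ∀ j, cube (c j) (l j) = Q j := fun j => cube_eq_ball (c j) (hl j)
  have hQG : ∀ j, Q j ⊆ G := fun j => (hball j).2.2.2
  have hQm : ∀ j, MeasurableSet (Q j) := fun j => Metric.isOpen_ball.measurableSet
  have hQfin : ∀ j, volume (Q j) ≠ ⊤ := fun j => measure_ball_lt_top.ne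
  have hGfin : volume G ≠ ⊤ := hGb.measure_lt_top.ne
  have hfin : ∀ A, volume (G ∩ A) ≠ ⊤ := fun A =>
    ((measure_mono inter_subset_left).trans_lt hGfin.lt_top).ne
  set U := ⋃ j, Q j with hU
  have hUG : U ⊆ G := iUnion_subset hQG
  have hUm : MeasurableSet U := MeasurableSet.iUnion hQm
  have hWt : ∀ j, IsTestFun (Q j) (W j) := fun j => (hW j).isTestFun
  set w := ∑ j, W j with hw
  have hwt : IsTestFun G w := IsTestFun.sum _ fun j _ => (hWt j).mono (hQG j)
  have hin : ∀ {j y}, y ∈ Q j → divField w y = divField (W j) y ∧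
      fderiv ℝ (divField w) y = fderiv ℝ (divField (W j)) y ∧ pairField w y = pairField (W j) y :=
    fun hy => fields_sum_eq hdisj hWt hy
  have hout : ∀ {y}, y ∉ U → divField w y = 0 ∧ fderiv ℝ (divField w) y = 0 ∧
      pairField w y = 0 := fun hy => fields_sum_eq_zero hWt hy
  have hpair : ∀ y ∈ closure G, diffPair G (u + divField w) (v + w) y =
      diffPair G u v y + pairField w y := fun y hy => diffPair_add hu hv hwt.1 hy
  have hsmall : ∀ y, ‖divField w y‖ ≤ η ∧ ‖fderiv ℝ (divField w) y (0, 1)‖ ≤ η := by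
    intro y
    by_cases hy : y ∈ U
    · obtain ⟨j, hj⟩ := mem_iUnion.1 hy
      rw [(hin hj).1, (hin hj).2.1]
      exact ⟨((hW j).norm_div_lt y).1.le, ((hW j).norm_div_lt y).2.le⟩
    · rw [(hout hy).1, (hout hy).2.1]
      simp [hη.le]
  have hset : ∀ j (A : Set (MatPair m n)),
      Q j ∩ {y | diffPair G u v y + pairField (W j) y ∈ A} =
        Q j ∩ {y | diffPair G (u + divField w) (v + w) y ∈ A} := by
    intro j A
    ext y
    refine and_congr_right fun hy => ?_
    rw [mem_ofPred_eq, mem_ofPred_eq, hpair y (subset_closure (hQG j hy)), (hin hy).2.2]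
  have hsum : ∀ A, ∑ j, volume.real (Q j ∩ A) = volume.real (U ∩ A) :=
    sum_measureReal_inter hdisj hQm hQfin
  have hsumQ : ∑ j, volume.real (Q j) = volume.real U := by
    simpa only [inter_univ] using hsum univ
  have hUA : ∀ A, volume.real (U ∩ A) ≤ volume.real (G ∩ A) := fun A =>
    measureReal_mono (inter_subset_inter_left A hUG) (hfin A)
  have hUV : (1 - η) * volume.real G ≤ volume.real U := by
    rw [measureReal_sdiff hUG hUm hGfin] at hrest
    linarith
  have hV : 0 ≤ volume.real G := measureReal_nonneg
  have hUle : volume.real U ≤ volume.real G := measureReal_mono hUG hGfin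
  have hηV : 0 ≤ η * volume.real G := mul_nonneg hη.le hV
  have hηηV : 0 ≤ η * (η * volume.real G) := mul_nonneg hη.le hηV
  have hSj : ∀ j, (1 - 2 * η) * volume.real (Q j) ≤
      volume.real (Q j ∩ {y | diffPair G (u + divField w) (v + w) y ∈ d.S s mu}) := fun j => by
    rw [← hset]
    exact (hW j).measure_S
  refine ⟨u + divField w, v + w, M, c, l, ?_, ?_, ?_, ?_, ?_, ?_, ?_, ?_, ?_, ?_, ?_, ?_⟩
  · rw [add_sub_cancel_left]
    exact hwt.isTestFun_divField
  · rwa [add_sub_cancel_left]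
  · intro j
    rw [hcube]
    exact hQG j
  · intro i j hij
    rw [hcube, hcube]
    exact hdisj hij
  · simp only [hcube]
    refine hrest.trans_le (mul_le_mul_of_nonneg_right (by linarith) hV)
  · exact fun j => ⟨hl j, (hball j).2.1.trans (by linarith)⟩
  · intro y hy
    refine ⟨?_, ?_⟩
    · rw [spaceDiv_add hv hwt.1 hy, Pi.add_apply, (huv y hy).1]
    · rw [hpair y hy]
      by_cases hyU : y ∈ U
      · obtain ⟨j, hj⟩ := mem_iUnion.1 hyU
        rw [(hin hj).2.2]
        exact (hW j).mem_Sig y hj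
      · rw [(hout hyU).2.2, add_zero]
        exact d.Sig_mono hrs.le hlm.le (huv y hy).2
  · have e1 : eLpNorm (u + divField w - u) ⊤ (volume.restrict G) ≤ ENNReal.ofReal η := by
      rw [add_sub_cancel_left, eLpNorm_exponent_top]
      exact eLpNormEssSup_le_of_ae_bound (Filter.Eventually.of_forall fun y => (hsmall y).1)
    have e2 : eLpNorm (timeDeriv G (u + divField w) - timeDeriv G u) ⊤ (volume.restrict G) ≤
        ENNReal.ofReal η := by
      rw [eLpNorm_exponent_top]
      apply eLpNormEssSup_le_of_ae_bound
      filter_upwards [ae_restrict_mem hG.measurableSet] with y hy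
      rw [Pi.sub_apply, timeDeriv_add hu (contDiff_divField hwt.1) (subset_closure hy),
        add_sub_cancel_left]
      exact (hsmall y).2
    refine (add_le_add e1 e2).trans_lt ?_
    rw [← ENNReal.ofReal_add hη.le hη.le]
    exact (ENNReal.ofReal_lt_ofReal_iff hε).2 (by linarith)
  · intro j
    rw [hcube]
    exact (mul_le_mul_of_nonneg_right (by linarith) measureReal_nonneg).trans (hSj j)
  · refine le_trans ?_ (hUA _)
    rw [← hsum]
    refine le_trans ?_ (Finset.sum_le_sum fun j _ => hSj j)
    rw [← Finset.mul_sum, hsumQ]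
    have e1 : η * volume.real U ≤ η * volume.real G := mul_le_mul_of_nonneg_left hUle hη.le
    have e2 : 4 * η * volume.real G ≤ ε * volume.real G :=
      mul_le_mul_of_nonneg_right hηε.le hV
    linarith
  · intro k
    set q := d.stageWeight lam mu with hqdef
    have e1 : lam / mu * volume.real (U ∩ {y | diffPair G u v y ∈ d.Si k r lam}) +
        (q - 2 * η) * volume.real U ≤
          volume.real (U ∩ {y | diffPair G (u + divField w) (v + w) y ∈ d.Si k s mu}) := by
      rw [← hsum, ← hsum, ← hsumQ, Finset.mul_sum, Finset.mul_sum, ← Finset.sum_add_distrib]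
      refine Finset.sum_le_sum fun j _ => ?_
      rw [← hset]
      exact (hW j).measure_Si k
    have e2 := hUA {y | diffPair G (u + divField w) (v + w) y ∈ d.Si k s mu}
    have e3 : (q - 3 * η) * volume.real G ≤ (q - 2 * η) * volume.real U := by
      have a1 : (q - 2 * η) * ((1 - η) * volume.real G) ≤ (q - 2 * η) * volume.real U :=
        mul_le_mul_of_nonneg_left hUV (by linarith)
      have a2 : q * (η * volume.real G) ≤ 1 * (η * volume.real G) :=
        mul_le_mul_of_nonneg_right hq.2.le hηV
      linarith
    have e4 : 8 * η * volume.real G ≤ q * volume.real G := mul_le_mul_of_nonneg_right hηq.le hV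
    constructor
    · have a1 : 0 ≤ lam / mu * volume.real (U ∩ {y | diffPair G u v y ∈ d.Si k r lam}) :=
        mul_nonneg hlmu.1 measureReal_nonneg
      have a2 : 1 / 2 * (mu - lam) * (mu - d.δ₂) ^ (N - 1) * d.δ₁ * volume.real G =
          1 / 2 * (q * volume.real G) := by
        rw [hqdef, ONData.stageWeight]
        ring
      rw [a2]
      linarith
    -- The part of `S_k` missed by the cubes has measure less than `η |G|`; the gain `(q - 3 η) |G|`
    -- obtained in the cubes outweighs it.
    · have a1 : volume.real (G ∩ {y | diffPair G u v y ∈ d.Si k r lam}) ≤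
          volume.real (U ∩ {y | diffPair G u v y ∈ d.Si k r lam}) + volume.real (G \ U) := by
        refine le_trans (measureReal_mono ?_ ?_) (measureReal_union_le _ _)
        · intro y hy
          by_cases hyU : y ∈ U
          · exact Or.inl ⟨hyU, hy.2⟩
          · exact Or.inr ⟨hy.1, hyU⟩
        · refine ((measure_mono (union_subset (inter_subset_left.trans hUG) sdiff_subset)).trans_lt
            hGfin.lt_top).ne
      have a2 := mul_le_mul_of_nonneg_left (a1.trans (add_le_add_right hrest.le _)) hlmu.1
      have a3 : lam / mu * (η * volume.real G) ≤ 1 * (η * volume.real G) :=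
        mul_le_mul_of_nonneg_right hlmu.2 hηV
      linarith
  · set C := 2 + 2 * |Metric.diam d.SigOne / d.δ₀| with hC
    have hC0 : 0 ≤ C := by positivity
    have e1 : ∫⁻ y in G \ U, ‖pairField w y‖ₑ = 0 := by
      rw [setLIntegral_congr_fun (g := fun _ => 0) (hG.measurableSet.diff hUm)
        fun y hy => by simp only [(hout hy.2).2.2, enorm_zero], lintegral_zero]
    have e2 : ∫⁻ y in U, ‖pairField w y‖ₑ ≤ ENNReal.ofReal (∑ j, C * (volume.real
        (Q j ∩ {y | diffPair G u v y ∉ d.S r lam}) + (η + (mu - lam)) * volume.real (Q j))) := by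
      rw [hU, lintegral_iUnion hQm hdisj, tsum_fintype, ENNReal.ofReal_sum_of_nonneg]
      · refine Finset.sum_le_sum fun j _ => le_trans (le_of_eq ?_) (hW j).lintegral_le
        exact setLIntegral_congr_fun (hQm j) fun y hy => by simp only [(hin hy).2.2]
      · intro j _
        have : 0 ≤ η + (mu - lam) := by linarith
        positivity
    have e3 : eLpNorm (spaceGrad G (u + divField w) - spaceGrad G u) 1 (volume.restrict G) ≤
        ∫⁻ y in G, ‖pairField w y‖ₑ := by
      rw [eLpNorm_one_eq_lintegral_enorm]
      refine setLIntegral_mono' hG.measurableSet fun y hy => ?_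
      rw [Pi.sub_apply, spaceGrad_add hu (contDiff_divField hwt.1) (subset_closure hy),
        add_sub_cancel_left]
      -- The change of `Du` is the first component of `pairField w`.
      exact WithLp.enorm_fst_le _ (pairField w y)
    refine e3.trans ?_
    rw [← union_sdiff_cancel hUG, lintegral_union (hG.measurableSet.diff hUm) disjoint_sdiff_right,
      e1, add_zero, union_sdiff_cancel hUG]
    refine e2.trans (ENNReal.ofReal_le_ofReal ?_)
    rw [← Finset.mul_sum, Finset.sum_add_distrib, hsum, ← Finset.mul_sum, hsumQ]
    refine mul_le_mul_of_nonneg_left (add_le_add (hUA _) ?_) hC0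
    exact mul_le_mul (by linarith) hUle measureReal_nonneg (by linarith)
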